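/- Let $a<b<e$ and $c<d$ be real, let $B_j=(a,b)\times(c,d)$ and $B_\ell=(b,e)\times(c,d)$ be two adjacent boxes in $\mathbb R^2$, let $C=\partial B_j\cap\partial B_\ell$ be their common edge, and let $S_j\subset B_j$, $S_\ell\subset B_\ell$ be compact sets (the scatterers). Let $k>0$ and $\eta\in\mathbb R\setminus\{0\}$. For $m\in\{j,\ell\}$ let $H^{1/2}(\partial B_m)$ and $H^{1/2}(C)$ be the Sobolev–Slobodeckij spaces with respect to arc length, with norm $\|f\|^2=\int|f|^2\,ds+\iint\frac{|f(x)-f(y)|^2}{|x-y|^2}\,ds\,ds$; let $H^{-1/2}(\partial B_m)$ be the dual of $H^{1/2}(\partial B_m)$ and $\widetilde H^{-1/2}(C)$ the dual of $H^{1/2}(C)$; let $\widetilde H^{1/2}(C)$ be the space of functions on $C$ whose extension by zero lies in $H^{1/2}(\partial B_m)$, and $H^{-1/2}(C)$ its dual. All dualities extend the bilinear $L^2$ pairing. Thus $H^{1/2}(C)$ and $\widetilde H^{-1/2}(C)$ map naturally into $H^{-1/2}(C)$, every $\varphi\in\widetilde H^{-1/2}(C)$ extends by zero to $(0,\varphi)\in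 H^{-1/2}(\partial B_m)$, and every element of $H^{-1/2}(\partial B_m)$ restricts to an element of $H^{-1/2}(C)$. The block $\mathcal S^m_{CC}$ of the Robin-to-Robin map of $B_m$ maps $\varphi\in\widetilde H^{-1/2}(C)$ to $$\mathcal S^m_{CC}\varphi=(\partial_n w+i\eta w)|_C\in H^{-1/2}(C),$$ where $w\in H^1(B_m\setminus S_m)$ satisfies $$\Delta w+k^2w=0\ \text{in } B_m\setminus S_m,\qquad w=0\ \text{on }\partial S_m,\qquad \partial_n w-i\eta w=\varphi\ \text{on } C,\qquad \partial_n w-i\eta w=0\ \text{on }\partial B_m\setminus C.$$ Here $n$ is the unit normal exterior to $B_m$, $w=0$ on $\partial S_m$ means that $w$ is a limit in $H^1(B_m\setminus S_m)$ of smooth functions vanishing near $S_m$, the traces of $w$ on $\partial B_m$ are taken in $H^{1/2}(\partial B_m)$, $\partial_n w\in H^{-1/2}(\partial B_m)$ is defined by Green's formula, and the Robin condition is an identity in $H^{-1/2}(\partial B_m)$. Then $\mathcal S^j_{CC}$ and $\mathcal S^\ell_{CC}$ are well defined (for every $\varphi\in\widetilde H^{-1/2}(C)$ a solution $w$ exists,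 and $(\partial_n w+i\eta w)|_C$ does not depend on its choice), and there are continuous linear operators $\mathcal K^j,\mathcal K^\ell:\widetilde H^{-1/2}(C)\to H^{1/2}(C)$ such that $$\mathcal S^j_{CC}\varphi=\varphi+\mathcal K^j\varphi,\qquad \mathcal S^\ell_{CC}\varphi=\varphi+\mathcal K^\ell\varphi\qquad\text{in } H^{-1/2}(C),\quad \varphi\in\widetilde H^{-1/2}(C).$$ -/

import Mathlib

open MeasureTheory Filter Topology
open scoped ContDiff ENNReal

noncomputable section

namespace RtR

/-- The Euclidean plane. -/
abbrev Plane := EuclideanSpace ℝ (Fin 2)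

/-! ### Boxes and arc length -/

/-- The open box `(a, b) × (c, d)`. -/
def box (a b c d : ℝ) : Set Plane :=
  {x | (a < x 0 ∧ x 0 < b) ∧ (c < x 1 ∧ x 1 < d)}

/-- Arc length on a subset of the plane: the one-dimensional Hausdorff measure restricted to it. -/
def arc (Γ : Set Plane) : Measure Plane := (Measure.hausdorffMeasure 1).restrict Γ

theorem arc_mono {C Γ : Set Plane} (h : C ⊆ Γ) : arc C ≤ arc Γ :=
  Measure.restrict_mono h le_rfl

theorem frontier_box_subset (a b c d : ℝ) :
    frontier (box a b c d) ⊆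
      (segment ℝ (!₂[a, c] : Plane) !₂[a, d] ∪ segment ℝ (!₂[b, c] : Plane) !₂[b, d]) ∪
      (segment ℝ (!₂[a, c] : Plane) !₂[b, c] ∪ segment ℝ (!₂[a, d] : Plane) !₂[b, d]) := by
  intro x hx
  have h0 : Continuous fun y : Plane => y 0 := by fun_prop
  have h1 : Continuous fun y : Plane => y 1 := by fun_prop
  have hopen : IsOpen (box a b c d) :=
    ((isOpen_lt continuous_const h0).inter (isOpen_lt h0 continuous_const)).inter
      ((isOpen_lt continuous_const h1).inter (isOpen_lt h1 continuous_const))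
  have hcl : IsClosed {y : Plane | (a ≤ y 0 ∧ y 0 ≤ b) ∧ (c ≤ y 1 ∧ y 1 ≤ d)} :=
    ((isClosed_le continuous_const h0).inter (isClosed_le h0 continuous_const)).inter
      ((isClosed_le continuous_const h1).inter (isClosed_le h1 continuous_const))
  have hsub : box a b c d ⊆ {y : Plane | (a ≤ y 0 ∧ y 0 ≤ b) ∧ (c ≤ y 1 ∧ y 1 ≤ d)} :=
    fun y hy => ⟨⟨hy.1.1.le, hy.1.2.le⟩, ⟨hy.2.1.le, hy.2.2.le⟩⟩
  rw [hopen.frontier_eq] at hx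
  obtain ⟨⟨hxa, hxb⟩, hxc, hxd⟩ := closure_minimal hsub hcl hx.1
  have hvert : ∀ p : ℝ, x 0 = p → x ∈ segment ℝ (!₂[p, c] : Plane) !₂[p, d] := by
    intro p hp
    have : x 1 ∈ segment ℝ c d := by rw [segment_eq_Icc (hxc.trans hxd)]; exact ⟨hxc, hxd⟩
    obtain ⟨s, t, hs, ht, hst, h⟩ := this
    refine ⟨s, t, hs, ht, hst, ?_⟩
    ext i
    fin_cases i
    · simp [hp, ← add_mul, hst]
    · simpa using h
  have hhor : ∀ p : ℝ, x 1 = p → x ∈ segment ℝ (!₂[a, p] : Plane) !₂[b, p] := by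
    intro p hp
    have : x 0 ∈ segment ℝ a b := by rw [segment_eq_Icc (hxa.trans hxb)]; exact ⟨hxa, hxb⟩
    obtain ⟨s, t, hs, ht, hst, h⟩ := this
    refine ⟨s, t, hs, ht, hst, ?_⟩
    ext i
    fin_cases i
    · simpa using h
    · simp [hp, ← add_mul, hst]
  by_contra hne
  simp only [Set.mem_union, not_or] at hne
  refine hx.2 ⟨⟨lt_of_le_of_ne hxa fun h => hne.1.1 (hvert a h.symm),
    lt_of_le_of_ne hxb fun h => hne.1.2 (hvert b h)⟩,
    lt_of_le_of_ne hxc fun h => hne.2.1 (hhor c h.symm),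
    lt_of_le_of_ne hxd fun h => hne.2.2 (hhor d h)⟩

instance isFiniteMeasure_arc_frontier_box (a b c d : ℝ) :
    IsFiniteMeasure (arc (frontier (box a b c d))) := by
  refine ⟨?_⟩
  rw [arc, Measure.restrict_apply_univ]
  refine (measure_mono (frontier_box_subset a b c d)).trans_lt ?_
  refine measure_union_lt_top (measure_union_lt_top ?_ ?_) (measure_union_lt_top ?_ ?_) <;>
    (rw [hausdorffMeasure_segment]; exact edist_lt_top _ _)

instance isFiniteMeasure_arc_inter (Γ T : Set Plane) [IsFiniteMeasure (arc Γ)] :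
    IsFiniteMeasure (arc (Γ ∩ T)) :=
  isFiniteMeasure_of_le (arc Γ) (arc_mono Set.inter_subset_left)

/-! ### Sobolev spaces on curves -/

/-- The space `H^{1/2}` (Sobolev–Slobodeckij) of a curve with arc length measure `σ`. A function
`f ∈ L²(σ)` is kept together with its difference quotient
`F (x, y) = (f x - f y) / |x - y| ∈ L²(σ × σ)`, so that the norm is
`‖f‖² = ∫ |f|² dσ + ∬ |f x - f y|² / |x - y|² dσ dσ`. -/
def H12 (σ : Measure Plane) [IsFiniteMeasure σ] :
    Submodule ℂ (WithLp 2 (Lp ℂ 2 σ × Lp ℂ 2 (σ.prod σ))) where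
  carrier := {p | ∀ᵐ z ∂(σ.prod σ), p.snd z = (p.fst z.1 - p.fst z.2) / (dist z.1 z.2 : ℂ)}
  zero_mem' := by
    have h := Lp.coeFn_zero ℂ 2 σ
    have h1 := Measure.quasiMeasurePreserving_fst (μ := σ) (ν := σ) |>.ae h
    have h2 := Measure.quasiMeasurePreserving_snd (μ := σ) (ν := σ) |>.ae h
    filter_upwards [h1, h2, Lp.coeFn_zero ℂ 2 (σ.prod σ)] with z a1 a2 a3
    simp only [WithLp.zero_fst, WithLp.zero_snd]
    rw [a1, a2, a3]
    simp
  add_mem' := by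
    intro p q hp hq
    have h := Lp.coeFn_add p.fst q.fst
    have h1 := Measure.quasiMeasurePreserving_fst (μ := σ) (ν := σ) |>.ae h
    have h2 := Measure.quasiMeasurePreserving_snd (μ := σ) (ν := σ) |>.ae h
    filter_upwards [hp, hq, h1, h2, Lp.coeFn_add p.snd q.snd] with z b1 b2 a1 a2 a3
    simp only [WithLp.add_fst, WithLp.add_snd]
    rw [a1, a2, a3]
    simp only [Pi.add_apply, b1, b2]
    ring
  smul_mem' := by
    intro r p hp
    have h := Lp.coeFn_smul r p.fst
    have h1 := Measure.quasiMeasurePreserving_fst (μ := σ) (ν := σ) |>.ae h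
    have h2 := Measure.quasiMeasurePreserving_snd (μ := σ) (ν := σ) |>.ae h
    filter_upwards [hp, h1, h2, Lp.coeFn_smul r p.snd] with z b1 a1 a2 a3
    simp only [WithLp.smul_fst, WithLp.smul_snd]
    rw [a1, a2, a3]
    simp only [Pi.smul_apply, b1, smul_eq_mul]
    ring

section
variable {σ : Measure Plane} [IsFiniteMeasure σ]

/-- The inclusion `H^{1/2} → L²`. -/
def H12.toL2 (σ : Measure Plane) [IsFiniteMeasure σ] : H12 σ →L[ℂ] Lp ℂ 2 σ :=
  (WithLp.fstL 2 ℂ (Lp ℂ 2 σ) (Lp ℂ 2 (σ.prod σ))).comp (H12 σ).subtypeL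

/-- The natural map `L²(μ) → L²(ν)` for `ν ≤ μ`, as a linear map. -/
def L2.monoLin {α : Type} [MeasurableSpace α] {μ ν : Measure α} (h : ν ≤ μ) :
    Lp ℂ 2 μ →ₗ[ℂ] Lp ℂ 2 ν where
  toFun f := ((Lp.memLp f).mono_measure h).toLp f
  map_add' f g := by
    rw [← MemLp.toLp_add]
    exact MemLp.toLp_congr _ _ ((Lp.coeFn_add f g).filter_mono (ae_mono h))
  map_smul' r f := by
    rw [RingHom.id_apply, ← MemLp.toLp_const_smul]
    exact MemLp.toLp_congr _ _ ((Lp.coeFn_smul r f).filter_mono (ae_mono h))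

theorem L2.norm_monoLin_le {α : Type} [MeasurableSpace α] {μ ν : Measure α} (h : ν ≤ μ)
    (f : Lp ℂ 2 μ) : ‖L2.monoLin h f‖ ≤ 1 * ‖f‖ := by
  have h1 : ‖L2.monoLin h f‖ = (eLpNorm f 2 ν).toReal :=
    Lp.norm_toLp (f : α → ℂ) ((Lp.memLp f).mono_measure h)
  rw [one_mul, h1, Lp.norm_def]
  exact ENNReal.toReal_mono (Lp.eLpNorm_ne_top f) (eLpNorm_mono_measure _ h)

/-- The natural map `L²(μ) → L²(ν)` for `ν ≤ μ`. -/
def L2.mono {α : Type} [MeasurableSpace α] {μ ν : Measure α} (h : ν ≤ μ) :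
    Lp ℂ 2 μ →L[ℂ] Lp ℂ 2 ν :=
  (L2.monoLin h).mkContinuous 1 (L2.norm_monoLin_le h)

theorem L2.coeFn_mono {α : Type} [MeasurableSpace α] {μ ν : Measure α} (h : ν ≤ μ)
    (f : Lp ℂ 2 μ) : L2.mono h f =ᵐ[ν] f :=
  MemLp.coeFn_toLp ((Lp.memLp f).mono_measure h)

/-- Restriction of `H^{1/2}` functions from `Γ` to a part `C` of `Γ`. -/
def H12.restrict {C Γ : Set Plane} [IsFiniteMeasure (arc Γ)] [IsFiniteMeasure (arc C)]
    (h : C ⊆ Γ) : H12 (arc Γ) →L[ℂ] H12 (arc C) :=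
  ContinuousLinearMap.codRestrict
    ((WithLp.prodContinuousLinearEquiv 2 ℂ (Lp ℂ 2 (arc C))
        (Lp ℂ 2 ((arc C).prod (arc C)))).symm.toContinuousLinearMap.comp
      (((L2.mono (arc_mono h)).prodMap
          (L2.mono (Measure.prod_mono (arc_mono h) (arc_mono h)))).comp
        ((WithLp.prodContinuousLinearEquiv 2 ℂ (Lp ℂ 2 (arc Γ))
            (Lp ℂ 2 ((arc Γ).prod (arc Γ)))).toContinuousLinearMap.comp
          (H12 (arc Γ)).subtypeL)))
    (H12 (arc C))
    (by
      rintro ⟨p, hp⟩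
      have h2 : (arc C).prod (arc C) ≤ (arc Γ).prod (arc Γ) :=
        Measure.prod_mono (arc_mono h) (arc_mono h)
      have e := L2.coeFn_mono (arc_mono h) p.fst
      have e1 := Measure.quasiMeasurePreserving_fst (μ := arc C) (ν := arc C) |>.ae e
      have e2 := Measure.quasiMeasurePreserving_snd (μ := arc C) (ν := arc C) |>.ae e
      filter_upwards [e1, e2, L2.coeFn_mono h2 p.snd, ae_mono h2 hp] with z a1 a2 a3 a4
      exact a3.trans (a4.trans (by rw [← a1, ← a2]; rfl)))

/-- `H^{-1/2}` of the whole curve: the dual of `H^{1/2}`. -/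
abbrev Hm12 (σ : Measure Plane) [IsFiniteMeasure σ] := StrongDual ℂ (H12 σ)

/-- `H^{1/2} ⊂ H^{-1/2}` through the bilinear `L²` pairing `⟨g, f⟩ = ∫ g f dσ`. -/
def H12.toHm12 (σ : Measure Plane) [IsFiniteMeasure σ] : H12 σ →L[ℂ] Hm12 σ :=
  ((ContinuousLinearMap.mul ℂ ℂ).lpPairing σ 2 2).bilinearComp (H12.toL2 σ) (H12.toL2 σ)

/-- `H̃^{1/2}(C)` for a part `C` of `Γ`: the functions on `C` whose extension by zero is in
`H^{1/2}(Γ)`. Such a function is represented by its extension by zero. -/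
def HTilde12 (C Γ : Set Plane) [IsFiniteMeasure (arc Γ)] : Submodule ℂ (H12 (arc Γ)) where
  carrier := {f | ∀ᵐ x ∂(arc Γ), x ∉ C → H12.toL2 (arc Γ) f x = 0}
  zero_mem' := by
    simp only [Set.mem_ofPred_eq, map_zero]
    filter_upwards [Lp.coeFn_zero ℂ 2 (arc Γ)] with x hx _
    rw [hx]; rfl
  add_mem' := by
    intro f g hf hg
    simp only [Set.mem_ofPred_eq, map_add] at hf hg ⊢
    filter_upwards [hf, hg, Lp.coeFn_add (H12.toL2 (arc Γ) f) (H12.toL2 (arc Γ) g)]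
      with x h1 h2 h3 hx
    rw [h3, Pi.add_apply, h1 hx, h2 hx, add_zero]
  smul_mem' := by
    intro r f hf
    simp only [Set.mem_ofPred_eq, map_smul] at hf ⊢
    filter_upwards [hf, Lp.coeFn_smul r (H12.toL2 (arc Γ) f)] with x h1 h2 hx
    rw [h2, Pi.smul_apply, h1 hx, smul_zero]

/-- `H̃^{-1/2}(C)`: the dual of `H^{1/2}(C)`. -/
abbrev HTildem12 (C : Set Plane) [IsFiniteMeasure (arc C)] := Hm12 (arc C)

/-- `H^{-1/2}(C)`: the dual of `H̃^{1/2}(C)`. -/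
abbrev Hm12Part (C Γ : Set Plane) [IsFiniteMeasure (arc Γ)] := StrongDual ℂ (HTilde12 C Γ)

/-- The restriction `R_C : H^{-1/2}(Γ) → H^{-1/2}(C)`, dual to the extension by zero
`H̃^{1/2}(C) → H^{1/2}(Γ)`. -/
def restrictDual (C Γ : Set Plane) [IsFiniteMeasure (arc Γ)] (ψ : Hm12 (arc Γ)) :
    Hm12Part C Γ :=
  ψ.comp (HTilde12 C Γ).subtypeL

/-- The extension by zero `φ ↦ (0, φ)`, `H̃^{-1/2}(C) → H^{-1/2}(Γ)`. -/
def extendZero {C Γ : Set Plane} [IsFiniteMeasure (arc Γ)] [IsFiniteMeasure (arc C)]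
    (h : C ⊆ Γ) (φ : HTildem12 C) : Hm12 (arc Γ) :=
  φ.comp (H12.restrict h)

/-- The inclusion `H̃^{-1/2}(C) ⊂ H^{-1/2}(C)`: `⟨φ, f⟩` is the value of `φ` at `f|_C`, for
`f ∈ H̃^{1/2}(C)`. -/
def inclTilde {C Γ : Set Plane} [IsFiniteMeasure (arc Γ)] [IsFiniteMeasure (arc C)]
    (h : C ⊆ Γ) (φ : HTildem12 C) : Hm12Part C Γ :=
  φ.comp ((H12.restrict h).comp (HTilde12 C Γ).subtypeL)

/-- The inclusion `H^{1/2}(C) ⊂ H^{-1/2}(C)` through the `L²` pairing `⟨g, f⟩ = ∫_C g f ds`. -/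
def inclHalf {C Γ : Set Plane} [IsFiniteMeasure (arc Γ)] [IsFiniteMeasure (arc C)]
    (h : C ⊆ Γ) (g : H12 (arc C)) : Hm12Part C Γ :=
  (H12.toHm12 (arc C) g).comp ((H12.restrict h).comp (HTilde12 C Γ).subtypeL)

end

/-! ### The Sobolev space `H¹` of a plane open set -/

/-- The partial derivative `∂ᵢ φ`. -/
def pderiv (i : Fin 2) (φ : Plane → ℂ) (x : Plane) : ℂ :=
  fderiv ℝ φ x (EuclideanSpace.single i 1)

/-- Test functions on `Ω`: smooth, with compact support in `Ω`. -/
def IsTest (Ω : Set Plane) (φ : Plane → ℂ) : Prop :=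
  ContDiff ℝ ∞ φ ∧ HasCompactSupport φ ∧ tsupport φ ⊆ Ω

theorem IsTest.memLp {Ω : Set Plane} {φ : Plane → ℂ} (h : IsTest Ω φ) (μ : Measure Plane)
    [IsFiniteMeasureOnCompacts μ] : MemLp φ 2 μ :=
  h.1.continuous.memLp_of_hasCompactSupport h.2.1

theorem IsTest.memLp_pderiv {Ω : Set Plane} {φ : Plane → ℂ} (h : IsTest Ω φ) (i : Fin 2)
    (μ : Measure Plane) [IsFiniteMeasureOnCompacts μ] : MemLp (pderiv i φ) 2 μ := by
  refine Continuous.memLp_of_hasCompactSupport ?_ ?_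
  · exact (h.1.continuous_fderiv (by simp)).clm_apply continuous_const
  · exact h.2.1.fderiv_apply ℝ _

/-- The `i`-th component of a vector valued `L²` function. -/
def L2.comp {μ : Measure Plane} (i : Fin 2) :
    Lp (EuclideanSpace ℂ (Fin 2)) 2 μ →L[ℂ] Lp ℂ 2 μ :=
  (EuclideanSpace.proj i : EuclideanSpace ℂ (Fin 2) →L[ℂ] ℂ).compLpL 2 μ

/-- `H¹(Ω)`: pairs `(u, ∇u)` of an `L²` function and its weak gradient in `L²`, with the norm
`‖u‖² = ∫ |u|² + ∫ |∇u|²`. -/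
def H1 (Ω : Set Plane) :
    Submodule ℂ (WithLp 2 (Lp ℂ 2 (volume.restrict Ω) ×
      Lp (EuclideanSpace ℂ (Fin 2)) 2 (volume.restrict Ω))) where
  carrier := {p | ∀ φ, IsTest Ω φ → ∀ i,
    ∫ x in Ω, p.fst x * pderiv i φ x = - ∫ x in Ω, L2.comp i p.snd x * φ x}
  zero_mem' := by
    intro φ _ i
    simp only [WithLp.zero_fst, WithLp.zero_snd, map_zero]
    have h := Lp.coeFn_zero ℂ 2 (volume.restrict Ω)
    rw [integral_congr_ae (g := fun _ => 0) (by filter_upwards [h] with x hx; rw [hx]; simp),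
      integral_congr_ae (f := fun x => (0 : Lp ℂ 2 (volume.restrict Ω)) x * φ x)
        (g := fun _ => 0) (by filter_upwards [h] with x hx; rw [hx]; simp)]
    simp
  add_mem' := by
    intro p q hp hq φ hφ i
    have e1 := Lp.coeFn_add p.fst q.fst
    have e2 := Lp.coeFn_add (L2.comp i p.snd) (L2.comp i q.snd)
    have m := hφ.memLp (volume.restrict Ω)
    have m' := hφ.memLp_pderiv i (volume.restrict Ω)
    simp only [WithLp.add_fst, WithLp.add_snd, map_add]
    rw [integral_congr_ae (g := fun x => p.fst x * pderiv i φ x + q.fst x * pderiv i φ x)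
        (by filter_upwards [e1] with x hx; rw [hx, Pi.add_apply, add_mul]),
      integral_congr_ae (f := fun x => (L2.comp i p.snd + L2.comp i q.snd : Lp ℂ 2 _) x * φ x)
        (g := fun x => L2.comp i p.snd x * φ x + L2.comp i q.snd x * φ x)
        (by filter_upwards [e2] with x hx; rw [hx, Pi.add_apply, add_mul]),
      integral_add (f := fun x => p.fst x * pderiv i φ x) (g := fun x => q.fst x * pderiv i φ x)
        ((Lp.memLp p.fst).integrable_mul m') ((Lp.memLp q.fst).integrable_mul m'),
      integral_add (f := fun x => L2.comp i p.snd x * φ x) (g := fun x => L2.comp i q.snd x * φ x)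
        ((Lp.memLp (L2.comp i p.snd)).integrable_mul m)
        ((Lp.memLp (L2.comp i q.snd)).integrable_mul m), hp φ hφ i, hq φ hφ i]
    ring
  smul_mem' := by
    intro r p hp φ hφ i
    have e1 := Lp.coeFn_smul r p.fst
    have e2 := Lp.coeFn_smul r (L2.comp i p.snd)
    simp only [WithLp.smul_fst, WithLp.smul_snd, map_smul]
    rw [integral_congr_ae (g := fun x => r * (p.fst x * pderiv i φ x))
        (by filter_upwards [e1] with x hx; rw [hx, Pi.smul_apply, smul_eq_mul, mul_assoc]),
      integral_congr_ae (f := fun x => (r • L2.comp i p.snd : Lp ℂ 2 _) x * φ x)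
        (g := fun x => r * (L2.comp i p.snd x * φ x))
        (by filter_upwards [e2] with x hx; rw [hx, Pi.smul_apply, smul_eq_mul, mul_assoc]),
      integral_const_mul, integral_const_mul, hp φ hφ i]
    ring

/-- The function `u ∈ L²(Ω)` underlying an element of `H¹(Ω)`. -/
def H1.fn {Ω : Set Plane} (u : H1 Ω) : Lp ℂ 2 (volume.restrict Ω) := u.1.fst

/-- The weak derivative `∂ᵢ u ∈ L²(Ω)`. -/
def H1.grad {Ω : Set Plane} (u : H1 Ω) (i : Fin 2) : Lp ℂ 2 (volume.restrict Ω) :=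
  L2.comp i u.1.snd

/-- `u ∈ H¹(Ω)` is the restriction to `Ω` of the smooth, compactly supported function `Φ`. -/
def H1.IsSmooth {Ω : Set Plane} (u : H1 Ω) (Φ : Plane → ℂ) : Prop :=
  ContDiff ℝ ∞ Φ ∧ HasCompactSupport Φ ∧ H1.fn u =ᵐ[volume.restrict Ω] Φ

/-- The homogeneous Dirichlet condition `u = 0` on the boundary of the scatterer `S`, for
`u ∈ H¹(B \ S)`: `u` is a limit in `H¹` of smooth functions that vanish in a neighbourhood
of `S`. -/
def VanishesOn (B S : Set Plane) (u : H1 (B \ S)) : Prop :=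
  u ∈ closure {v : H1 (B \ S) | ∃ Φ, H1.IsSmooth v Φ ∧ Disjoint (tsupport Φ) S}

/-- `g ∈ H^{1/2}(∂B)` is the trace on `∂B` of `u ∈ H¹(B \ S)`: there are smooth functions `Φₙ`
that tend to `u` in `H¹(B \ S)` and whose restrictions to `∂B` tend to `g` in `L²(∂B)`. -/
def IsTrace (B S : Set Plane) [IsFiniteMeasure (arc (frontier B))] (u : H1 (B \ S))
    (g : H12 (arc (frontier B))) : Prop :=
  ∃ (v : ℕ → H1 (B \ S)) (Φ : ℕ → Plane → ℂ), (∀ n, H1.IsSmooth (v n) (Φ n)) ∧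
    Tendsto v atTop (𝓝 u) ∧
    Tendsto (fun n => eLpNorm (fun x => Φ n x - H12.toL2 (arc (frontier B)) g x) 2 (arc (frontier B)))
      atTop (𝓝 0)

/-- `Δ u = q` in `Ω` in the sense of distributions, with `q ∈ L²(Ω)`. -/
def IsLaplacian {Ω : Set Plane} (u : H1 Ω) (q : Lp ℂ 2 (volume.restrict Ω)) : Prop :=
  ∀ φ, IsTest Ω φ → ∑ i, ∫ x in Ω, H1.grad u i x * pderiv i φ x = - ∫ x in Ω, q x * φ x

/-- `ν ∈ H^{-1/2}(∂B)` is the normal derivative `∂ₙ u` on `∂B` (normal exterior to `B`) of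
`u ∈ H¹(B \ S)` with `Δ u ∈ L²(B \ S)`, defined by Green's formula
`⟨∂ₙ u, v⟩ = ∫ (∇u · ∇v + Δu v)` for all `v ∈ H¹(B \ S)` that vanish on `∂S`. -/
def IsNormalDeriv (B S : Set Plane) [IsFiniteMeasure (arc (frontier B))] (u : H1 (B \ S))
    (ν : Hm12 (arc (frontier B))) : Prop :=
  ∃ q, IsLaplacian u q ∧ ∀ v : H1 (B \ S), VanishesOn B S v →
    ∀ f : H12 (arc (frontier B)), IsTrace B S v f →
      ν f = (∑ i, ∫ x in B \ S, H1.grad u i x * H1.grad v i x) + ∫ x in B \ S, q x * H1.fn v x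

/-! ### The Robin-to-Robin map -/

/-- The graph of the Robin-to-Robin map of the subdomain `B` with scatterer `S`: `θ` is
`∂ₙ w + iη w` on `∂B` for a solution `w ∈ H¹(B \ S)` of `Δw + k² w = 0` in `B \ S`, `w = 0` on
`∂S`, `∂ₙ w - iη w = ψ` on `∂B`. -/
def IsRtR (B S : Set Plane) [IsFiniteMeasure (arc (frontier B))] (k η : ℝ)
    (ψ θ : Hm12 (arc (frontier B))) : Prop :=
  ∃ (w : H1 (B \ S)) (g : H12 (arc (frontier B))) (ν : Hm12 (arc (frontier B))),
    IsLaplacian w (-((k : ℂ) ^ 2 • H1.fn w)) ∧ VanishesOn B S w ∧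
    IsTrace B S w g ∧ IsNormalDeriv B S w ν ∧
    ν - (Complex.I * η) • H12.toHm12 _ g = ψ ∧
    ν + (Complex.I * η) • H12.toHm12 _ g = θ

/-- The graph of the block `S_CC : H̃^{-1/2}(C) → H^{-1/2}(C)` of the Robin-to-Robin map of `B`,
for a part `C` of `∂B`: the Robin data `φ` on `C` is extended by zero to `∂B`, and the outgoing
Robin data is restricted to `C`. -/
def IsRtRBlock (B S C : Set Plane) [IsFiniteMeasure (arc (frontier B))] [IsFiniteMeasure (arc C)]
    (h : C ⊆ frontier B) (k η : ℝ) (φ : HTildem12 C) (ψ : Hm12Part C (frontier B)) : Prop :=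
  ∃ θ, IsRtR B S k η (extendZero h φ) θ ∧ ψ = restrictDual C (frontier B) θ

/-- The common edge of two subdomains. -/
abbrev interface (B B' : Set Plane) : Set Plane := frontier B ∩ frontier B'

end RtR

end

noncomputable section

namespace RtR

/-! ### Compact perturbations in Hilbert spaces -/

section Hilbert

variable {H F : Type*} [NormedAddCommGroup H] [InnerProductSpace ℂ H] [CompleteSpace H]
  [NormedAddCommGroup F] [InnerProductSpace ℂ F] [CompleteSpace F]

/-! The incoming and outgoing Robin data of a solution differ by 2iη times its trace: ∂ₙw + iηw =
(∂ₙw - iηw) + 2iηw on ∂B. Restricted to the edge C, with incoming data φ extended by zero, this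
reads S_CC φ = φ + 2iη w|_C. So the operator sought is φ ↦ 2iη w|_C, and what has to be shown is
that the trace of w exists in H^{1/2}(∂B), depends linearly and continuously on the Robin data in
H^{-1/2}(∂B), and is the same for all solutions w. The two boxes are treated separately; of C only
measurability and C ⊆ ∂B matter.

Let V be the closed space of H¹ functions vanishing on ∂S, and γ the trace on V. The weak form of
the problem is ∫∇w·∇v - k²∫wv - iη∫_{∂B} wv = φ(γv) for all v in V. Replacing v by its conjugate
turns the left side into ⟪v, (1 - K - iη T*T)w⟫ with K = (k²+1)ι*ι, where ι : V → L² is the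
inclusion and T is γ followed by H^{1/2} ⊂ L². By Rellich's theorem ι is compact, so this is a
Fredholm problem. The solution w itself need not be unique: S may enclose a cavity with Dirichlet
eigenvalue k². However, the imaginary part of the form shows that kernel elements have zero trace,
since η ≠ 0. Therefore the kernel is orthogonal to the range, and also to the right-hand side, which
sees v only through γv. A solution exists for all data and its trace is unique. This is
`exists_solution_operator`, made concrete in `exists_robin_solution`.

The analytic input is proved for smooth functions and passed to V by density. The H^{1/2} trace
bound (`sobolevBounded_kern_frontier`) joins two boundary points by an axis-parallel path inside the
box whose length is comparable to their distance, and sums up with Hardy's inequality. The L² trace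
bound needs only a collar of ∂B that avoids S, so it holds without any condition on S; it makes
traces unique (`HasTraceBounds.isTrace_unique`). Rellich's theorem (`isCompactOperator_vfn`) is
Poincaré's inequality on the cells of a fine grid. Functions vanishing near S behave like functions
on the whole box, so no regularity of S enters. -/

open ContinuousLinearMap in
/-- An operator that is arbitrarily small on closed subspaces of finite codimension is compact. -/
theorem isCompactOperator_of_small_on_ker (ι : H →L[ℂ] F)
    (h : ∀ ε > 0, ∃ (κ : Type) (_ : Fintype κ) (L : H →L[ℂ] (κ → ℂ)),
      ∀ u, L u = 0 → ‖ι u‖ ≤ ε * ‖u‖) : IsCompactOperator ι := by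
  have key : ∀ n : ℕ, ∃ G : H →L[ℂ] F, IsCompactOperator G ∧ ‖ι - G‖ ≤ 1 / ((n : ℝ) + 1) := by
    intro n
    obtain ⟨κ, _, L, hL⟩ := h (1 / ((n : ℝ) + 1)) (by positivity)
    let W : Submodule ℂ H := L.ker
    have hW : IsClosed (W : Set H) := L.isClosed_ker
    have : CompleteSpace W := hW.completeSpace_coe
    have : FiniteDimensional ℂ Wᗮ := by
      refine FiniteDimensional.of_injective ((L : H →ₗ[ℂ] (κ → ℂ)).comp Wᗮ.subtype) ?_
      rw [← LinearMap.ker_eq_bot, LinearMap.ker_eq_bot']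
      rintro ⟨x, hx⟩ hx0
      have : x ∈ W ⊓ Wᗮ := ⟨hx0, hx⟩
      rw [Submodule.inf_orthogonal_eq_bot] at this
      simpa using this
    -- The orthogonal complement of ker L is finite dimensional because L is injective on it. Hence
    -- ι composed with its projection has finite rank, and the error is ι composed with the
    -- projection onto ker L, where ι is small by assumption.
    refine ⟨ι.comp Wᗮ.starProjection, ?_, ?_⟩
    · have : ProperSpace Wᗮ := FiniteDimensional.proper ℂ _
      have h1 : IsCompactOperator Wᗮ.subtypeL :=
        isCompactOperator_of_locallyCompactSpace_rng Wᗮ.subtypeL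
      have h2 := (h1.clm_comp ι).comp_clm Wᗮ.orthogonalProjectionOnto
      exact h2
    · refine opNorm_le_bound _ (by positivity) fun u => ?_
      have h1 : (ι - ι.comp Wᗮ.starProjection) u = ι (W.starProjection u) := by
        have := W.starProjection_add_starProjection_orthogonal u
        simp only [sub_apply, comp_apply, ← map_sub]
        congr 1
        rw [sub_eq_iff_eq_add]; exact this.symm
      rw [h1]
      refine (hL _ (W.starProjection_apply_mem u)).trans ?_
      gcongr
      exact W.norm_starProjection_apply_le u
  choose G hG hG' using key
  refine isCompactOperator_of_tendsto (l := atTop) (F := G) ?_ (.of_forall hG)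
  rw [tendsto_iff_norm_sub_tendsto_zero]
  refine squeeze_zero (fun _ => norm_nonneg _) (fun n => ?_) tendsto_one_div_add_atTop_nhds_zero_nat
  rw [norm_sub_rev]; exact hG' n

open ContinuousLinearMap in
/-- The operator `1 - K - iη T*T`, for `K` compact and self-adjoint. -/
def dissipative (K : H →L[ℂ] H) (T : H →L[ℂ] F) (η : ℝ) : H →L[ℂ] H :=
  1 - K - (Complex.I * η) • (adjoint T).comp T

open ContinuousLinearMap InnerProductSpace

theorem inner_dissipative (K : H →L[ℂ] H) (T : H →L[ℂ] F) (η : ℝ) (v w : H) :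
    inner ℂ v (dissipative K T η w) =
      inner ℂ v w - inner ℂ v (K w) - Complex.I * η * inner ℂ (T v) (T w) := by
  simp [dissipative, adjoint_inner_right]

/-- The number ⟪n, Kn⟫ is real, so the imaginary part of ⟪n, (1 - K - iη T*T)n⟫ is -η‖Tn‖². This is
the only place where the sign-definite, non-zero impedance acts. -/
theorem trace_eq_zero_of_dissipative {K : H →L[ℂ] H} (hK : IsSelfAdjoint K) {T : H →L[ℂ] F}
    {η : ℝ} (hη : η ≠ 0) {n : H} (hn : dissipative K T η n = 0) : T n = 0 := by
  have h := inner_dissipative K T η n n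
  rw [hn, inner_zero_right] at h
  have h1 : (inner ℂ n (K n)).im = 0 := by
    rw [← adjoint_inner_left, ← star_eq_adjoint, hK.star_eq, ← inner_conj_symm, Complex.conj_im]
    have : (inner ℂ n (K n)).im = - (inner ℂ n (K n)).im := by
      conv_lhs => rw [← inner_conj_symm, Complex.conj_im]
      rw [← adjoint_inner_right, ← star_eq_adjoint, hK.star_eq]
    linarith
  have h2 := congrArg Complex.im h
  rw [inner_self_eq_norm_sq_to_K, inner_self_eq_norm_sq_to_K] at h2
  have h3 : η * ‖T n‖ ^ 2 = 0 := by
    simp only [Complex.sub_im, h1, Complex.mul_im, Complex.mul_re, Complex.I_re, Complex.I_im,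
      Complex.ofReal_re, Complex.ofReal_im, Complex.zero_im, Complex.coe_algebraMap,
      ← Complex.ofReal_pow] at h2
    linarith
  have : ‖T n‖ ^ 2 = 0 := (mul_eq_zero.mp h3).resolve_left hη
  exact norm_eq_zero.mp (pow_eq_zero_iff (two_ne_zero) |>.mp this)

/-- For η ≠ 0 the operator is iη((iη)⁻¹ - T*T), and (iη)⁻¹ is not real while the spectrum of the
self-adjoint T*T is. Thus the boundary term need not be compact: it is absorbed in the invertible
part. -/
theorem isUnit_one_sub_smul_adjoint_comp (T : H →L[ℂ] F) (η : ℝ) :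
    IsUnit (1 - (Complex.I * η) • (adjoint T).comp T : H →L[ℂ] H) := by
  rcases eq_or_ne η 0 with rfl | hη
  · simp
  have hT : IsSelfAdjoint ((adjoint T).comp T) := by
    rw [IsSelfAdjoint, star_eq_adjoint, adjoint_comp, adjoint_adjoint]
  have hz : (Complex.I * η) ≠ 0 := by simp [hη]
  have : (Complex.I * η)⁻¹ ∉ spectrum ℂ ((adjoint T).comp T) := by
    intro hmem
    have := hT.im_eq_zero_of_mem_spectrum hmem
    simp [Complex.inv_im] at this
    exact hη this
  rw [spectrum.notMem_iff] at this
  have h2 := this.smul (Units.mk0 _ hz)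
  convert! h2 using 1
  rw [Units.smul_mk0, smul_sub, Algebra.algebraMap_eq_smul_one, smul_smul, mul_inv_cancel₀ hz,
    one_smul]

/-- Fredholm alternative: `1 - K - iη T*T` can be solved on the orthogonal complement of its
kernel, with a continuous solution operator. -/
theorem exists_solution_operator {K : H →L[ℂ] H} (hK : IsSelfAdjoint K)
    (hKc : IsCompactOperator K) (T : H →L[ℂ] F) {η : ℝ} (hη : η ≠ 0) :
    ∃ R : H →L[ℂ] H, ∀ f, (∀ n, dissipative K T η n = 0 → inner ℂ n f = 0) →
      dissipative K T η (R f) = f := by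
  set A := dissipative K T η with hA
  let N : Submodule ℂ H := A.ker
  have hNc : IsClosed (N : Set H) := A.isClosed_ker
  have : CompleteSpace N := hNc.completeSpace_coe
  let P : H →L[ℂ] H := N.starProjection
  have hT0 : ∀ n ∈ N, T n = 0 := fun n hn => trace_eq_zero_of_dissipative hK hη hn
  have hKn : ∀ n ∈ N, K n = n := by
    intro n hn
    have h1 : A n = 0 := hn
    simp only [hA, dissipative, sub_apply, smul_apply, comp_apply, hT0 n hn, map_zero, smul_zero,
      sub_zero] at h1
    exact (sub_eq_zero.mp h1).symm
  -- On the kernel N the boundary term drops out, so K is the identity there. Moving K to the other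
  -- factor gives ⟪n, Ax⟫ = ⟪n - Kn, x⟫ = 0, although A is not self-adjoint.
  have hrange : ∀ x, A x ∈ Nᗮ := by
    intro x
    rw [Submodule.mem_orthogonal]
    intro n hn
    rw [hA, inner_dissipative, hT0 n hn, ← adjoint_inner_left, ← star_eq_adjoint, hK.star_eq,
      hKn n hn]
    simp
  obtain ⟨J, hJ⟩ := isUnit_one_sub_smul_adjoint_comp T η
  let X : H →L[ℂ] H := (↑J⁻¹ : H →L[ℂ] H) * (K * (1 - P))
  have hXc : IsCompactOperator X := (hKc.comp_clm (1 - P)).clm_comp (↑J⁻¹ : H →L[ℂ] H)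
  -- Adding the projection P onto N removes the kernel. Since KP = P, the sum is J - K(1 - P), an
  -- invertible operator times identity minus compact, so injectivity will give invertibility.
  have hfac : A + P = (J : H →L[ℂ] H) * (1 - X) := by
    have hKP : K * P = P := by
      ext x; exact hKn _ (N.starProjection_apply_mem x)
    rw [mul_sub, mul_one, ← mul_assoc, Units.mul_inv, one_mul, mul_sub, mul_one, hKP, hJ, hA,
      dissipative]
    abel
  have hinj : ∀ x, (A + P) x = 0 → x = 0 := by
    intro x hx
    have h1 : P x ∈ N ⊓ Nᗮ := by
      refine ⟨N.starProjection_apply_mem x, ?_⟩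
      have : P x = - A x := by rw [eq_neg_iff_add_eq_zero, add_comm]; exact hx
      rw [this]; exact neg_mem (hrange x)
    rw [Submodule.inf_orthogonal_eq_bot, Submodule.mem_bot] at h1
    have h2 : A x = 0 := by simpa [h1] using hx
    have h3 : P x = x := Submodule.starProjection_eq_self_iff.mpr h2
    rw [← h3, h1]
  have hunit : IsUnit (1 - X) := by
    rcases hXc.hasEigenvalue_or_mem_resolventSet one_ne_zero with h | h
    · exfalso
      obtain ⟨x, hx⟩ := h.exists_hasEigenvector
      refine hx.2 (hinj x ?_)
      have hx1 : X x = x := by simpa using hx.apply_eq_smul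
      rw [hfac]
      simp [hx1]
    · simpa [spectrum.mem_resolventSet_iff] using h
  have hAP : IsUnit (A + P) := hfac ▸ J.isUnit.mul hunit
  obtain ⟨U, hU⟩ := hAP
  refine ⟨↑U⁻¹, fun f hf => ?_⟩
  set x : H := (↑U⁻¹ : H →L[ℂ] H) f
  have hx : A x + P x = f := by
    have : ((U : H →L[ℂ] H) * ↑U⁻¹) f = f := by rw [Units.mul_inv]; rfl
    rw [hU] at this
    exact this
  have hfN : f ∈ Nᗮ := (Submodule.mem_orthogonal _ _).mpr hf
  -- For f orthogonal to N, Px = f - Ax lies in both N and its complement; so the correction P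
  -- contributes nothing and Ax = f.
  have h1 : P x ∈ N ⊓ Nᗮ := by
    refine ⟨N.starProjection_apply_mem x, ?_⟩
    rw [eq_sub_of_add_eq' hx]; exact sub_mem hfN (hrange x)
  rw [Submodule.inf_orthogonal_eq_bot, Submodule.mem_bot] at h1
  rw [h1, add_zero] at hx
  exact hx

/-- A compactness criterion: on a dense set, `ι u` is controlled by finitely many functionals
up to a small multiple of the norm. -/
theorem isCompactOperator_of_dense (ι : H →L[ℂ] F) {D : Set H} (hD : Dense D)
    (h : ∀ ε > 0, ∃ (κ : Type) (_ : Fintype κ) (ℓ : κ → F) (C : ℝ), ∀ u ∈ D,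
      ‖ι u‖ ^ 2 ≤ C * ∑ i, ‖inner ℂ (ℓ i) (ι u)‖ ^ 2 + ε ^ 2 * ‖u‖ ^ 2) : IsCompactOperator ι := by
  refine isCompactOperator_of_small_on_ker ι fun ε hε => ?_
  obtain ⟨κ, _, ℓ, C, hC⟩ := h ε hε
  refine ⟨κ, inferInstance, ContinuousLinearMap.pi fun i => (innerSL ℂ (ℓ i)).comp ι,
    fun u hu => ?_⟩
  have hz : ∀ i, inner ℂ (ℓ i) (ι u) = 0 := fun i => congrFun hu i
  -- Both sides are continuous in u, so the estimate extends from D to H before it is restricted to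
  -- the common kernel of the functionals, which D may miss.
  have key : ∀ u, ‖ι u‖ ^ 2 ≤ C * ∑ i, ‖inner ℂ (ℓ i) (ι u)‖ ^ 2 + ε ^ 2 * ‖u‖ ^ 2 := fun u => by
    have hcl : IsClosed {u | ‖ι u‖ ^ 2 ≤ C * ∑ i, ‖inner ℂ (ℓ i) (ι u)‖ ^ 2 + ε ^ 2 * ‖u‖ ^ 2} :=
      isClosed_le (by fun_prop) (by fun_prop)
    exact hcl.closure_subset_iff.mpr hC (hD u)
  have h1 := key u
  simp only [hz, norm_zero, ne_eq, OfNat.ofNat_ne_zero, not_false_eq_true, zero_pow,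
    Finset.sum_const_zero, mul_zero, zero_add] at h1
  exact (abs_le_of_sq_le_sq' (by rw [mul_pow]; exact h1) (by positivity)).2

/-- An antiunitary involution `J` turns functionals into right hand sides. -/
theorem exists_riesz_conj {X : Type*} [NormedAddCommGroup X] [NormedSpace ℂ X] (γ : H →L[ℂ] X)
    {J : H → H} (hJJ : ∀ u, J (J u) = u) (hJ : ∀ u v, inner ℂ (J u) (J v) = inner ℂ v u) :
    ∃ f : StrongDual ℂ X →L[ℂ] H, ∀ φ v, inner ℂ (J v) (f φ) = φ (γ v) := by
  have ext : ∀ x y : H, (∀ v, inner ℂ (J v) x = inner ℂ (J v) y) → x = y := fun x y h =>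
    ext_inner_left ℂ fun v => by rw [← hJJ v]; exact h (J v)
  have hf : ∀ (φ : StrongDual ℂ X) v,
      inner ℂ (J v) (J ((toDual ℂ H).symm (φ.comp γ))) = φ (γ v) := by
    intro φ v
    rw [hJ, toDual_symm_apply]
    rfl
  have hnorm : ∀ u, ‖J u‖ = ‖u‖ := fun u => by
    rw [← sq_eq_sq₀ (norm_nonneg _) (norm_nonneg _), ← inner_self_eq_norm_sq (𝕜 := ℂ),
      ← inner_self_eq_norm_sq (𝕜 := ℂ), hJ]
  -- The Riesz map is antilinear and J undoes this. Additivity of J is not assumed; linearity is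
  -- read off by testing against all J v, which exhaust H.
  let f : StrongDual ℂ X →ₗ[ℂ] H :=
    { toFun := fun φ => J ((toDual ℂ H).symm (φ.comp γ))
      map_add' := fun φ ψ => ext _ _ fun v => by rw [inner_add_right, hf, hf, hf]; rfl
      map_smul' := fun r φ => ext _ _ fun v => by
        rw [inner_smul_right, hf, hf, RingHom.id_apply]; rfl }
  refine ⟨f.mkContinuous ‖γ‖ fun φ => ?_, hf⟩
  change ‖J ((toDual ℂ H).symm (φ.comp γ))‖ ≤ ‖γ‖ * ‖φ‖
  rw [hnorm, LinearIsometryEquiv.norm_map, mul_comm]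
  exact opNorm_comp_le φ γ

/-- Solvability of the abstract Robin problem
`⟪J v, w⟫ - κ ⟪ι J v, ι w⟫ - iη ⟪τ γ J v, τ γ w⟫ = φ (γ v)`, with uniqueness of `γ w`. -/
theorem exists_robin_solution {X G : Type*} [NormedAddCommGroup X] [NormedSpace ℂ X]
    [NormedAddCommGroup G] [InnerProductSpace ℂ G] [CompleteSpace G]
    {ι : H →L[ℂ] F} (hι : IsCompactOperator ι) (γ : H →L[ℂ] X) {τ : X →L[ℂ] G}
    (hτ : Function.Injective τ) {J : H → H} (hJJ : ∀ u, J (J u) = u)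
    (hJ : ∀ u v, inner ℂ (J u) (J v) = inner ℂ v u) (hJγ : ∀ u, γ u = 0 → γ (J u) = 0)
    (κ : ℝ) {η : ℝ} (hη : η ≠ 0) :
    ∃ R : StrongDual ℂ X →L[ℂ] H,
      (∀ φ v, inner ℂ (J v) (R φ) - κ * inner ℂ (ι (J v)) (ι (R φ)) -
        Complex.I * η * inner ℂ (τ (γ (J v))) (τ (γ (R φ))) = φ (γ v)) ∧
      ∀ φ w, (∀ v, inner ℂ (J v) w - κ * inner ℂ (ι (J v)) (ι w) -
        Complex.I * η * inner ℂ (τ (γ (J v))) (τ (γ w)) = φ (γ v)) → γ w = γ (R φ) := by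
  obtain ⟨f, hf⟩ := exists_riesz_conj γ hJJ hJ
  let K : H →L[ℂ] H := (κ : ℂ) • (adjoint ι).comp ι
  have hK : IsSelfAdjoint K := by
    refine IsSelfAdjoint.smul (Complex.conj_ofReal κ) ?_
    rw [IsSelfAdjoint, star_eq_adjoint, adjoint_comp, adjoint_adjoint]
  have hKc : IsCompactOperator K := (hι.clm_comp (adjoint ι)).smul (κ : ℂ)
  let T : H →L[ℂ] G := τ.comp γ
  have hT : ∀ n, dissipative K T η n = 0 → γ n = 0 := fun n hn =>
    hτ ((trace_eq_zero_of_dissipative hK hη hn).trans (map_zero τ).symm)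
  have hA : ∀ v w, inner ℂ (J v) (dissipative K T η w) =
      inner ℂ (J v) w - κ * inner ℂ (ι (J v)) (ι w) -
        Complex.I * η * inner ℂ (τ (γ (J v))) (τ (γ w)) := fun v w => by
    rw [inner_dissipative]
    simp [K, T, adjoint_inner_right]
  obtain ⟨R, hR⟩ := exists_solution_operator hK hKc T hη
  -- Solvability condition: a kernel element n has γ n = 0, hence γ (J n) = 0, and the right-hand
  -- side paired with n is φ (γ (J n)).
  have hRf : ∀ φ, dissipative K T η (R (f φ)) = f φ := fun φ => hR _ fun n hn => by
    have := hf φ (J n)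
    rwa [hJJ, hJγ n (hT n hn), map_zero] at this
  refine ⟨R.comp f, fun φ v => ?_, fun φ w hw => ?_⟩
  · rw [← hA, ← hf]
    exact congrArg _ (hRf φ)
  · have h0 : dissipative K T η (w - R (f φ)) = 0 := by
      rw [map_sub, hRf, sub_eq_zero]
      refine ext_inner_left ℂ fun v => ?_
      rw [← hJJ v, hA, hw, hf]
    have := hT _ h0
    rwa [map_sub, sub_eq_zero] at this

/-- A bounded, densely defined linear relation extends to a continuous linear map. -/
theorem exists_extension_of_relation {H X : Type*} [NormedAddCommGroup H] [NormedSpace ℂ H]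
    [NormedAddCommGroup X] [NormedSpace ℂ X] [CompleteSpace X] (r : H → X → Prop)
    (hadd : ∀ u v x y, r u x → r v y → r (u + v) (x + y))
    (hsmul : ∀ (c : ℂ) u x, r u x → r (c • u) (c • x))
    (hdense : Dense {u | ∃ x, r u x}) {C : ℝ} (hC : ∀ u x, r u x → ‖x‖ ≤ C * ‖u‖) :
    ∃ γ : H →L[ℂ] X, ∀ u x, r u x → γ u = x := by
  -- The difference x - y is related to 0, so the bound forces it to vanish: the relation is
  -- single-valued.
  have huniq : ∀ u x y, r u x → r u y → x = y := fun u x y hx hy => by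
    have h := hC _ _ (hadd _ _ _ _ hx (hsmul (-1) _ _ hy))
    simpa [← sub_eq_add_neg, sub_eq_zero] using h
  have h0 : r 0 0 := by
    obtain ⟨u, x, hx⟩ := hdense.nonempty
    simpa using hsmul 0 u x hx
  let D : Submodule ℂ H :=
    { carrier := {u | ∃ x, r u x}
      zero_mem' := ⟨0, h0⟩
      add_mem' := fun ⟨x, hx⟩ ⟨y, hy⟩ => ⟨x + y, hadd _ _ _ _ hx hy⟩
      smul_mem' := fun c _ ⟨x, hx⟩ => ⟨c • x, hsmul c _ _ hx⟩ }
  choose g hg using fun u : D => u.2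
  let gL : D →ₗ[ℂ] X :=
    { toFun := g
      map_add' := fun u v => huniq _ _ _ (hg (u + v)) (hadd _ _ _ _ (hg u) (hg v))
      map_smul' := fun c u => huniq _ _ _ (hg (c • u)) (hsmul c _ _ (hg u)) }
  let gC : D →L[ℂ] X := gL.mkContinuous C fun u => hC _ _ (hg u)
  refine ⟨gC.extend D.subtypeL, fun u x hx => ?_⟩
  have hd : DenseRange D.subtypeL := by
    rw [DenseRange]
    convert! hdense
    exact Subtype.range_coe
  have h1 := gC.extend_eq hd isUniformEmbedding_subtype_val.isUniformInducing ⟨u, x, hx⟩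
  exact h1.trans (huniq _ _ _ (hg ⟨u, x, hx⟩) hx)

end Hilbert

/-! ### Estimates on the unit square -/

section Square

open Set

theorem sq_lintegral_mul_le {α : Type*} [MeasurableSpace α] (μ : Measure α) {f g : α → ℝ≥0∞}
    (hf : AEMeasurable f μ) (hg : AEMeasurable g μ) :
    (∫⁻ x, f x * g x ∂μ) ^ 2 ≤ (∫⁻ x, f x ^ 2 ∂μ) * ∫⁻ x, g x ^ 2 ∂μ := by
  have h := ENNReal.lintegral_mul_le_Lp_mul_Lq μ Real.HolderConjugate.two_two hf hg
  simp only [Pi.mul_apply, ENNReal.rpow_two] at h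
  calc _ ≤ ((∫⁻ x, f x ^ 2 ∂μ) ^ (1 / (2 : ℝ)) * (∫⁻ x, g x ^ 2 ∂μ) ^ (1 / (2 : ℝ))) ^ 2 := by
        gcongr
    _ = _ := by
        rw [mul_pow, ← ENNReal.rpow_two, ← ENNReal.rpow_two, ← ENNReal.rpow_mul,
          ← ENNReal.rpow_mul]
        norm_num

theorem sq_lintegral_le {α : Type*} [MeasurableSpace α] (μ : Measure α) {f : α → ℝ≥0∞}
    (hf : AEMeasurable f μ) : (∫⁻ x, f x ∂μ) ^ 2 ≤ μ univ * ∫⁻ x, f x ^ 2 ∂μ := by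
  simpa using sq_lintegral_mul_le μ (f := fun _ => 1) aemeasurable_const hf

theorem ENNReal_add_sq_le (x y : ℝ≥0∞) : (x + y) ^ 2 ≤ 2 * x ^ 2 + 2 * y ^ 2 := by
  have h := ENNReal.rpow_add_le_mul_rpow_add_rpow x y (p := 2) (by norm_num)
  norm_num at h
  rwa [mul_add] at h

theorem lintegral_rpow_neg_half (t : ℝ) (ht : 0 < t) :
    ∫⁻ τ in Ioo 0 t, ENNReal.ofReal (τ ^ (-(1 / 2) : ℝ)) = ENNReal.ofReal (2 * t ^ (1 / 2 : ℝ)) := by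
  have hi : IntervalIntegrable (fun τ : ℝ => τ ^ (-(1 / 2) : ℝ)) volume 0 t :=
    intervalIntegral.intervalIntegrable_rpow' (by norm_num)
  rw [intervalIntegrable_iff_integrableOn_Ioo_of_le ht.le] at hi
  rw [← ofReal_integral_eq_lintegral_ofReal hi, ← integral_Ioc_eq_integral_Ioo,
    ← intervalIntegral.integral_of_le ht.le, integral_rpow (Or.inl (by norm_num))]
  · congr 1
    rw [Real.zero_rpow (by norm_num)]
    norm_num
    ring
  · filter_upwards [self_mem_ae_restrict measurableSet_Ioo] with τ hτ
    exact Real.rpow_nonneg hτ.1.le _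

theorem lintegral_rpow_neg_three_half (τ : ℝ) (hτ : 0 < τ) :
    ∫⁻ t in Ioi τ, ENNReal.ofReal (t ^ (-(3 / 2) : ℝ)) =
      ENNReal.ofReal (2 * τ ^ (-(1 / 2) : ℝ)) := by
  rw [← ofReal_integral_eq_lintegral_ofReal (integrableOn_Ioi_rpow_of_lt (by norm_num) hτ),
    integral_Ioi_rpow_of_lt (by norm_num) hτ]
  · congr 1
    norm_num
    ring
  · filter_upwards [self_mem_ae_restrict measurableSet_Ioi] with t ht
    exact Real.rpow_nonneg (hτ.trans ht).le _

/-- Hardy's inequality on the unit interval. -/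
theorem hardy {f : ℝ → ℝ≥0∞} (hf : Measurable f) :
    ∫⁻ t in Ioo (0 : ℝ) 1, (ENNReal.ofReal t)⁻¹ ^ 2 * (∫⁻ τ in Ioo 0 t, f τ) ^ 2 ≤
      4 * ∫⁻ t in Ioo (0 : ℝ) 1, f t ^ 2 := by
  have hm : Measurable fun p : ℝ × ℝ => (Iio p.1).indicator
      (fun τ => ENNReal.ofReal (2 * p.1 ^ (-(3 / 2) : ℝ)) *
        (ENNReal.ofReal (τ ^ (1 / 2 : ℝ)) * f τ ^ 2)) p.2 := by
    have hS : MeasurableSet {p : ℝ × ℝ | p.2 < p.1} :=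
      measurableSet_lt measurable_snd measurable_fst
    have : Measurable ({p : ℝ × ℝ | p.2 < p.1}.indicator fun p : ℝ × ℝ =>
        ENNReal.ofReal (2 * p.1 ^ (-(3 / 2) : ℝ)) *
        (ENNReal.ofReal (p.2 ^ (1 / 2 : ℝ)) * f p.2 ^ 2)) := by
      refine Measurable.indicator ?_ hS
      fun_prop
    exact this
  calc ∫⁻ t in Ioo (0 : ℝ) 1, (ENNReal.ofReal t)⁻¹ ^ 2 * (∫⁻ τ in Ioo 0 t, f τ) ^ 2
      ≤ ∫⁻ t in Ioo (0 : ℝ) 1, ∫⁻ τ in Ioo (0 : ℝ) 1, (Iio t).indicator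
          (fun τ => ENNReal.ofReal (2 * t ^ (-(3 / 2) : ℝ)) *
            (ENNReal.ofReal (τ ^ (1 / 2 : ℝ)) * f τ ^ 2)) τ := by
        refine setLIntegral_mono' measurableSet_Ioo fun t ht => ?_
        -- Cauchy–Schwarz with weight τ^{1/4}: the first factor gives ∫₀ᵗ τ^{-1/2} = 2t^{1/2}. After
        -- exchanging the integrals, ∫_τ^∞ t^{-3/2} = 2τ^{-1/2} cancels the remaining weight
        -- τ^{1/2}, and 4 = 2 · 2.
        have h1 : ∫⁻ τ in Ioo 0 t, f τ =
            ∫⁻ τ in Ioo 0 t, ENNReal.ofReal (τ ^ (-(1 / 4) : ℝ)) *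
              (ENNReal.ofReal (τ ^ (1 / 4 : ℝ)) * f τ) := by
          refine setLIntegral_congr_fun measurableSet_Ioo fun τ hτ => ?_
          rw [← mul_assoc, ← ENNReal.ofReal_mul (Real.rpow_nonneg hτ.1.le _),
            ← Real.rpow_add hτ.1]
          norm_num
        have h2 : (∫⁻ τ in Ioo 0 t, f τ) ^ 2 ≤ ENNReal.ofReal (2 * t ^ (1 / 2 : ℝ)) *
            ∫⁻ τ in Ioo 0 t, ENNReal.ofReal (τ ^ (1 / 2 : ℝ)) * f τ ^ 2 := by
          rw [h1]
          refine (sq_lintegral_mul_le _ (by fun_prop) (by fun_prop)).trans_eq ?_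
          congr 1
          · rw [← lintegral_rpow_neg_half t ht.1]
            refine setLIntegral_congr_fun measurableSet_Ioo fun τ hτ => ?_
            rw [← ENNReal.ofReal_pow (Real.rpow_nonneg hτ.1.le _), ← Real.rpow_natCast,
              ← Real.rpow_mul hτ.1.le]
            norm_num
          · refine setLIntegral_congr_fun measurableSet_Ioo fun τ hτ => ?_
            simp only [mul_pow]
            rw [← ENNReal.ofReal_pow (Real.rpow_nonneg hτ.1.le _), ← Real.rpow_natCast,
              ← Real.rpow_mul hτ.1.le]
            norm_num
        calc _ ≤ (ENNReal.ofReal t)⁻¹ ^ 2 * (ENNReal.ofReal (2 * t ^ (1 / 2 : ℝ)) *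
            ∫⁻ τ in Ioo 0 t, ENNReal.ofReal (τ ^ (1 / 2 : ℝ)) * f τ ^ 2) := by gcongr
          _ = ENNReal.ofReal (2 * t ^ (-(3 / 2) : ℝ)) *
            ∫⁻ τ in Ioo 0 t, ENNReal.ofReal (τ ^ (1 / 2 : ℝ)) * f τ ^ 2 := by
              rw [← mul_assoc, ← ENNReal.ofReal_inv_of_pos ht.1, ← ENNReal.ofReal_pow
                (inv_nonneg.mpr ht.1.le), ← ENNReal.ofReal_mul (by have := ht.1; positivity)]
              congr 2
              rw [← Real.rpow_neg_one, ← Real.rpow_natCast, ← Real.rpow_mul ht.1.le,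
                mul_left_comm, ← Real.rpow_add ht.1]
              norm_num
          _ = _ := by
              rw [← lintegral_const_mul _ (by fun_prop), lintegral_indicator measurableSet_Iio,
                Measure.restrict_restrict measurableSet_Iio]
              congr 3
              ext τ
              simp only [mem_Ioo, mem_inter_iff, mem_Iio]
              constructor
              · exact fun h => ⟨h.2, h.1, h.2.trans ht.2⟩
              · exact fun h => ⟨h.2.1, h.1⟩
    _ = ∫⁻ τ in Ioo (0 : ℝ) 1, ∫⁻ t in Ioo (0 : ℝ) 1, (Iio t).indicator
          (fun τ => ENNReal.ofReal (2 * t ^ (-(3 / 2) : ℝ)) *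
            (ENNReal.ofReal (τ ^ (1 / 2 : ℝ)) * f τ ^ 2)) τ :=
        lintegral_lintegral_swap hm.aemeasurable
    _ ≤ ∫⁻ τ in Ioo (0 : ℝ) 1, 4 * f τ ^ 2 := by
        refine setLIntegral_mono' measurableSet_Ioo fun τ hτ => ?_
        calc _ ≤ ∫⁻ t, (Ioi τ).indicator (fun t => 2 * ENNReal.ofReal (t ^ (-(3 / 2) : ℝ)) *
                (ENNReal.ofReal (τ ^ (1 / 2 : ℝ)) * f τ ^ 2)) t := by
              refine (setLIntegral_le_lintegral _ _).trans_eq (lintegral_congr fun t => ?_)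
              simp only [indicator, mem_Iio, mem_Ioi]
              rw [ENNReal.ofReal_mul zero_le_two, ENNReal.ofReal_ofNat]
          _ = 2 * ENNReal.ofReal (2 * τ ^ (-(1 / 2) : ℝ)) *
                (ENNReal.ofReal (τ ^ (1 / 2 : ℝ)) * f τ ^ 2) := by
              rw [lintegral_indicator measurableSet_Ioi, lintegral_mul_const _ (by fun_prop),
                lintegral_const_mul _ (by fun_prop), lintegral_rpow_neg_three_half τ hτ.1]
          _ = 4 * f τ ^ 2 := by
              rw [ENNReal.ofReal_mul zero_le_two, ENNReal.ofReal_ofNat, ← mul_assoc]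
              congr 1
              rw [mul_assoc, mul_assoc, ← ENNReal.ofReal_mul (Real.rpow_nonneg hτ.1.le _),
                ← Real.rpow_add hτ.1]
              norm_num
    _ = 4 * ∫⁻ t in Ioo (0 : ℝ) 1, f t ^ 2 := lintegral_const_mul _ (by fun_prop)

/-- `D` dominates the variation of `Ψ` along horizontal and vertical segments. -/
structure IsUpperGradient (Ψ : ℝ → ℝ → ℂ) (D : ℝ → ℝ → ℝ≥0∞) : Prop where
  measurable_fun : Measurable (Function.uncurry Ψ)
  measurable : Measurable (Function.uncurry D)
  horizontal : ∀ s s' t, s ≤ s' → ‖Ψ s t - Ψ s' t‖ₑ ≤ ∫⁻ σ in Ioo s s', D σ t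
  vertical : ∀ s t t', t ≤ t' → ‖Ψ s t - Ψ s t'‖ₑ ≤ ∫⁻ τ in Ioo t t', D s τ

/-- The square of the `L²` norm of `D` on the unit square. -/
def energy (D : ℝ → ℝ → ℝ≥0∞) : ℝ≥0∞ :=
  ∫⁻ s in Ioo (0 : ℝ) 1, ∫⁻ t in Ioo (0 : ℝ) 1, D s t ^ 2

variable {Ψ : ℝ → ℝ → ℂ} {D : ℝ → ℝ → ℝ≥0∞}

theorem energy_swap (hD : Measurable (Function.uncurry D)) :
    energy (fun s t => D t s) = energy D := by
  unfold energy
  exact lintegral_lintegral_swap (f := fun s t => D t s ^ 2)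
    ((hD.comp measurable_swap).pow_const 2).aemeasurable

theorem IsUpperGradient.swap (h : IsUpperGradient Ψ D) :
    IsUpperGradient (fun s t => Ψ t s) (fun s t => D t s) where
  measurable_fun := h.measurable_fun.comp measurable_swap
  measurable := h.measurable.comp measurable_swap
  horizontal s s' t hs := h.vertical t s s' hs
  vertical s t t' ht := h.horizontal t t' s ht

theorem measurable_lintegral_Ioo {D : ℝ → ℝ → ℝ≥0∞} (hD : Measurable (Function.uncurry D)) :
    Measurable fun p : ℝ × ℝ => ∫⁻ τ in Ioo 0 p.2, D p.1 τ := by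
  have hS : MeasurableSet {q : (ℝ × ℝ) × ℝ | 0 < q.2 ∧ q.2 < q.1.2} :=
    (measurableSet_lt measurable_const measurable_snd).inter
      (measurableSet_lt measurable_snd (measurable_snd.comp measurable_fst))
  have h1 : Measurable ({q : (ℝ × ℝ) × ℝ | 0 < q.2 ∧ q.2 < q.1.2}.indicator
      fun q => Function.uncurry D (q.1.1, q.2)) :=
    (hD.comp (by fun_prop)).indicator hS
  have h2 := h1.lintegral_prod_right' (ν := (volume : Measure ℝ))
  have h3 : (fun p : ℝ × ℝ => ∫⁻ τ in Ioo 0 p.2, D p.1 τ) = fun p : ℝ × ℝ => ∫⁻ τ,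
      {q : (ℝ × ℝ) × ℝ | 0 < q.2 ∧ q.2 < q.1.2}.indicator
        (fun q => Function.uncurry D (q.1.1, q.2)) (p, τ) := by
    funext p
    rw [← lintegral_indicator measurableSet_Ioo]
    rfl
  rw [h3]
  exact h2

theorem lintegral_lintegral_const_mul_add {μ ν : Measure ℝ} [SFinite ν] {P Q : ℝ → ℝ → ℝ≥0∞}
    (hP : Measurable (Function.uncurry P)) {c c' : ℝ≥0∞} (hc : c ≠ ⊤) (hc' : c' ≠ ⊤) :
    ∫⁻ s, ∫⁻ t, (c * P s t + c' * Q s t) ∂ν ∂μ =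
      c * (∫⁻ s, ∫⁻ t, P s t ∂ν ∂μ) + c' * ∫⁻ s, ∫⁻ t, Q s t ∂ν ∂μ := by
  have h1 : Measurable fun s => ∫⁻ t, P s t ∂ν := hP.lintegral_prod_right'
  rw [← lintegral_const_mul' _ _ hc, ← lintegral_const_mul' _ _ hc',
    ← lintegral_add_left (h1.const_mul c)]
  refine lintegral_congr fun s => ?_
  have h2 : Measurable (P s) := hP.comp (measurable_const.prodMk measurable_id)
  rw [lintegral_add_left (h2.const_mul c), lintegral_const_mul' _ _ hc,
    lintegral_const_mul' _ _ hc']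

/-- Compare Ψ(s,0) with Ψ(s,t) along the vertical segment and average over t in (0,1). -/
theorem lintegral_sq_norm_edge_le (h : IsUpperGradient Ψ D) :
    ∫⁻ s in Ioo (0 : ℝ) 1, ‖Ψ s 0‖ₑ ^ 2 ≤
      2 * (∫⁻ s in Ioo (0 : ℝ) 1, ∫⁻ t in Ioo (0 : ℝ) 1, ‖Ψ s t‖ₑ ^ 2) + 2 * energy D := by
  have hD := h.measurable
  have hΨ := h.measurable_fun
  have hΨ2 : Measurable (Function.uncurry fun s t => ‖Ψ s t‖ₑ ^ 2) := hΨ.enorm.pow_const 2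
  rw [energy, ← lintegral_const_mul' _ _ (by norm_num), ← lintegral_const_mul' _ _ (by norm_num),
    ← lintegral_add_left (Measurable.const_mul (f := fun s => ∫⁻ t in Ioo (0 : ℝ) 1, ‖Ψ s t‖ₑ ^ 2)
      hΨ2.lintegral_prod_right' 2)]
  refine lintegral_mono fun s => ?_
  have hΨs : Measurable fun t => ‖Ψ s t‖ₑ ^ 2 := hΨ2.comp (measurable_const.prodMk measurable_id)
  have hDs : Measurable (D s) := hD.comp (measurable_const.prodMk measurable_id)
  have h1 : ∀ t ∈ Ioo (0 : ℝ) 1, ‖Ψ s 0‖ₑ ^ 2 ≤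
      2 * ‖Ψ s t‖ₑ ^ 2 + 2 * ∫⁻ t in Ioo (0 : ℝ) 1, D s t ^ 2 := by
    intro t ht
    have h2 : ‖Ψ s 0‖ₑ ≤ ‖Ψ s t‖ₑ + ∫⁻ τ in Ioo (0 : ℝ) 1, D s τ := by
      calc ‖Ψ s 0‖ₑ = ‖Ψ s t + (Ψ s 0 - Ψ s t)‖ₑ := by congr 1; ring
        _ ≤ ‖Ψ s t‖ₑ + ‖Ψ s 0 - Ψ s t‖ₑ := enorm_add_le _ _
        _ ≤ ‖Ψ s t‖ₑ + ∫⁻ τ in Ioo (0 : ℝ) t, D s τ := by gcongr; exact h.vertical s 0 t ht.1.le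
        _ ≤ _ := by
          gcongr
          exact ht.2.le
    have h3 := sq_lintegral_le (volume.restrict (Ioo (0 : ℝ) 1)) hDs.aemeasurable
    simp only [Measure.restrict_apply_univ, Real.volume_Ioo, sub_zero, ENNReal.ofReal_one,
      one_mul] at h3
    calc _ ≤ (‖Ψ s t‖ₑ + ∫⁻ τ in Ioo (0 : ℝ) 1, D s τ) ^ 2 := by gcongr
      _ ≤ _ := (ENNReal_add_sq_le _ _).trans (by gcongr)
  calc ‖Ψ s 0‖ₑ ^ 2 = ∫⁻ t in Ioo (0 : ℝ) 1, ‖Ψ s 0‖ₑ ^ 2 := by simp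
    _ ≤ ∫⁻ t in Ioo (0 : ℝ) 1, (2 * ‖Ψ s t‖ₑ ^ 2 + 2 * ∫⁻ t in Ioo (0 : ℝ) 1, D s t ^ 2) :=
        setLIntegral_mono' measurableSet_Ioo h1
    _ = _ := by
        rw [lintegral_add_left (hΨs.const_mul 2), lintegral_const_mul _ hΨs]
        simp

/-- Go from (s,t) horizontally to (s',t), then vertically to (s',t'). Each leg is at most the
integral of D over a full line of the square, and Cauchy–Schwarz and Fubini turn it into the energy.
This is the core of Poincaré's inequality. -/
theorem lintegral_sq_sub_le (h : IsUpperGradient Ψ D) :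
    ∫⁻ s in Ioo (0 : ℝ) 1, ∫⁻ t in Ioo (0 : ℝ) 1, ∫⁻ s' in Ioo (0 : ℝ) 1,
      ∫⁻ t' in Ioo (0 : ℝ) 1, ‖Ψ s t - Ψ s' t'‖ₑ ^ 2 ≤ 4 * energy D := by
  have hD := h.measurable
  have key : ∀ s ∈ Ioo (0 : ℝ) 1, ∀ t, ∀ s' ∈ Ioo (0 : ℝ) 1, ∀ t',
      t ∈ Ioo (0 : ℝ) 1 → t' ∈ Ioo (0 : ℝ) 1 → ‖Ψ s t - Ψ s' t'‖ₑ ^ 2 ≤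
      2 * (∫⁻ σ in Ioo (0 : ℝ) 1, D σ t ^ 2) + 2 * (∫⁻ τ in Ioo (0 : ℝ) 1, D s' τ ^ 2) := by
    intro s hs t s' hs' t' ht ht'
    have a1 : ‖Ψ s t - Ψ s' t‖ₑ ≤ ∫⁻ σ in Ioo (0 : ℝ) 1, D σ t := by
      rcases le_total s s' with hle | hle
      · exact (h.horizontal s s' t hle).trans
          (lintegral_mono_set (Ioo_subset_Ioo hs.1.le hs'.2.le))
      · rw [enorm_sub_rev]
        exact (h.horizontal s' s t hle).trans
          (lintegral_mono_set (Ioo_subset_Ioo hs'.1.le hs.2.le))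
    have a2 : ‖Ψ s' t - Ψ s' t'‖ₑ ≤ ∫⁻ τ in Ioo (0 : ℝ) 1, D s' τ := by
      rcases le_total t t' with hle | hle
      · exact (h.vertical s' t t' hle).trans
          (lintegral_mono_set (Ioo_subset_Ioo ht.1.le ht'.2.le))
      · rw [enorm_sub_rev]
        exact (h.vertical s' t' t hle).trans
          (lintegral_mono_set (Ioo_subset_Ioo ht'.1.le ht.2.le))
    have b1 := sq_lintegral_le (volume.restrict (Ioo (0 : ℝ) 1)) (f := fun σ => D σ t)
      (hD.comp (measurable_id.prodMk measurable_const)).aemeasurable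
    have b2 := sq_lintegral_le (volume.restrict (Ioo (0 : ℝ) 1)) (f := D s')
      (hD.comp (measurable_const.prodMk measurable_id)).aemeasurable
    simp only [Measure.restrict_apply_univ, Real.volume_Ioo, sub_zero, ENNReal.ofReal_one,
      one_mul] at b1 b2
    calc ‖Ψ s t - Ψ s' t'‖ₑ ^ 2 = ‖(Ψ s t - Ψ s' t) + (Ψ s' t - Ψ s' t')‖ₑ ^ 2 := by
          congr 2; ring
      _ ≤ ((∫⁻ σ in Ioo (0 : ℝ) 1, D σ t) + ∫⁻ τ in Ioo (0 : ℝ) 1, D s' τ) ^ 2 := by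
          gcongr; exact (enorm_add_le _ _).trans (add_le_add a1 a2)
      _ ≤ _ := (ENNReal_add_sq_le _ _).trans (by gcongr)
  calc _ ≤ ∫⁻ s in Ioo (0 : ℝ) 1, ∫⁻ t in Ioo (0 : ℝ) 1, ∫⁻ s' in Ioo (0 : ℝ) 1,
      ∫⁻ t' in Ioo (0 : ℝ) 1, (2 * (∫⁻ σ in Ioo (0 : ℝ) 1, D σ t ^ 2) +
        2 * (∫⁻ τ in Ioo (0 : ℝ) 1, D s' τ ^ 2)) := by
        refine setLIntegral_mono' measurableSet_Ioo fun s hs =>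
          setLIntegral_mono' measurableSet_Ioo fun t ht =>
          setLIntegral_mono' measurableSet_Ioo fun s' hs' =>
          setLIntegral_mono' measurableSet_Ioo fun t' ht' => key s hs t s' hs' t' ht ht'
    _ = 2 * energy (fun s t => D t s) + 2 * energy D := by
        simp only [lintegral_const, Measure.restrict_apply_univ, Real.volume_Ioo, sub_zero,
          ENNReal.ofReal_one, mul_one]
        have e1 : ∀ t, ∫⁻ s' in Ioo (0 : ℝ) 1, (2 * (∫⁻ σ in Ioo (0 : ℝ) 1, D σ t ^ 2) +
            2 * (∫⁻ τ in Ioo (0 : ℝ) 1, D s' τ ^ 2)) =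
            2 * (∫⁻ σ in Ioo (0 : ℝ) 1, D σ t ^ 2) + 2 * energy D := by
          intro t
          rw [lintegral_add_left measurable_const, lintegral_const,
            lintegral_const_mul' _ _ (by norm_num)]
          simp [energy]
        simp only [e1]
        rw [lintegral_add_right _ measurable_const, lintegral_const_mul' _ _ (by norm_num)]
        simp [energy]
    _ = 4 * energy D := by rw [energy_swap hD, ← add_mul]; norm_num

theorem lintegral_hardy_le (hD : Measurable (Function.uncurry D)) :
    ∫⁻ s in Ioo (0 : ℝ) 1, ∫⁻ t in Ioo (0 : ℝ) 1,
      (ENNReal.ofReal t)⁻¹ ^ 2 * (∫⁻ τ in Ioo 0 t, D s τ) ^ 2 ≤ 4 * energy D := by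
  rw [energy, ← lintegral_const_mul' _ _ (by norm_num)]
  exact lintegral_mono fun s => hardy (hD.comp (measurable_const.prodMk measurable_id))

/-- The two sides of the square that meet at the origin. -/
theorem lintegral_corner_le (h : IsUpperGradient Ψ D) {W : ℝ → ℝ → ℝ≥0∞}
    (hW1 : ∀ s t, W s t ≤ (ENNReal.ofReal s)⁻¹ ^ 2)
    (hW2 : ∀ s t, W s t ≤ (ENNReal.ofReal t)⁻¹ ^ 2) :
    ∫⁻ s in Ioo (0 : ℝ) 1, ∫⁻ t in Ioo (0 : ℝ) 1, ‖Ψ s 0 - Ψ 0 t‖ₑ ^ 2 * W s t ≤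
      16 * energy D := by
  have hD := h.measurable
  have hD' : Measurable (Function.uncurry fun s t => D t s) := hD.comp measurable_swap
  let P : ℝ → ℝ → ℝ≥0∞ := fun s t => (ENNReal.ofReal t)⁻¹ ^ 2 * (∫⁻ τ in Ioo 0 t, D s τ) ^ 2
  let Q : ℝ → ℝ → ℝ≥0∞ := fun s t => (ENNReal.ofReal t)⁻¹ ^ 2 * (∫⁻ τ in Ioo 0 t, D τ s) ^ 2
  have hP : Measurable (Function.uncurry P) :=
    ((ENNReal.measurable_ofReal.comp measurable_snd).inv.pow_const 2).mul
      ((measurable_lintegral_Ioo hD).pow_const 2)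
  have hQ : Measurable (Function.uncurry Q) :=
    ((ENNReal.measurable_ofReal.comp measurable_snd).inv.pow_const 2).mul
      ((measurable_lintegral_Ioo hD').pow_const 2)
  -- The path from (s,0) to (0,t) passes through (s,t). Its vertical leg has length t and takes the
  -- weight t⁻², its horizontal leg has length s and takes s⁻²; each is a Hardy integral, whence 16
  -- = 2 · 4 + 2 · 4.
  have key : ∀ s ∈ Ioo (0 : ℝ) 1, ∀ t ∈ Ioo (0 : ℝ) 1,
      ‖Ψ s 0 - Ψ 0 t‖ₑ ^ 2 * W s t ≤ 2 * P s t + 2 * Q t s := by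
    intro s hs t ht
    have a1 := h.vertical s 0 t ht.1.le
    have a2 := h.horizontal 0 s t hs.1.le
    calc ‖Ψ s 0 - Ψ 0 t‖ₑ ^ 2 * W s t
        = ‖(Ψ s 0 - Ψ s t) - (Ψ 0 t - Ψ s t)‖ₑ ^ 2 * W s t := by congr 3; ring
      _ ≤ ((∫⁻ τ in Ioo 0 t, D s τ) + ∫⁻ σ in Ioo 0 s, D σ t) ^ 2 * W s t := by
          gcongr; exact (enorm_sub_le).trans (add_le_add a1 a2)
      _ ≤ (2 * (∫⁻ τ in Ioo 0 t, D s τ) ^ 2 + 2 * (∫⁻ σ in Ioo 0 s, D σ t) ^ 2) * W s t := by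
          gcongr; exact ENNReal_add_sq_le _ _
      _ = 2 * (W s t * (∫⁻ τ in Ioo 0 t, D s τ) ^ 2) +
          2 * (W s t * (∫⁻ σ in Ioo 0 s, D σ t) ^ 2) := by ring
      _ ≤ _ := by
          simp only [P, Q]
          gcongr
          · exact hW2 s t
          · exact hW1 s t
  calc _ ≤ ∫⁻ s in Ioo (0 : ℝ) 1, ∫⁻ t in Ioo (0 : ℝ) 1, (2 * P s t + 2 * Q t s) :=
        setLIntegral_mono' measurableSet_Ioo fun s hs =>
          setLIntegral_mono' measurableSet_Ioo fun t ht => key s hs t ht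
    _ = 2 * (∫⁻ s in Ioo (0 : ℝ) 1, ∫⁻ t in Ioo (0 : ℝ) 1, P s t) +
        2 * ∫⁻ s in Ioo (0 : ℝ) 1, ∫⁻ t in Ioo (0 : ℝ) 1, Q t s := by
        exact lintegral_lintegral_const_mul_add hP (by norm_num) (by norm_num)
    _ ≤ 2 * (4 * energy D) + 2 * (4 * energy (fun s t => D t s)) := by
        gcongr
        · exact lintegral_hardy_le hD
        · rw [lintegral_lintegral_swap (f := fun s t => Q t s)
            (hQ.comp measurable_swap).aemeasurable]
          exact lintegral_hardy_le hD'
    _ = 16 * energy D := by rw [energy_swap hD]; ring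

/-- Two points of the edge at distance r are joined by a path that rises to height r, runs across,
and descends. The two vertical legs (`P` and its translate `P'`) are Hardy integrals. The horizontal
leg `Q` is handled by Cauchy–Schwarz, which leaves a factor r⁻¹; for fixed σ and r the starting
points s with σ in (s, s + r) form an interval of length r, which cancels it. Altogether 28 = 2 · 4
+ 4 · (4 + 1). -/
theorem lintegral_same_edge_shift_le (h : IsUpperGradient Ψ D) :
    ∫⁻ s in Ioo (0 : ℝ) 1, ∫⁻ r in Ioo (0 : ℝ) 1, (Iio (1 - s)).indicator
      (fun r => ‖Ψ s 0 - Ψ (s + r) 0‖ₑ ^ 2 * (ENNReal.ofReal r)⁻¹ ^ 2) r ≤ 28 * energy D := by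
  have hD := h.measurable
  have hD' : Measurable (Function.uncurry fun s t => D t s) := hD.comp measurable_swap
  let P : ℝ → ℝ → ℝ≥0∞ := fun s r => (ENNReal.ofReal r)⁻¹ ^ 2 * (∫⁻ τ in Ioo 0 r, D s τ) ^ 2
  let P' : ℝ → ℝ → ℝ≥0∞ := fun s r => (Ioo (0 : ℝ) 1).indicator (fun t => P t r) (s + r)
  let M : ℝ → ℝ → ℝ → ℝ≥0∞ := fun s r => (Ioo s (s + r)).indicator
    fun σ => (ENNReal.ofReal r)⁻¹ * D σ r ^ 2
  let Q : ℝ → ℝ → ℝ≥0∞ := fun s r => ∫⁻ σ in Ioo (0 : ℝ) 1, M s r σ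
  have hP : Measurable (Function.uncurry P) :=
    ((ENNReal.measurable_ofReal.comp measurable_snd).inv.pow_const 2).mul
      ((measurable_lintegral_Ioo hD).pow_const 2)
  have hP' : Measurable (Function.uncurry P') := by
    have hS : MeasurableSet {p : ℝ × ℝ | p.1 + p.2 ∈ Ioo (0 : ℝ) 1} :=
      (measurable_fst.add measurable_snd) measurableSet_Ioo
    have h1 : Measurable ({p : ℝ × ℝ | p.1 + p.2 ∈ Ioo (0 : ℝ) 1}.indicator
        fun p => Function.uncurry P (p.1 + p.2, p.2)) :=
      (hP.comp (by fun_prop)).indicator hS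
    exact h1
  have hM : Measurable fun q : (ℝ × ℝ) × ℝ => M q.1.1 q.1.2 q.2 := by
    have hS : MeasurableSet {q : (ℝ × ℝ) × ℝ | q.1.1 < q.2 ∧ q.2 < q.1.1 + q.1.2} :=
      (measurableSet_lt (by fun_prop) measurable_snd).inter
        (measurableSet_lt measurable_snd (by fun_prop))
    have h2 : Measurable fun q : (ℝ × ℝ) × ℝ => Function.uncurry D (q.2, q.1.2) :=
      hD.comp (by fun_prop)
    have h1 : Measurable ({q : (ℝ × ℝ) × ℝ | q.1.1 < q.2 ∧ q.2 < q.1.1 + q.1.2}.indicator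
        fun q => (ENNReal.ofReal q.1.2)⁻¹ * Function.uncurry D (q.2, q.1.2) ^ 2) :=
      (Measurable.mul (by fun_prop) (h2.pow_const 2)).indicator hS
    exact h1
  have hQ : Measurable (Function.uncurry Q) := hM.lintegral_prod_right'
  have key : ∀ s ∈ Ioo (0 : ℝ) 1, ∀ r ∈ Ioo (0 : ℝ) 1, (Iio (1 - s)).indicator
      (fun r => ‖Ψ s 0 - Ψ (s + r) 0‖ₑ ^ 2 * (ENNReal.ofReal r)⁻¹ ^ 2) r ≤
      2 * P s r + 4 * (P' s r + Q s r) := by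
    intro s hs r hr
    by_cases hsr : r ∈ Iio (1 - s)
    swap
    · rw [indicator_of_notMem hsr]; exact zero_le
    rw [indicator_of_mem hsr]
    have hsr1 : s + r < 1 := by have := mem_Iio.mp hsr; linarith
    have hmem : s + r ∈ Ioo (0 : ℝ) 1 := ⟨add_pos hs.1 hr.1, hsr1⟩
    have hr0 : ENNReal.ofReal r ≠ 0 := by simpa using hr.1
    have a1 := h.vertical s 0 r hr.1.le
    have a2 := h.vertical (s + r) 0 r hr.1.le
    have a3 := h.horizontal s (s + r) r (by linarith [hr.1])
    set x := ∫⁻ τ in Ioo 0 r, D s τ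
    set y := ∫⁻ τ in Ioo 0 r, D (s + r) τ
    set z := ∫⁻ σ in Ioo s (s + r), D σ r
    have hz : (ENNReal.ofReal r)⁻¹ ^ 2 * z ^ 2 ≤ Q s r := by
      have b := sq_lintegral_le (volume.restrict (Ioo s (s + r))) (f := fun σ => D σ r)
        (hD.comp (measurable_id.prodMk measurable_const)).aemeasurable
      simp only [Measure.restrict_apply_univ, Real.volume_Ioo, add_sub_cancel_left] at b
      have hsub : Ioo s (s + r) ∩ Ioo 0 1 = Ioo s (s + r) :=
        inter_eq_left.mpr (Ioo_subset_Ioo hs.1.le hsr1.le)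
      calc _ ≤ (ENNReal.ofReal r)⁻¹ ^ 2 * (ENNReal.ofReal r * ∫⁻ σ in Ioo s (s + r), D σ r ^ 2) := by
            gcongr
        _ = (ENNReal.ofReal r)⁻¹ * ∫⁻ σ in Ioo s (s + r), D σ r ^ 2 := by
            rw [sq, ← mul_assoc, mul_assoc _ _ (ENNReal.ofReal r),
              ENNReal.inv_mul_cancel hr0 ENNReal.ofReal_ne_top, mul_one]
        _ = Q s r := by
            simp only [Q, M]
            rw [lintegral_indicator measurableSet_Ioo, Measure.restrict_restrict measurableSet_Ioo,
              hsub, lintegral_const_mul' _ _ (ENNReal.inv_ne_top.mpr hr0)]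
    have hP's : P' s r = (ENNReal.ofReal r)⁻¹ ^ 2 * y ^ 2 := by
      simp only [P']; rw [indicator_of_mem hmem]
    calc ‖Ψ s 0 - Ψ (s + r) 0‖ₑ ^ 2 * (ENNReal.ofReal r)⁻¹ ^ 2
        = ‖(Ψ s 0 - Ψ s r) + ((Ψ s r - Ψ (s + r) r) - (Ψ (s + r) 0 - Ψ (s + r) r))‖ₑ ^ 2 *
            (ENNReal.ofReal r)⁻¹ ^ 2 := by congr 3; ring
      _ ≤ (x + (z + y)) ^ 2 * (ENNReal.ofReal r)⁻¹ ^ 2 := by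
          gcongr
          exact (enorm_add_le _ _).trans (add_le_add a1 (enorm_sub_le.trans (add_le_add a3 a2)))
      _ ≤ (2 * x ^ 2 + 2 * (2 * z ^ 2 + 2 * y ^ 2)) * (ENNReal.ofReal r)⁻¹ ^ 2 := by
          gcongr
          refine (ENNReal_add_sq_le _ _).trans ?_
          gcongr
          exact ENNReal_add_sq_le _ _
      _ = 2 * ((ENNReal.ofReal r)⁻¹ ^ 2 * x ^ 2) + 4 * ((ENNReal.ofReal r)⁻¹ ^ 2 * y ^ 2 +
            (ENNReal.ofReal r)⁻¹ ^ 2 * z ^ 2) := by ring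
      _ ≤ _ := by rw [hP's]; gcongr
  have hIP : ∫⁻ s in Ioo (0 : ℝ) 1, ∫⁻ r in Ioo (0 : ℝ) 1, P s r ≤ 4 * energy D :=
    lintegral_hardy_le hD
  have hIP' : ∫⁻ s in Ioo (0 : ℝ) 1, ∫⁻ r in Ioo (0 : ℝ) 1, P' s r ≤ 4 * energy D := by
    rw [lintegral_lintegral_swap hP'.aemeasurable]
    refine le_trans ?_ hIP
    rw [lintegral_lintegral_swap hP.aemeasurable]
    refine lintegral_mono fun r => ?_
    -- The indicator inside `P'` keeps the translated point in the unit interval, so integrating s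
    -- over the whole line loses nothing and translation invariance applies.
    calc _ ≤ ∫⁻ s, P' s r := setLIntegral_le_lintegral _ _
      _ = ∫⁻ t, (Ioo (0 : ℝ) 1).indicator (fun t => P t r) t :=
          lintegral_add_right_eq_self (fun t => (Ioo (0 : ℝ) 1).indicator (fun t => P t r) t) r
      _ = _ := lintegral_indicator measurableSet_Ioo _
  have hIQ : ∫⁻ s in Ioo (0 : ℝ) 1, ∫⁻ r in Ioo (0 : ℝ) 1, Q s r ≤ energy D := by
    rw [lintegral_lintegral_swap hQ.aemeasurable, ← energy_swap hD, energy]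
    refine setLIntegral_mono' measurableSet_Ioo fun r hr => ?_
    have hr0 : ENNReal.ofReal r ≠ 0 := by simpa using hr.1
    have hm : Measurable (Function.uncurry fun s σ => M s r σ) :=
      hM.comp (f := fun p : ℝ × ℝ => ((p.1, r), p.2)) (by fun_prop)
    simp only [Q]
    rw [lintegral_lintegral_swap hm.aemeasurable]
    refine lintegral_mono fun σ => ?_
    calc _ ≤ ∫⁻ s, M s r σ := setLIntegral_le_lintegral _ _
      _ = ∫⁻ s, (Ioo (σ - r) σ).indicator (fun _ => (ENNReal.ofReal r)⁻¹ * D σ r ^ 2) s := by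
          refine lintegral_congr fun s => ?_
          simp only [M, indicator, mem_Ioo]
          refine if_congr ?_ rfl rfl
          constructor <;> rintro ⟨h1, h2⟩ <;> constructor <;> linarith
      _ = D σ r ^ 2 := by
          rw [lintegral_indicator measurableSet_Ioo, setLIntegral_const, Real.volume_Ioo,
            sub_sub_cancel, mul_right_comm, ENNReal.inv_mul_cancel hr0 ENNReal.ofReal_ne_top,
            one_mul]
  calc _ ≤ ∫⁻ s in Ioo (0 : ℝ) 1, ∫⁻ r in Ioo (0 : ℝ) 1,
        (2 * P s r + 4 * (P' s r + Q s r)) :=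
        setLIntegral_mono' measurableSet_Ioo fun s hs =>
          setLIntegral_mono' measurableSet_Ioo fun r hr => key s hs r hr
    _ = 2 * (∫⁻ s in Ioo (0 : ℝ) 1, ∫⁻ r in Ioo (0 : ℝ) 1, P s r) +
        4 * ((∫⁻ s in Ioo (0 : ℝ) 1, ∫⁻ r in Ioo (0 : ℝ) 1, P' s r) +
          ∫⁻ s in Ioo (0 : ℝ) 1, ∫⁻ r in Ioo (0 : ℝ) 1, Q s r) := by
        rw [lintegral_lintegral_const_mul_add hP (by norm_num) (by norm_num)]
        congr 2
        have := lintegral_lintegral_const_mul_add (μ := volume.restrict (Ioo (0 : ℝ) 1))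
          (ν := volume.restrict (Ioo (0 : ℝ) 1)) (Q := Q) hP' ENNReal.one_ne_top ENNReal.one_ne_top
        simpa only [one_mul] using this
    _ ≤ 2 * (4 * energy D) + 4 * (4 * energy D + energy D) := by gcongr
    _ = 28 * energy D := by ring

/-- The `H^{1/2}` seminorm along one side of the square. -/
theorem lintegral_same_edge_le (h : IsUpperGradient Ψ D) :
    ∫⁻ s in Ioo (0 : ℝ) 1, ∫⁻ t in Ioo (0 : ℝ) 1,
      ‖Ψ s 0 - Ψ t 0‖ₑ ^ 2 * (ENNReal.ofReal |s - t|)⁻¹ ^ 2 ≤ 56 * energy D := by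
  have hΨ : Measurable fun s => Ψ s 0 :=
    h.measurable_fun.comp (measurable_id.prodMk measurable_const)
  -- The integrand is symmetric, so it suffices to treat t > s, where t = s + r. On the diagonal it
  -- is 0 · ∞ = 0.
  let G : ℝ → ℝ → ℝ≥0∞ := fun s => (Ioi s).indicator
    fun t => ‖Ψ s 0 - Ψ t 0‖ₑ ^ 2 * (ENNReal.ofReal (t - s))⁻¹ ^ 2
  have hG : Measurable (Function.uncurry G) := by
    have h1 : Measurable ({p : ℝ × ℝ | p.1 < p.2}.indicator fun p =>
        ‖Ψ p.1 0 - Ψ p.2 0‖ₑ ^ 2 * (ENNReal.ofReal (p.2 - p.1))⁻¹ ^ 2) := by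
      refine Measurable.indicator ?_ (measurableSet_lt measurable_fst measurable_snd)
      have a : Measurable fun p : ℝ × ℝ => Ψ p.1 0 - Ψ p.2 0 :=
        (hΨ.comp measurable_fst).sub (hΨ.comp measurable_snd)
      exact (a.enorm.pow_const 2).mul (by fun_prop)
    exact h1
  have hGle : ∫⁻ s in Ioo (0 : ℝ) 1, ∫⁻ t in Ioo (0 : ℝ) 1, G s t ≤ 28 * energy D := by
    refine le_trans (setLIntegral_mono' measurableSet_Ioo fun s hs => ?_)
      (lintegral_same_edge_shift_le h)
    rw [← lintegral_indicator measurableSet_Ioo,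
      ← lintegral_add_left_eq_self _ s, ← lintegral_indicator measurableSet_Ioo]
    refine lintegral_mono fun r => ?_
    simp only [G, indicator, mem_Ioo, mem_Ioi, mem_Iio, add_sub_cancel_left]
    split_ifs with c1 c2 c3 c4 <;> first | exact le_rfl | exact zero_le | exfalso
    · exact c4 (by linarith [c1.2])
    · exact c3 ⟨by linarith, by linarith [c1.2, hs.1]⟩
  have hpt : ∀ s t, ‖Ψ s 0 - Ψ t 0‖ₑ ^ 2 * (ENNReal.ofReal |s - t|)⁻¹ ^ 2 ≤
      1 * G s t + 1 * G t s := by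
    intro s t
    rcases lt_trichotomy s t with hlt | rfl | hlt
    · rw [abs_sub_comm, abs_of_pos (sub_pos.mpr hlt), one_mul]
      exact le_add_right (by simp only [G]; rw [indicator_of_mem (mem_Ioi.mpr hlt)])
    · simp
    · rw [abs_of_pos (sub_pos.mpr hlt), one_mul, one_mul, enorm_sub_rev]
      exact le_add_left (by simp only [G]; rw [indicator_of_mem (mem_Ioi.mpr hlt)])
  calc _ ≤ ∫⁻ s in Ioo (0 : ℝ) 1, ∫⁻ t in Ioo (0 : ℝ) 1, (1 * G s t + 1 * G t s) :=
        lintegral_mono fun s => lintegral_mono fun t => hpt s t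
    _ = 1 * (∫⁻ s in Ioo (0 : ℝ) 1, ∫⁻ t in Ioo (0 : ℝ) 1, G s t) +
        1 * ∫⁻ s in Ioo (0 : ℝ) 1, ∫⁻ t in Ioo (0 : ℝ) 1, G t s :=
        lintegral_lintegral_const_mul_add hG ENNReal.one_ne_top ENNReal.one_ne_top
    _ = (∫⁻ s in Ioo (0 : ℝ) 1, ∫⁻ t in Ioo (0 : ℝ) 1, G s t) +
        ∫⁻ s in Ioo (0 : ℝ) 1, ∫⁻ t in Ioo (0 : ℝ) 1, G s t := by
        rw [one_mul, one_mul, lintegral_lintegral_swap (f := fun s t => G t s)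
          (hG.comp measurable_swap).aemeasurable]
    _ ≤ 28 * energy D + 28 * energy D := add_le_add hGle hGle
    _ = 56 * energy D := by ring

end Square

/-! ### Closedness of `H^{1/2}` and `H¹` -/

/-- The relation between a function and its difference quotient holds almost everywhere only, so an
L² limit is handled by extracting twice: a subsequence along which the functions converge a.e., then
one along which the quotients do. -/
theorem isClosed_H12 (σ : Measure Plane) [IsFiniteMeasure σ] :
    IsClosed (H12 σ : Set (WithLp 2 (Lp ℂ 2 σ × Lp ℂ 2 (σ.prod σ)))) := by
  refine isClosed_of_closure_subset fun p hp => ?_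
  obtain ⟨u, hu, hlim⟩ := mem_closure_iff_seq_limit.mp hp
  have h1 : Tendsto (fun n => (u n).fst) atTop (𝓝 p.fst) :=
    ((WithLp.fstL 2 ℂ (Lp ℂ 2 σ) (Lp ℂ 2 (σ.prod σ))).continuous.tendsto p).comp hlim
  have h2 : Tendsto (fun n => (u n).snd) atTop (𝓝 p.snd) :=
    ((WithLp.sndL 2 ℂ (Lp ℂ 2 σ) (Lp ℂ 2 (σ.prod σ))).continuous.tendsto p).comp hlim
  obtain ⟨ns, hns, hae1⟩ := (tendstoInMeasure_of_tendsto_Lp h1).exists_seq_tendsto_ae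
  obtain ⟨ms, hms, hae2⟩ := (tendstoInMeasure_of_tendsto_Lp
    (h2.comp hns.tendsto_atTop)).exists_seq_tendsto_ae
  have a1 := Measure.quasiMeasurePreserving_fst (μ := σ) (ν := σ) |>.ae hae1
  have a2 := Measure.quasiMeasurePreserving_snd (μ := σ) (ν := σ) |>.ae hae1
  have a3 : ∀ᵐ z ∂(σ.prod σ), ∀ n, (u n).snd z =
      ((u n).fst z.1 - (u n).fst z.2) / (dist z.1 z.2 : ℂ) := ae_all_iff.mpr hu
  change ∀ᵐ z ∂(σ.prod σ), p.snd z = (p.fst z.1 - p.fst z.2) / (dist z.1 z.2 : ℂ)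
  filter_upwards [a1, a2, a3, hae2] with z b1 b2 b3 b4
  refine tendsto_nhds_unique b4 ?_
  have c1 := b1.comp hms.tendsto_atTop
  have c2 := b2.comp hms.tendsto_atTop
  refine ((c1.sub c2).div_const (dist z.1 z.2 : ℂ)).congr fun n => ?_
  exact (b3 (ns (ms n))).symm

instance completeSpace_H12 (σ : Measure Plane) [IsFiniteMeasure σ] : CompleteSpace (H12 σ) :=
  (isClosed_H12 σ).completeSpace_coe

theorem H12.toL2_injective (σ : Measure Plane) [IsFiniteMeasure σ] :
    Function.Injective (H12.toL2 σ) := by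
  intro f g h
  have h1 : f.1.fst = g.1.fst := h
  refine Subtype.ext ((WithLp.ofLp_injective 2) (Prod.ext h1 ?_))
  refine Lp.ext ?_
  filter_upwards [f.2, g.2] with z hf hg
  refine hf.trans (Eq.trans ?_ hg.symm)
  rw [h1]

theorem continuous_integral_mul {α : Type*} [MeasurableSpace α] {μ : Measure α} {g : α → ℂ}
    (hg : MemLp g 2 μ) : Continuous fun f : Lp ℂ 2 μ => ∫ x, f x * g x ∂μ := by
  have h : (fun f : Lp ℂ 2 μ => ∫ x, f x * g x ∂μ) =
      fun f => (ContinuousLinearMap.mul ℂ ℂ).lpPairing μ 2 2 f (hg.toLp g) := by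
    funext f
    rw [ContinuousLinearMap.lpPairing_eq_integral]
    refine integral_congr_ae ?_
    filter_upwards [hg.coeFn_toLp] with x hx
    simp [hx]
  rw [h]
  fun_prop

theorem isClosed_H1 (Ω : Set Plane) :
    IsClosed (H1 Ω : Set (WithLp 2 (Lp ℂ 2 (volume.restrict Ω) ×
      Lp (EuclideanSpace ℂ (Fin 2)) 2 (volume.restrict Ω)))) := by
  have : (H1 Ω : Set (WithLp 2 (Lp ℂ 2 (volume.restrict Ω) ×
      Lp (EuclideanSpace ℂ (Fin 2)) 2 (volume.restrict Ω)))) =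
      ⋂ (φ : Plane → ℂ) (_ : IsTest Ω φ) (i : Fin 2), {p | ∫ x in Ω, p.fst x * pderiv i φ x =
        - ∫ x in Ω, L2.comp i p.snd x * φ x} := by
    ext p
    simp only [Set.mem_iInter]
    rfl
  rw [this]
  refine isClosed_iInter fun φ => isClosed_iInter fun hφ => isClosed_iInter fun i =>
    isClosed_eq ?_ ?_
  · exact (continuous_integral_mul (hφ.memLp_pderiv i _)).comp
      (WithLp.fstL 2 ℂ (Lp ℂ 2 (volume.restrict Ω)) _).continuous
  · exact ((continuous_integral_mul (hφ.memLp _)).comp ((L2.comp i).continuous.comp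
      (WithLp.sndL 2 ℂ (Lp ℂ 2 (volume.restrict Ω)) _).continuous)).neg

instance completeSpace_H1 (Ω : Set Plane) : CompleteSpace (H1 Ω) :=
  (isClosed_H1 Ω).completeSpace_coe

/-! ### Structure of `H¹` -/

section

variable {Ω : Set Plane}

theorem L2.coeFn_comp {μ : Measure Plane} (i : Fin 2)
    (F : Lp (EuclideanSpace ℂ (Fin 2)) 2 μ) : L2.comp i F =ᵐ[μ] fun x => F x i :=
  ContinuousLinearMap.coeFn_compLpL _ F

theorem L2.ext_comp {μ : Measure Plane} {F G : Lp (EuclideanSpace ℂ (Fin 2)) 2 μ}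
    (h : ∀ i, L2.comp i F = L2.comp i G) : F = G := by
  refine Lp.ext ?_
  have hF : ∀ᵐ x ∂μ, ∀ i, L2.comp i F x = F x i := ae_all_iff.mpr fun i => L2.coeFn_comp i F
  have hG : ∀ᵐ x ∂μ, ∀ i, L2.comp i G x = G x i := ae_all_iff.mpr fun i => L2.coeFn_comp i G
  filter_upwards [hF, hG] with x h1 h2
  ext i
  rw [← h1, ← h2, h]

/-- The vector valued `L²` function with given components. -/
def L2.vec {μ : Measure Plane} (g : Fin 2 → Lp ℂ 2 μ) : Lp (EuclideanSpace ℂ (Fin 2)) 2 μ :=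
  MemLp.toLp (fun x => WithLp.toLp 2 fun i => g i x)
    (MemLp.of_eval_piLp fun i => Lp.memLp (g i))

theorem L2.comp_vec {μ : Measure Plane} (g : Fin 2 → Lp ℂ 2 μ) (i : Fin 2) :
    L2.comp i (L2.vec g) = g i := by
  refine Lp.ext ?_
  filter_upwards [L2.coeFn_comp i (L2.vec g), MemLp.coeFn_toLp (f := fun x => WithLp.toLp 2
    fun i => g i x) (MemLp.of_eval_piLp fun i => Lp.memLp (g i))] with x h1 h2
  rw [h1, L2.vec, h2]

/-- The element of `H¹` with given function and given weak gradient. -/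
def H1.mk (f : Lp ℂ 2 (volume.restrict Ω)) (g : Fin 2 → Lp ℂ 2 (volume.restrict Ω))
    (h : ∀ φ, IsTest Ω φ → ∀ i,
      ∫ x in Ω, f x * pderiv i φ x = - ∫ x in Ω, g i x * φ x) : H1 Ω :=
  ⟨WithLp.toLp 2 (f, L2.vec g), fun φ hφ i => by
    simpa only [WithLp.toLp_fst, WithLp.toLp_snd, L2.comp_vec] using h φ hφ i⟩

@[simp]
theorem H1.grad_mk (f : Lp ℂ 2 (volume.restrict Ω)) (g : Fin 2 → Lp ℂ 2 (volume.restrict Ω)) (h)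
    (i : Fin 2) : H1.grad (H1.mk f g h) i = g i := L2.comp_vec g i

theorem H1.weak (u : H1 Ω) {φ : Plane → ℂ} (hφ : IsTest Ω φ) (i : Fin 2) :
    ∫ x in Ω, H1.fn u x * pderiv i φ x = - ∫ x in Ω, H1.grad u i x * φ x := u.2 φ hφ i

/-- The inclusion `H¹ → L²`. -/
def H1.fnL (Ω : Set Plane) : H1 Ω →L[ℂ] Lp ℂ 2 (volume.restrict Ω) :=
  (WithLp.fstL 2 ℂ _ _).comp (H1 Ω).subtypeL

/-- The weak partial derivative as a map `H¹ → L²`. -/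
def H1.gradL (Ω : Set Plane) (i : Fin 2) : H1 Ω →L[ℂ] Lp ℂ 2 (volume.restrict Ω) :=
  (L2.comp i).comp ((WithLp.sndL 2 ℂ _ _).comp (H1 Ω).subtypeL)

theorem H1.ext_fn_grad {u v : H1 Ω} (h : H1.fn u = H1.fn v)
    (h' : ∀ i, H1.grad u i = H1.grad v i) : u = v :=
  Subtype.ext ((WithLp.ofLp_injective 2) (Prod.ext h (L2.ext_comp h')))

theorem inner_L2_vec {μ : Measure Plane} (F G : Lp (EuclideanSpace ℂ (Fin 2)) 2 μ) :
    inner ℂ F G = ∑ i, inner ℂ (L2.comp i F) (L2.comp i G) := by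
  have hF : ∀ᵐ x ∂μ, ∀ i, L2.comp i F x = F x i := ae_all_iff.mpr fun i => L2.coeFn_comp i F
  have hG : ∀ᵐ x ∂μ, ∀ i, L2.comp i G x = G x i := ae_all_iff.mpr fun i => L2.coeFn_comp i G
  simp only [MeasureTheory.L2.inner_def]
  rw [← integral_finsetSum _ fun i _ => MeasureTheory.L2.integrable_inner _ _]
  refine integral_congr_ae ?_
  filter_upwards [hF, hG] with x h1 h2
  simp only [h1, h2]
  exact PiLp.inner_apply _ _

/-- The Hilbert structure on pairs is exactly the H¹ inner product; this identifies the abstract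
identity operator with the gradient form plus the L² form. -/
theorem H1.inner_eq (u v : H1 Ω) : inner ℂ u v =
    inner ℂ (H1.fn u) (H1.fn v) + ∑ i, inner ℂ (H1.grad u i) (H1.grad v i) := by
  rw [Submodule.coe_inner, WithLp.prod_inner_apply]
  congr 1
  exact inner_L2_vec _ _

theorem H1.norm_sq_eq (u : H1 Ω) :
    ‖u‖ ^ 2 = ‖H1.fn u‖ ^ 2 + ∑ i, ‖H1.grad u i‖ ^ 2 := by
  have h := H1.inner_eq u u
  rw [inner_self_eq_norm_sq_to_K (𝕜 := ℂ) u] at h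
  simp only [inner_self_eq_norm_sq_to_K] at h
  exact_mod_cast h

/-! ### Complex conjugation -/

theorem L2.inner_star_left {α : Type*} [MeasurableSpace α] {μ : Measure α} (f g : Lp ℂ 2 μ) :
    inner ℂ (star f) g = ∫ x, f x * g x ∂μ := by
  rw [MeasureTheory.L2.inner_def]
  refine integral_congr_ae ?_
  filter_upwards [Lp.coeFn_star f] with x hx
  rw [hx]
  simp [mul_comm]

theorem L2.inner_star_star {α : Type*} [MeasurableSpace α] {μ : Measure α} (f g : Lp ℂ 2 μ) :
    inner ℂ (star f) (star g) = inner ℂ g f := by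
  rw [MeasureTheory.L2.inner_def, MeasureTheory.L2.inner_def]
  refine integral_congr_ae ?_
  filter_upwards [Lp.coeFn_star f, Lp.coeFn_star g] with x hx hx'
  rw [hx, hx']
  simp [mul_comm]

theorem L2.star_sub {α : Type*} [MeasurableSpace α] {μ : Measure α} (f g : Lp ℂ 2 μ) :
    star (f - g) = star f - star g := by
  refine Lp.ext ?_
  filter_upwards [Lp.coeFn_star (f - g), Lp.coeFn_star f, Lp.coeFn_star g, Lp.coeFn_sub f g,
    Lp.coeFn_sub (star f) (star g)] with x h1 h2 h3 h4 h5
  rw [h1, h5, Pi.sub_apply, h2, h3, Pi.star_apply, h4, Pi.sub_apply, _root_.star_sub]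
  rfl

theorem L2.norm_star {α : Type*} [MeasurableSpace α] {μ : Measure α} (f : Lp ℂ 2 μ) :
    ‖star f‖ = ‖f‖ := by
  have h := L2.inner_star_star f f
  simp only [inner_self_eq_norm_sq_to_K] at h
  have h' : ‖star f‖ ^ 2 = ‖f‖ ^ 2 := by exact_mod_cast h
  exact (pow_left_inj₀ (norm_nonneg _) (norm_nonneg _) two_ne_zero).mp h'

theorem pderiv_star {φ : Plane → ℂ} (hφ : ContDiff ℝ ∞ φ) (i : Fin 2) (x : Plane) :
    pderiv i (fun y => star (φ y)) x = star (pderiv i φ x) := by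
  have h := (hφ.differentiable (by simp) x).hasFDerivAt
  have h2 := (Complex.conjCLE : ℂ →L[ℝ] ℂ).hasFDerivAt.comp x h
  have h3 : fderiv ℝ (fun y => star (φ y)) x = (Complex.conjCLE : ℂ →L[ℝ] ℂ).comp (fderiv ℝ φ x) :=
    h2.fderiv
  rw [pderiv, h3]
  rfl

theorem IsTest.conj {φ : Plane → ℂ} (h : IsTest Ω φ) : IsTest Ω fun x => star (φ x) := by
  have hs : Function.support (fun x => star (φ x)) = Function.support φ := by
    ext x; simp
  refine ⟨Complex.conjCLE.contDiff.comp h.1, ?_, ?_⟩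
  · rw [HasCompactSupport, tsupport, hs]; exact h.2.1
  · rw [tsupport, hs]; exact h.2.2

/-- Complex conjugation on `H¹`. -/
def H1.conj (u : H1 Ω) : H1 Ω :=
  H1.mk (star (H1.fn u)) (fun i => star (H1.grad u i)) fun φ hφ i => by
    have h := congrArg star (H1.weak u hφ.conj i)
    rw [star_neg] at h
    simp only [RCLike.star_def, ← integral_conj] at h
    convert! h using 1
    · refine integral_congr_ae ?_
      filter_upwards [Lp.coeFn_star (H1.fn u)] with x hx
      rw [hx]
      have := pderiv_star hφ.1 i x
      simp only [RCLike.star_def] at this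
      simp [this]
    · congr 1
      refine integral_congr_ae ?_
      filter_upwards [Lp.coeFn_star (H1.grad u i)] with x hx
      rw [hx]
      simp

@[simp]
theorem H1.fn_conj (u : H1 Ω) : H1.fn (H1.conj u) = star (H1.fn u) := rfl

@[simp]
theorem H1.grad_conj (u : H1 Ω) (i : Fin 2) : H1.grad (H1.conj u) i = star (H1.grad u i) :=
  H1.grad_mk _ _ _ i

attribute [irreducible] H1.conj

theorem H1.conj_conj (u : H1 Ω) : H1.conj (H1.conj u) = u :=
  H1.ext_fn_grad (by simp) (by simp)

theorem H1.inner_conj_conj (u v : H1 Ω) : inner ℂ (H1.conj u) (H1.conj v) = inner ℂ v u := by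
  simp only [H1.inner_eq, H1.fn_conj, H1.grad_conj, L2.inner_star_star]

/-- Green's formula and all dualities are bilinear, whereas Hilbert space theory is sesquilinear;
conjugating the test function translates one into the other. -/
theorem H1.inner_conj_left (u v : H1 Ω) : inner ℂ (H1.conj u) v =
    (∫ x in Ω, H1.fn u x * H1.fn v x) + ∑ i, ∫ x in Ω, H1.grad u i x * H1.grad v i x := by
  simp only [H1.inner_eq, H1.fn_conj, H1.grad_conj, L2.inner_star_left]

theorem H1.conj_sub (u v : H1 Ω) : H1.conj (u - v) = H1.conj u - H1.conj v := by
  have e1 : ∀ a b : H1 Ω, H1.fn (a - b) = H1.fn a - H1.fn b := fun _ _ => rfl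
  have e2 : ∀ (a b : H1 Ω) (i : Fin 2), H1.grad (a - b) i = H1.grad a i - H1.grad b i :=
    fun a b i => map_sub (H1.gradL Ω i) a b
  refine H1.ext_fn_grad ?_ fun i => ?_
  · simp only [e1, H1.fn_conj, L2.star_sub]
  · simp only [e2, H1.grad_conj, L2.star_sub]

theorem H1.norm_conj (u : H1 Ω) : ‖H1.conj u‖ = ‖u‖ := by
  have h2 : ‖H1.conj u‖ ^ 2 = ‖u‖ ^ 2 := by
    rw [H1.norm_sq_eq (H1.conj u), H1.norm_sq_eq u]
    simp only [H1.fn_conj, H1.grad_conj, L2.norm_star]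
  exact (pow_left_inj₀ (norm_nonneg _) (norm_nonneg _) two_ne_zero).mp h2

theorem H1.isometry_conj : Isometry (H1.conj : H1 Ω → H1 Ω) := by
  refine Isometry.of_dist_eq fun u v => ?_
  calc dist (H1.conj u) (H1.conj v) = ‖H1.conj u - H1.conj v‖ := dist_eq_norm _ _
    _ = ‖H1.conj (u - v)‖ := congrArg norm (H1.conj_sub u v).symm
    _ = ‖u - v‖ := H1.norm_conj _
    _ = dist u v := (dist_eq_norm u v).symm

/-! ### Smooth functions in `H¹` -/

/-- Both integrands vanish off Ω, so this is integration by parts on the whole plane, and the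
regularity of Ω plays no role. -/
theorem integral_mul_pderiv {Φ φ : Plane → ℂ} (hΦ : ContDiff ℝ ∞ Φ) (hφ : IsTest Ω φ)
    (i : Fin 2) : ∫ x in Ω, Φ x * pderiv i φ x = - ∫ x in Ω, pderiv i Φ x * φ x := by
  have hs : Function.support φ ⊆ Ω := (subset_tsupport φ).trans hφ.2.2
  have hs' : Function.support (pderiv i φ) ⊆ Ω := by
    refine (Function.support_subset_iff'.mpr fun x hx => ?_ : _ ⊆ tsupport φ).trans hφ.2.2
    rw [pderiv, fderiv_of_notMem_tsupport ℝ hx]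
    rfl
  have c1 : Continuous (pderiv i φ) := (hφ.1.continuous_fderiv (by simp)).clm_apply continuous_const
  have c2 : Continuous (pderiv i Φ) := (hΦ.continuous_fderiv (by simp)).clm_apply continuous_const
  have k1 : HasCompactSupport (pderiv i φ) := hφ.2.1.fderiv_apply ℝ _
  rw [setIntegral_eq_integral_of_forall_compl_eq_zero,
    setIntegral_eq_integral_of_forall_compl_eq_zero]
  · refine integral_mul_fderiv_eq_neg_fderiv_mul_of_integrable ?_ ?_ ?_ ?_ ?_
    · exact (c2.mul hφ.1.continuous).integrable_of_hasCompactSupport hφ.2.1.mul_left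
    · exact (hΦ.continuous.mul c1).integrable_of_hasCompactSupport k1.mul_left
    · exact (hΦ.continuous.mul hφ.1.continuous).integrable_of_hasCompactSupport hφ.2.1.mul_left
    · exact fun x _ => hΦ.differentiable (by simp) x
    · exact fun x _ => hφ.1.differentiable (by simp) x
  · intro x hx
    rw [Function.notMem_support.mp fun h => hx (hs h), mul_zero]
  · intro x hx
    rw [Function.notMem_support.mp fun h => hx (hs' h), mul_zero]

/-- The fundamental lemma of the calculus of variations. -/
theorem ae_eq_of_integral_test (hΩ : IsOpen Ω) {f g : Plane → ℂ}
    (hf : LocallyIntegrableOn f Ω) (hg : LocallyIntegrableOn g Ω)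
    (hfi : ∀ φ, IsTest Ω φ → Integrable (fun x => f x * φ x) (volume.restrict Ω))
    (hgi : ∀ φ, IsTest Ω φ → Integrable (fun x => g x * φ x) (volume.restrict Ω))
    (h : ∀ φ, IsTest Ω φ → ∫ x in Ω, f x * φ x = ∫ x in Ω, g x * φ x) :
    f =ᵐ[volume.restrict Ω] g := by
  have key := hΩ.ae_eq_zero_of_integral_contDiff_smul_eq_zero (μ := volume) (hf.sub hg) ?_
  · rw [EventuallyEq, ae_restrict_iff' hΩ.measurableSet]
    filter_upwards [key] with x hx hxΩ
    exact sub_eq_zero.mp (hx hxΩ)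
  · intro ψ h1 h2 h3
    have hs : Function.support (fun x => (ψ x : ℂ)) = Function.support ψ := by
      ext x; simp
    have hφ : IsTest Ω (fun x => (ψ x : ℂ)) := by
      refine ⟨Complex.ofRealCLM.contDiff.comp h1, ?_, ?_⟩
      · rw [HasCompactSupport, tsupport, hs]; exact h2
      · rw [tsupport, hs]; exact h3
    rw [← setIntegral_eq_integral_of_forall_compl_eq_zero (s := Ω)]
    · have := h _ hφ
      rw [← sub_eq_zero, ← integral_sub (hfi _ hφ) (hgi _ hφ)] at this
      rw [← this]
      refine integral_congr_ae (.of_forall fun x => ?_)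
      simp only [Pi.sub_apply, Complex.real_smul]
      ring
    · intro x hx
      rw [Function.notMem_support.mp fun hh => hx (h3 (subset_tsupport _ hh)), zero_smul]

theorem Lp.locallyIntegrableOn (f : Lp ℂ 2 (volume.restrict Ω)) : LocallyIntegrableOn f Ω := by
  intro x hx
  refine ⟨Metric.ball x 1 ∩ Ω, inter_mem (mem_nhdsWithin_of_mem_nhds
    (Metric.ball_mem_nhds x one_pos)) self_mem_nhdsWithin, ?_⟩
  rw [IntegrableOn, ← Measure.restrict_restrict Metric.isOpen_ball.measurableSet]
  have : IsFiniteMeasure ((volume.restrict Ω).restrict (Metric.ball x 1)) := by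
    refine ⟨?_⟩
    rw [Measure.restrict_restrict Metric.isOpen_ball.measurableSet, Measure.restrict_apply_univ]
    exact (measure_mono Set.inter_subset_left).trans_lt measure_ball_lt_top
  exact ((Lp.memLp f).restrict _).integrable (by norm_num)

theorem Lp.ae_eq_of_integral_test (hΩ : IsOpen Ω) (f g : Lp ℂ 2 (volume.restrict Ω))
    (h : ∀ φ, IsTest Ω φ → ∫ x in Ω, f x * φ x = ∫ x in Ω, g x * φ x) : f = g :=
  Lp.ext (RtR.ae_eq_of_integral_test hΩ (Lp.locallyIntegrableOn f) (Lp.locallyIntegrableOn g)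
    (fun _ hφ => (Lp.memLp f).integrable_mul (hφ.memLp _))
    (fun _ hφ => (Lp.memLp g).integrable_mul (hφ.memLp _)) h)

theorem memLp_pderiv {Φ : Plane → ℂ} (h : ContDiff ℝ ∞ Φ) (h' : HasCompactSupport Φ) (i : Fin 2) :
    MemLp (pderiv i Φ) 2 (volume.restrict Ω) :=
  IsTest.memLp_pderiv (Ω := Set.univ) ⟨h, h', Set.subset_univ _⟩ i _

/-- Weak gradients on an open set are unique, and the classical one is a weak one. -/
theorem H1.IsSmooth.grad_ae_eq (hΩ : IsOpen Ω) {u : H1 Ω} {Φ : Plane → ℂ} (h : H1.IsSmooth u Φ)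
    (i : Fin 2) : H1.grad u i =ᵐ[volume.restrict Ω] pderiv i Φ := by
  have hm : MemLp (pderiv i Φ) 2 (volume.restrict Ω) := memLp_pderiv h.1 h.2.1 i
  have key : H1.grad u i = hm.toLp _ := by
    refine Lp.ae_eq_of_integral_test hΩ _ _ fun φ hφ => ?_
    have h1 := H1.weak u hφ i
    have h2 := integral_mul_pderiv h.1 hφ i
    have h3 : ∫ x in Ω, H1.fn u x * pderiv i φ x = ∫ x in Ω, Φ x * pderiv i φ x := by
      refine integral_congr_ae ?_
      filter_upwards [h.2.2] with x hx
      rw [hx]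
    have h4 : ∫ x in Ω, hm.toLp _ x * φ x = ∫ x in Ω, pderiv i Φ x * φ x := by
      refine integral_congr_ae ?_
      filter_upwards [hm.coeFn_toLp] with x hx
      rw [hx]
    rw [h4, ← neg_inj, ← h1, ← h2, h3]
  rw [key]
  exact hm.coeFn_toLp

/-- Test functions as elements of `H¹`. -/
def H1.ofTest {φ : Plane → ℂ} (h : IsTest Ω φ) : H1 Ω :=
  H1.mk ((h.memLp _).toLp φ) (fun i => (h.memLp_pderiv i _).toLp (pderiv i φ)) fun ψ hψ i => by
    have h1 := integral_mul_pderiv h.1 hψ i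
    convert! h1 using 1
    · refine integral_congr_ae ?_
      filter_upwards [(h.memLp (volume.restrict Ω)).coeFn_toLp] with x hx
      rw [hx]
    · congr 1
      refine integral_congr_ae ?_
      filter_upwards [(h.memLp_pderiv i (volume.restrict Ω)).coeFn_toLp] with x hx
      rw [hx]

theorem H1.isSmooth_ofTest {φ : Plane → ℂ} (h : IsTest Ω φ) : H1.IsSmooth (H1.ofTest h) φ :=
  ⟨h.1, h.2.1, (h.memLp _).coeFn_toLp⟩

theorem H1.grad_ofTest {φ : Plane → ℂ} (h : IsTest Ω φ) (i : Fin 2) :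
    H1.grad (H1.ofTest h) i =ᵐ[volume.restrict Ω] pderiv i φ := by
  rw [H1.ofTest, H1.grad_mk]
  exact (h.memLp_pderiv i _).coeFn_toLp

theorem H1.IsSmooth.sub {u v : H1 Ω} {Φ Ψ : Plane → ℂ} (h : H1.IsSmooth u Φ)
    (h' : H1.IsSmooth v Ψ) : H1.IsSmooth (u - v) (Φ - Ψ) := by
  refine ⟨h.1.sub h'.1, h.2.1.sub h'.2.1, ?_⟩
  have : H1.fn (u - v) = H1.fn u - H1.fn v := rfl
  rw [this]
  exact (Lp.coeFn_sub _ _).trans (h.2.2.sub h'.2.2)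

theorem H1.IsSmooth.add {u v : H1 Ω} {Φ Ψ : Plane → ℂ} (h : H1.IsSmooth u Φ)
    (h' : H1.IsSmooth v Ψ) : H1.IsSmooth (u + v) (Φ + Ψ) := by
  refine ⟨h.1.add h'.1, h.2.1.add h'.2.1, ?_⟩
  have : H1.fn (u + v) = H1.fn u + H1.fn v := rfl
  rw [this]
  exact (Lp.coeFn_add _ _).trans (h.2.2.add h'.2.2)

theorem H1.IsSmooth.smul {u : H1 Ω} {Φ : Plane → ℂ} (h : H1.IsSmooth u Φ) (r : ℂ) :
    H1.IsSmooth (r • u) (r • Φ) := by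
  refine ⟨contDiff_const.smul h.1, h.2.1.smul_left (f := fun _ => r), ?_⟩
  have : H1.fn (r • u) = r • H1.fn u := rfl
  rw [this]
  exact (Lp.coeFn_smul _ _).trans (h.2.2.const_smul r)

theorem H1.IsSmooth.conj {u : H1 Ω} {Φ : Plane → ℂ} (h : H1.IsSmooth u Φ) :
    H1.IsSmooth (H1.conj u) fun x => star (Φ x) := by
  have ht := IsTest.conj (Ω := Set.univ) ⟨h.1, h.2.1, Set.subset_univ _⟩
  refine ⟨ht.1, ht.2.1, ?_⟩
  rw [H1.fn_conj]
  filter_upwards [Lp.coeFn_star (H1.fn u), h.2.2] with x h1 h2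
  rw [h1, Pi.star_apply, h2]

/-- The operator norm is at most the Hilbert–Schmidt norm. Hence the scalar `‖fderiv ℝ Φ x‖ₑ` can
serve as the upper gradient while the H¹ norm is built from the partial derivatives. -/
theorem enorm_fderiv_sq_le (Φ : Plane → ℂ) (x : Plane) :
    ‖fderiv ℝ Φ x‖ₑ ^ 2 ≤ ∑ i, ‖pderiv i Φ x‖ₑ ^ 2 := by
  have h : ‖fderiv ℝ Φ x‖ ≤ Real.sqrt (∑ i, ‖pderiv i Φ x‖ ^ 2) := by
    refine ContinuousLinearMap.opNorm_le_bound _ (Real.sqrt_nonneg _) fun v => ?_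
    have hv : v = ∑ i, v i • EuclideanSpace.single i (1 : ℝ) := by
      ext j; fin_cases j <;> simp
    have h1 : fderiv ℝ Φ x v = ∑ i, (v i : ℂ) * pderiv i Φ x := by
      conv_lhs => rw [hv]
      simp [pderiv, Complex.real_smul]
    rw [h1]
    calc ‖∑ i, (v i : ℂ) * pderiv i Φ x‖ ≤ ∑ i, ‖pderiv i Φ x‖ * ‖v i‖ := by
          refine (norm_sum_le _ _).trans_eq (Finset.sum_congr rfl fun i _ => ?_)
          rw [norm_mul, Complex.norm_real, mul_comm]
      _ ≤ Real.sqrt (∑ i, ‖pderiv i Φ x‖ ^ 2) * Real.sqrt (∑ i, ‖v i‖ ^ 2) :=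
          Real.sum_mul_le_sqrt_mul_sqrt _ _ _
      _ = _ := by rw [EuclideanSpace.norm_eq]
  have h2 : ‖fderiv ℝ Φ x‖ ^ 2 ≤ ∑ i, ‖pderiv i Φ x‖ ^ 2 :=
    (Real.le_sqrt (norm_nonneg _) (by positivity)).mp h
  simp only [← ofReal_norm]
  rw [← ENNReal.ofReal_pow (norm_nonneg _)]
  simp only [← ENNReal.ofReal_pow (norm_nonneg _)]
  rw [← ENNReal.ofReal_sum_of_nonneg fun i _ => by positivity]
  exact ENNReal.ofReal_le_ofReal h2

theorem L2.enorm_sq {α : Type*} [MeasurableSpace α] {μ : Measure α} (f : Lp ℂ 2 μ) :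
    ‖f‖ₑ ^ 2 = ∫⁻ x, ‖f x‖ₑ ^ 2 ∂μ := by
  rw [Lp.enorm_def, ← ENNReal.rpow_natCast]
  have := eLpNorm_nnreal_pow_eq_lintegral (f := f) (μ := μ) (p := 2) (by norm_num)
  simpa using this

/-- Bridge from estimates of explicit integrals of Φ to estimates by the abstract norm of `H1`. -/
theorem H1.IsSmooth.lintegral_le (hΩ : IsOpen Ω) {u : H1 Ω} {Φ : Plane → ℂ}
    (h : H1.IsSmooth u Φ) :
    (∫⁻ x in Ω, ‖Φ x‖ₑ ^ 2) + ∫⁻ x in Ω, ‖fderiv ℝ Φ x‖ₑ ^ 2 ≤ ‖u‖ₑ ^ 2 := by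
  have e : ‖u‖ₑ ^ 2 = ‖H1.fn u‖ₑ ^ 2 + ∑ i, ‖H1.grad u i‖ₑ ^ 2 := by
    simp only [← ofReal_norm]
    rw [← ENNReal.ofReal_pow (norm_nonneg _), H1.norm_sq_eq, ENNReal.ofReal_add (by positivity)
      (by positivity), ENNReal.ofReal_sum_of_nonneg fun i _ => by positivity]
    simp only [← ENNReal.ofReal_pow (norm_nonneg _)]
  rw [e]
  refine add_le_add ?_ ?_
  · rw [L2.enorm_sq]
    refine (lintegral_congr_ae ?_).le
    filter_upwards [h.2.2] with x hx
    rw [hx]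
  · have e2 : ∀ i, ‖H1.grad u i‖ₑ ^ 2 = ∫⁻ x in Ω, ‖pderiv i Φ x‖ₑ ^ 2 := fun i => by
      rw [L2.enorm_sq]
      refine lintegral_congr_ae ?_
      filter_upwards [h.grad_ae_eq hΩ i] with x hx
      rw [hx]
    simp only [e2]
    rw [← lintegral_finsetSum]
    · exact lintegral_mono fun x => enorm_fderiv_sq_le Φ x
    · intro i _
      have c : Continuous (pderiv i Φ) :=
        (h.1.continuous_fderiv (by simp)).clm_apply continuous_const
      exact (c.measurable.enorm.pow_const 2)

end

/-! ### Rectangles -/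

section Rect

open Set

/-- Side lengths are allowed to be negative, so that an estimate at one corner of the unit square
serves all four corners of a box. -/
theorem add_mul_mem_uIoo {p L s : ℝ} (hL : L ≠ 0) :
    p + L * s ∈ uIoo p (p + L) ↔ s ∈ Ioo (0 : ℝ) 1 := by
  simp only [uIoo, mem_Ioo, inf_lt_iff, lt_sup_iff]
  rcases lt_or_gt_of_ne hL with h | h
  · constructor
    · rintro ⟨h1 | h1, h2 | h2⟩ <;> constructor <;> nlinarith
    · rintro ⟨h1, h2⟩; exact ⟨Or.inr (by nlinarith), Or.inl (by nlinarith)⟩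
  · constructor
    · rintro ⟨h1 | h1, h2 | h2⟩ <;> constructor <;> nlinarith
    · rintro ⟨h1, h2⟩; exact ⟨Or.inl (by nlinarith), Or.inr (by nlinarith)⟩

theorem lintegral_affine {p L : ℝ} (hL : L ≠ 0) (f : ℝ → ℝ≥0∞) :
    ∫⁻ s in Ioo (0 : ℝ) 1, f (p + L * s) =
      ENNReal.ofReal |L⁻¹| * ∫⁻ s in uIoo p (p + L), f s := by
  have hmap : Measure.map (fun s => p + L * s) volume =
      ENNReal.ofReal |L⁻¹| • (volume : Measure ℝ) := by
    have : (fun s => p + L * s) = (fun s => p + s) ∘ fun s => L * s := rfl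
    rw [this, ← Measure.map_map (measurable_const_add p) (measurable_const_mul L),
      Real.map_volume_mul_left hL, Measure.map_smul, map_add_left_eq_self]
  have hemb : MeasurableEmbedding fun s : ℝ => p + L * s :=
    (measurableEmbedding_addLeft p).comp (measurableEmbedding_mulLeft₀ hL)
  have hm : MeasurableSet (uIoo p (p + L)) := measurableSet_Ioo
  rw [← smul_eq_mul, ← lintegral_indicator hm, ← lintegral_smul_measure, ← hmap,
    hemb.lintegral_map, ← lintegral_indicator measurableSet_Ioo]
  refine lintegral_congr fun s => ?_
  simp only [indicator, add_mul_mem_uIoo hL]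

/-- The open rectangle spanned by a corner `(p, q)` and signed side lengths `L`, `M`. -/
def rect (p q L M : ℝ) : Set Plane := {x | x 0 ∈ uIoo p (p + L) ∧ x 1 ∈ uIoo q (q + M)}

theorem measurableSet_coord {A A' : Set ℝ} (hA : MeasurableSet A) (hA' : MeasurableSet A') :
    MeasurableSet {x : Plane | x 0 ∈ A ∧ x 1 ∈ A'} := by
  have h0 : Measurable fun y : Plane => y 0 := by fun_prop
  have h1 : Measurable fun y : Plane => y 1 := by fun_prop
  exact (h0 hA).inter (h1 hA')

theorem measurableSet_rect (p q L M : ℝ) : MeasurableSet (rect p q L M) :=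
  measurableSet_coord measurableSet_Ioo measurableSet_Ioo

theorem continuous_point : Continuous fun p : ℝ × ℝ => (!₂[p.1, p.2] : Plane) := by
  refine (PiLp.continuous_toLp 2 _).comp (continuous_pi fun i => ?_)
  fin_cases i
  · exact continuous_fst
  · exact continuous_snd

theorem lintegral_coord {A A' : Set ℝ} (hA : MeasurableSet A) (hA' : MeasurableSet A')
    {f : Plane → ℝ≥0∞} (hf : Measurable f) :
    ∫⁻ x in {x : Plane | x 0 ∈ A ∧ x 1 ∈ A'}, f x = ∫⁻ s in A, ∫⁻ t in A', f !₂[s, t] := by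
  have hmp : MeasurePreserving (fun p : ℝ × ℝ => (!₂[p.1, p.2] : Plane)) volume volume :=
    (PiLp.volume_preserving_toLp (Fin 2)).comp (volume_preserving_finTwoArrow ℝ).symm
  rw [← lintegral_indicator (measurableSet_coord hA hA'),
    ← hmp.lintegral_comp (hf.indicator (measurableSet_coord hA hA')),
    ← setLIntegral_prod (μ := volume) (ν := volume) (fun p : ℝ × ℝ => f !₂[p.1, p.2])
      (hf.comp continuous_point.measurable).aemeasurable,
    ← lintegral_indicator (hA.prod hA')]
  rfl

theorem lintegral_rect {p q L M : ℝ} (hL : L ≠ 0) (hM : M ≠ 0) {f : Plane → ℝ≥0∞}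
    (hf : Measurable f) :
    ∫⁻ s in Ioo (0 : ℝ) 1, ∫⁻ t in Ioo (0 : ℝ) 1, f !₂[p + L * s, q + M * t] =
      ENNReal.ofReal |L⁻¹| * ENNReal.ofReal |M⁻¹| * ∫⁻ x in rect p q L M, f x := by
  rw [rect, lintegral_coord (A := uIoo p (p + L)) (A' := uIoo q (q + M)) measurableSet_Ioo
      measurableSet_Ioo hf, mul_assoc,
    ← lintegral_const_mul' _ _ ENNReal.ofReal_ne_top,
    ← lintegral_affine hL fun x => ENNReal.ofReal |M⁻¹| * ∫⁻ t in uIoo q (q + M), f !₂[x, t]]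
  refine lintegral_congr fun s => ?_
  exact lintegral_affine hM fun y => f !₂[p + L * s, y]

theorem enorm_sub_le_of_hasDerivAt {f f' : ℝ → ℂ} (h : ContDiff ℝ 1 f)
    (h' : ∀ x, HasDerivAt f (f' x) x) {x y : ℝ} (hxy : x ≤ y) {D : ℝ → ℝ≥0∞}
    (hD : ∀ x, ‖f' x‖ₑ ≤ D x) : ‖f x - f y‖ₑ ≤ ∫⁻ τ in Ioo x y, D τ := by
  rw [enorm_sub_rev, restrict_Ioo_eq_restrict_Icc]
  refine (enorm_sub_le_lintegral_deriv_of_contDiffOn_Icc h.contDiffOn hxy).trans ?_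
  exact lintegral_mono fun τ => by rw [(h' τ).deriv]; exact hD τ

theorem hasDerivAt_point_fst (p L y s : ℝ) :
    HasDerivAt (fun s => (!₂[p + L * s, y] : Plane)) (L • EuclideanSpace.single 0 1) s := by
  have h : (fun s => (!₂[p + L * s, y] : Plane)) =
      fun s => s • (L • EuclideanSpace.single 0 1 : Plane) + !₂[p, y] := by
    funext s
    ext i
    fin_cases i <;> simp [mul_comm, add_comm]
  rw [h]
  simpa using ((hasDerivAt_id s).smul_const (L • EuclideanSpace.single 0 1 : Plane)).add_const
    (!₂[p, y] : Plane)

theorem hasDerivAt_point_snd (x q M t : ℝ) :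
    HasDerivAt (fun t => (!₂[x, q + M * t] : Plane)) (M • EuclideanSpace.single 1 1) t := by
  have h : (fun t => (!₂[x, q + M * t] : Plane)) =
      fun t => t • (M • EuclideanSpace.single 1 1 : Plane) + !₂[x, q] := by
    funext t
    ext i
    fin_cases i <;> simp [mul_comm, add_comm]
  rw [h]
  simpa using ((hasDerivAt_id t).smul_const (M • EuclideanSpace.single 1 1 : Plane)).add_const
    (!₂[x, q] : Plane)

/-- The pull-back of the gradient of `Φ` to the unit square is an upper gradient. -/
theorem isUpperGradient_rect {Φ : Plane → ℂ} (hΦ : ContDiff ℝ ∞ Φ) (p q : ℝ) {L M : ℝ} {K : ℝ}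
    (hL : |L| ≤ K) (hM : |M| ≤ K) :
    IsUpperGradient (fun s t => Φ !₂[p + L * s, q + M * t])
      (fun s t => ENNReal.ofReal K * ‖fderiv ℝ Φ !₂[p + L * s, q + M * t]‖ₑ) := by
  have hc : Continuous fun z : ℝ × ℝ => (!₂[p + L * z.1, q + M * z.2] : Plane) :=
    continuous_point.comp (by fun_prop : Continuous fun z : ℝ × ℝ => (p + L * z.1, q + M * z.2))
  have hfd : Continuous (fderiv ℝ Φ) := hΦ.continuous_fderiv (by simp)
  have hK : ∀ {N : ℝ}, |N| ≤ K → ∀ (i : Fin 2) (x : Plane),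
      ‖fderiv ℝ Φ x (N • EuclideanSpace.single i 1)‖ₑ ≤ ENNReal.ofReal K * ‖fderiv ℝ Φ x‖ₑ := by
    intro N hN i x
    rw [← ofReal_norm, ← ofReal_norm, ← ENNReal.ofReal_mul ((abs_nonneg _).trans hN)]
    refine ENNReal.ofReal_le_ofReal ((ContinuousLinearMap.le_opNorm _ _).trans ?_)
    rw [norm_smul, PiLp.norm_single, norm_one, mul_one, Real.norm_eq_abs, mul_comm]
    gcongr
  have hd : ∀ x, HasFDerivAt Φ (fderiv ℝ Φ x) x := fun x =>
    (hΦ.differentiable (by simp) x).hasFDerivAt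
  refine ⟨(hΦ.continuous.comp hc).measurable, ?_, fun s s' t hs => ?_, fun s t t' ht => ?_⟩
  · exact ((hfd.comp hc).measurable.enorm).const_mul _
  · refine enorm_sub_le_of_hasDerivAt (f := fun s => Φ !₂[p + L * s, q + M * t]) ?_
      (fun x => (hd _).comp_hasDerivAt x (hasDerivAt_point_fst p L (q + M * t) x)) hs
      (fun x => hK hL 0 _)
    refine (hΦ.of_le (by exact_mod_cast le_top)).comp (contDiff_euclidean.mpr fun i => ?_)
    fin_cases i <;> simp <;> fun_prop
  · refine enorm_sub_le_of_hasDerivAt (f := fun t => Φ !₂[p + L * s, q + M * t]) ?_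
      (fun x => (hd _).comp_hasDerivAt x (hasDerivAt_point_snd (p + L * s) q M x)) ht
      (fun x => hK hM 1 _)
    refine (hΦ.of_le (by exact_mod_cast le_top)).comp (contDiff_euclidean.mpr fun i => ?_)
    fin_cases i <;> simp <;> fun_prop

theorem energy_rect {Φ : Plane → ℂ} (hΦ : ContDiff ℝ ∞ Φ) (p q : ℝ) {L M : ℝ} (hL : L ≠ 0)
    (hM : M ≠ 0) (K : ℝ) :
    energy (fun s t => ENNReal.ofReal K * ‖fderiv ℝ Φ !₂[p + L * s, q + M * t]‖ₑ) =
      ENNReal.ofReal K ^ 2 * (ENNReal.ofReal |L⁻¹| * ENNReal.ofReal |M⁻¹| *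
        ∫⁻ x in rect p q L M, ‖fderiv ℝ Φ x‖ₑ ^ 2) := by
  have hfd : Continuous (fderiv ℝ Φ) := hΦ.continuous_fderiv (by simp)
  rw [← lintegral_rect hL hM (hfd.measurable.enorm.pow_const 2), energy]
  simp only [mul_pow]
  rw [← lintegral_const_mul' _ _ (by simp)]
  refine lintegral_congr fun s => ?_
  rw [lintegral_const_mul' _ _ (by simp)]

/-- The square of the `H¹(U)` norm of a smooth function. -/
def sobolev (U : Set Plane) (Φ : Plane → ℂ) : ℝ≥0∞ :=
  (∫⁻ x in U, ‖Φ x‖ₑ ^ 2) + ∫⁻ x in U, ‖fderiv ℝ Φ x‖ₑ ^ 2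

theorem sobolev_mono {U U' : Set Plane} (h : U ⊆ U') (Φ : Plane → ℂ) :
    sobolev U Φ ≤ sobolev U' Φ :=
  add_le_add (lintegral_mono_set h) (lintegral_mono_set h)

/-! ### Arc length on horizontal and vertical segments -/

/-- Arc length on the horizontal segment from `(p, q)` to `(p + L, q)`. -/
def hEdge (p q L : ℝ) : Measure Plane :=
  ENNReal.ofReal |L| • Measure.map (fun s => !₂[p + L * s, q]) (volume.restrict (Ioo (0 : ℝ) 1))

/-- Arc length on the vertical segment from `(p, q)` to `(p, q + M)`. -/
def vEdge (p q M : ℝ) : Measure Plane :=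
  ENNReal.ofReal |M| • Measure.map (fun t => !₂[p, q + M * t]) (volume.restrict (Ioo (0 : ℝ) 1))

instance (p q L : ℝ) : IsFiniteMeasure (hEdge p q L) := by
  unfold hEdge
  exact Measure.smul_finite _ ENNReal.ofReal_ne_top

instance (p q M : ℝ) : IsFiniteMeasure (vEdge p q M) := by
  unfold vEdge
  exact Measure.smul_finite _ ENNReal.ofReal_ne_top

theorem measurable_hpoint (p q L : ℝ) : Measurable fun s : ℝ => (!₂[p + L * s, q] : Plane) :=
  (continuous_point.comp (by fun_prop : Continuous fun s : ℝ => (p + L * s, q))).measurable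

theorem measurable_vpoint (p q M : ℝ) : Measurable fun t : ℝ => (!₂[p, q + M * t] : Plane) :=
  (continuous_point.comp (by fun_prop : Continuous fun t : ℝ => (p, q + M * t))).measurable

theorem lintegral_hEdge (p q L : ℝ) {f : Plane → ℝ≥0∞} (hf : Measurable f) :
    ∫⁻ x, f x ∂(hEdge p q L) =
      ENNReal.ofReal |L| * ∫⁻ s in Ioo (0 : ℝ) 1, f !₂[p + L * s, q] := by
  rw [hEdge, lintegral_smul_measure, lintegral_map hf (measurable_hpoint p q L), smul_eq_mul]

theorem lintegral_vEdge (p q M : ℝ) {f : Plane → ℝ≥0∞} (hf : Measurable f) :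
    ∫⁻ x, f x ∂(vEdge p q M) =
      ENNReal.ofReal |M| * ∫⁻ t in Ioo (0 : ℝ) 1, f !₂[p, q + M * t] := by
  rw [vEdge, lintegral_smul_measure, lintegral_map hf (measurable_vpoint p q M), smul_eq_mul]

theorem lintegral_affine' {p L : ℝ} (hL : L ≠ 0) (f : ℝ → ℝ≥0∞) :
    ENNReal.ofReal |L| * ∫⁻ s in Ioo (0 : ℝ) 1, f (p + L * s) = ∫⁻ s in uIoo p (p + L), f s := by
  rw [lintegral_affine hL, ← mul_assoc, ← ENNReal.ofReal_mul (abs_nonneg _), ← abs_mul,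
    mul_inv_cancel₀ hL]
  simp

/-- The line is an isometric image of ℝ, so one-dimensional Hausdorff measure on it is transported
Lebesgue measure. The endpoints, which lie in the closed segment but not in the parametrising
interval, are null. -/
theorem arc_horizontal {p q L : ℝ} (hL : L ≠ 0) {T : Set Plane}
    (hT : T ⊆ {x | x 0 ∈ uIcc p (p + L) ∧ x 1 = q}) : arc T ≤ hEdge p q L := by
  have hiso : Isometry fun s : ℝ => (!₂[s, q] : Plane) := by
    refine Isometry.of_dist_eq fun s t => ?_
    rw [EuclideanSpace.dist_eq]
    simp [Real.sqrt_sq_eq_abs, Real.dist_eq]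
  have hm := hiso.map_hausdorffMeasure (d := 1) (Or.inl zero_le_one)
  rw [Measure.le_iff]
  intro A hA
  rw [← lintegral_indicator_one hA, ← lintegral_indicator_one hA,
    lintegral_hEdge _ _ _ (measurable_one.indicator hA),
    lintegral_affine' hL fun s => A.indicator 1 (!₂[s, q] : Plane), uIoo,
    restrict_Ioo_eq_restrict_Icc]
  have hR : {x : Plane | x 0 ∈ uIcc p (p + L) ∧ x 1 = q} =
      {x : Plane | x 0 ∈ uIcc p (p + L) ∧ x 1 ∈ ({q} : Set ℝ)} ∩ range fun s : ℝ => (!₂[s, q] : Plane) := by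
    ext x
    constructor
    · rintro ⟨h1, h2⟩
      refine ⟨⟨h1, h2⟩, x 0, ?_⟩
      ext i; fin_cases i
      · simp
      · simpa using h2.symm
    · exact fun h => h.1
  calc ∫⁻ x, A.indicator 1 x ∂(arc T)
      ≤ ∫⁻ x, A.indicator 1 x ∂(arc {x : Plane | x 0 ∈ uIcc p (p + L) ∧ x 1 = q}) :=
        lintegral_mono' (arc_mono hT) le_rfl
    _ = ∫⁻ x in {x : Plane | x 0 ∈ uIcc p (p + L) ∧ x 1 ∈ ({q} : Set ℝ)},
          A.indicator 1 x ∂(Measure.map (fun s : ℝ => (!₂[s, q] : Plane)) volume) := by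
        rw [← hausdorffMeasure_real, hm, arc, hR, Measure.restrict_restrict
          (measurableSet_coord measurableSet_uIcc (measurableSet_singleton q))]
    _ = _ := by
        rw [Measure.restrict_map hiso.continuous.measurable
          (measurableSet_coord measurableSet_uIcc (measurableSet_singleton q)),
          lintegral_map (measurable_one.indicator hA) hiso.continuous.measurable]
        congr 2
        ext s
        simp [uIcc]

theorem arc_vertical {p q M : ℝ} (hM : M ≠ 0) {T : Set Plane}
    (hT : T ⊆ {x | x 0 = p ∧ x 1 ∈ uIcc q (q + M)}) : arc T ≤ vEdge p q M := by
  have hiso : Isometry fun s : ℝ => (!₂[p, s] : Plane) := by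
    refine Isometry.of_dist_eq fun s t => ?_
    rw [EuclideanSpace.dist_eq]
    simp [Real.sqrt_sq_eq_abs, Real.dist_eq]
  have hm := hiso.map_hausdorffMeasure (d := 1) (Or.inl zero_le_one)
  rw [Measure.le_iff]
  intro A hA
  rw [← lintegral_indicator_one hA, ← lintegral_indicator_one hA,
    lintegral_vEdge _ _ _ (measurable_one.indicator hA),
    lintegral_affine' hM fun s => A.indicator 1 (!₂[p, s] : Plane), uIoo,
    restrict_Ioo_eq_restrict_Icc]
  have hR : {x : Plane | x 0 = p ∧ x 1 ∈ uIcc q (q + M)} =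
      {x : Plane | x 0 ∈ ({p} : Set ℝ) ∧ x 1 ∈ uIcc q (q + M)} ∩ range fun s : ℝ => (!₂[p, s] : Plane) := by
    ext x
    constructor
    · rintro ⟨h1, h2⟩
      refine ⟨⟨h1, h2⟩, x 1, ?_⟩
      ext i; fin_cases i
      · simpa using h1.symm
      · simp
    · exact fun h => h.1
  calc ∫⁻ x, A.indicator 1 x ∂(arc T)
      ≤ ∫⁻ x, A.indicator 1 x ∂(arc {x : Plane | x 0 = p ∧ x 1 ∈ uIcc q (q + M)}) :=
        lintegral_mono' (arc_mono hT) le_rfl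
    _ = ∫⁻ x in {x : Plane | x 0 ∈ ({p} : Set ℝ) ∧ x 1 ∈ uIcc q (q + M)},
          A.indicator 1 x ∂(Measure.map (fun s : ℝ => (!₂[p, s] : Plane)) volume) := by
        rw [← hausdorffMeasure_real, hm, arc, hR, Measure.restrict_restrict
          (measurableSet_coord (measurableSet_singleton p) measurableSet_uIcc)]
    _ = _ := by
        rw [Measure.restrict_map hiso.continuous.measurable
          (measurableSet_coord (measurableSet_singleton p) measurableSet_uIcc),
          lintegral_map (measurable_one.indicator hA) hiso.continuous.measurable]
        congr 2
        ext s
        simp [uIcc]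

theorem hEdge_reverse {p q L : ℝ} (hL : L ≠ 0) : hEdge (p + L) q (-L) = hEdge p q L := by
  ext A hA
  rw [← lintegral_indicator_one hA, ← lintegral_indicator_one hA,
    lintegral_hEdge _ _ _ (measurable_one.indicator hA),
    lintegral_hEdge _ _ _ (measurable_one.indicator hA),
    lintegral_affine' hL fun s => A.indicator 1 (!₂[s, q] : Plane),
    lintegral_affine' (neg_ne_zero.mpr hL) fun s => A.indicator 1 (!₂[s, q] : Plane),
    add_neg_cancel_right, uIoo_comm]

theorem vEdge_reverse {p q M : ℝ} (hM : M ≠ 0) : vEdge p (q + M) (-M) = vEdge p q M := by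
  ext A hA
  rw [← lintegral_indicator_one hA, ← lintegral_indicator_one hA,
    lintegral_vEdge _ _ _ (measurable_one.indicator hA),
    lintegral_vEdge _ _ _ (measurable_one.indicator hA),
    lintegral_affine' hM fun s => A.indicator 1 (!₂[p, s] : Plane),
    lintegral_affine' (neg_ne_zero.mpr hM) fun s => A.indicator 1 (!₂[p, s] : Plane),
    add_neg_cancel_right, uIoo_comm]

end Rect

/-! ### Trace estimates for smooth functions -/

section TraceEstimates

open Set

/-- `F` is bounded by a multiple of the square of the `H¹(U)` norm on smooth functions. -/
def SobolevBounded (U : Set Plane) (F : (Plane → ℂ) → ℝ≥0∞) : Prop :=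
  ∃ C : ℝ≥0∞, C ≠ ⊤ ∧ ∀ Φ, ContDiff ℝ ∞ Φ → F Φ ≤ C * sobolev U Φ

variable {U U' : Set Plane} {F G : (Plane → ℂ) → ℝ≥0∞}

theorem SobolevBounded.mono (h : SobolevBounded U F) (hU : U ⊆ U')
    (hF : ∀ Φ, ContDiff ℝ ∞ Φ → G Φ ≤ F Φ) : SobolevBounded U' G := by
  obtain ⟨C, hC, h⟩ := h
  exact ⟨C, hC, fun Φ hΦ => (hF Φ hΦ).trans ((h Φ hΦ).trans (by gcongr; exact sobolev_mono hU Φ))⟩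

theorem SobolevBounded.add (h : SobolevBounded U F) (h' : SobolevBounded U G) :
    SobolevBounded U fun Φ => F Φ + G Φ := by
  obtain ⟨C, hC, h⟩ := h
  obtain ⟨C', hC', h'⟩ := h'
  exact ⟨C + C', ENNReal.add_ne_top.mpr ⟨hC, hC'⟩, fun Φ hΦ =>
    (add_le_add (h Φ hΦ) (h' Φ hΦ)).trans_eq (add_mul _ _ _).symm⟩

theorem SobolevBounded.const_mul (h : SobolevBounded U F) {c : ℝ≥0∞} (hc : c ≠ ⊤) :
    SobolevBounded U fun Φ => c * F Φ := by
  obtain ⟨C, hC, h⟩ := h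
  exact ⟨c * C, ENNReal.mul_ne_top hc hC, fun Φ hΦ => by
    rw [mul_assoc]; exact mul_le_mul' le_rfl (h Φ hΦ)⟩

theorem SobolevBounded.sum {ι : Type*} (s : Finset ι) {F : ι → (Plane → ℂ) → ℝ≥0∞}
    (h : ∀ i, SobolevBounded U (F i)) : SobolevBounded U fun Φ => ∑ i ∈ s, F i Φ := by
  classical
  induction s using Finset.induction_on with
  | empty => exact ⟨0, ENNReal.zero_ne_top, fun Φ _ => by simp⟩
  | insert i s hi ih =>
    refine ((h i).add ih).mono subset_rfl fun Φ _ => ?_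
    rw [Finset.sum_insert hi]

theorem sobolevBounded_energy (p q : ℝ) {L M : ℝ} (hL : L ≠ 0) (hM : M ≠ 0) (K : ℝ) :
    SobolevBounded (rect p q L M) fun Φ =>
      energy fun s t => ENNReal.ofReal K * ‖fderiv ℝ Φ !₂[p + L * s, q + M * t]‖ₑ := by
  refine ⟨ENNReal.ofReal K ^ 2 * (ENNReal.ofReal |L⁻¹| * ENNReal.ofReal |M⁻¹|), by finiteness,
    fun Φ hΦ => ?_⟩
  beta_reduce
  rw [energy_rect hΦ p q hL hM, ← mul_assoc]
  exact mul_le_mul' le_rfl le_add_self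

theorem sobolevBounded_lintegral (p q : ℝ) {L M : ℝ} (hL : L ≠ 0) (hM : M ≠ 0) :
    SobolevBounded (rect p q L M) fun Φ =>
      ∫⁻ s in Ioo (0 : ℝ) 1, ∫⁻ t in Ioo (0 : ℝ) 1, ‖Φ !₂[p + L * s, q + M * t]‖ₑ ^ 2 := by
  refine ⟨ENNReal.ofReal |L⁻¹| * ENNReal.ofReal |M⁻¹|, by finiteness, fun Φ hΦ => ?_⟩
  beta_reduce
  rw [lintegral_rect (f := fun x => ‖Φ x‖ₑ ^ 2) hL hM (hΦ.continuous.measurable.enorm.pow_const 2)]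
  gcongr
  exact le_self_add

/-- The height M of the rectangle is independent of the edge and may have either sign: this permits
both the upper side of a box and a thin collar that misses the scatterer. -/
theorem sobolevBounded_hEdge (p q : ℝ) {L M : ℝ} (hL : L ≠ 0) (hM : M ≠ 0) :
    SobolevBounded (rect p q L M) fun Φ => ∫⁻ x, ‖Φ x‖ₑ ^ 2 ∂(hEdge p q L) := by
  refine ((((sobolevBounded_lintegral p q hL hM).const_mul (c := 2) (by norm_num)).add
    ((sobolevBounded_energy p q hL hM (max |L| |M|)).const_mul (c := 2) (by norm_num))).const_mul
    (c := ENNReal.ofReal |L|) ENNReal.ofReal_ne_top).mono subset_rfl fun Φ hΦ => ?_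
  rw [lintegral_hEdge (f := fun x => ‖Φ x‖ₑ ^ 2) _ _ _
    (hΦ.continuous.measurable.enorm.pow_const 2)]
  have := lintegral_sq_norm_edge_le
    (isUpperGradient_rect hΦ p q (le_max_left |L| |M|) (le_max_right |L| |M|))
  simp only [mul_zero, add_zero] at this
  gcongr

theorem sobolevBounded_vEdge (p q : ℝ) {L M : ℝ} (hL : L ≠ 0) (hM : M ≠ 0) :
    SobolevBounded (rect p q L M) fun Φ => ∫⁻ x, ‖Φ x‖ₑ ^ 2 ∂(vEdge p q M) := by
  refine ((((sobolevBounded_lintegral p q hL hM).const_mul (c := 2) (by norm_num)).add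
    ((sobolevBounded_energy p q hL hM (max |L| |M|)).const_mul (c := 2) (by norm_num))).const_mul
    (c := ENNReal.ofReal |M|) ENNReal.ofReal_ne_top).mono subset_rfl fun Φ hΦ => ?_
  rw [lintegral_vEdge (f := fun x => ‖Φ x‖ₑ ^ 2) _ _ _
    (hΦ.continuous.measurable.enorm.pow_const 2)]
  have hug := isUpperGradient_rect hΦ p q (le_max_left |L| |M|) (le_max_right |L| |M|)
  have h1 := lintegral_sq_norm_edge_le hug.swap
  rw [energy_swap hug.measurable, lintegral_lintegral_swap (f := fun s t =>
    ‖Φ !₂[p + L * t, q + M * s]‖ₑ ^ 2)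
    ((hug.measurable_fun.comp measurable_swap).enorm.pow_const 2).aemeasurable] at h1
  simp only [mul_zero, add_zero] at h1
  gcongr

/-- The integrand of the `H^{1/2}` seminorm. -/
def kern (Φ : Plane → ℂ) (x y : Plane) : ℝ≥0∞ :=
  ‖Φ x - Φ y‖ₑ ^ 2 * (ENNReal.ofReal (dist x y))⁻¹ ^ 2

theorem kern_comm (Φ : Plane → ℂ) (x y : Plane) : kern Φ x y = kern Φ y x := by
  rw [kern, kern, enorm_sub_rev, dist_comm]

theorem measurable_kern {Φ : Plane → ℂ} (hΦ : Continuous Φ) :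
    Measurable (Function.uncurry (kern Φ)) := by
  have h1 : Measurable fun z : Plane × Plane => Φ z.1 - Φ z.2 :=
    ((hΦ.comp continuous_fst).sub (hΦ.comp continuous_snd)).measurable
  have h2 : Measurable fun z : Plane × Plane => dist z.1 z.2 := continuous_dist.measurable
  exact (h1.enorm.pow_const 2).mul (h2.ennreal_ofReal.inv.pow_const 2)

theorem measurable_kern_right {Φ : Plane → ℂ} (hΦ : Continuous Φ) (x : Plane) :
    Measurable (kern Φ x) := (measurable_kern hΦ).of_uncurry_left

theorem measurable_lintegral_kern {Φ : Plane → ℂ} (hΦ : Continuous Φ) (ν : Measure Plane)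
    [SFinite ν] : Measurable fun x => ∫⁻ y, kern Φ x y ∂ν :=
  (measurable_kern hΦ).lintegral_prod_right'

theorem ENNReal_ofReal_inv_sq_mul {a : ℝ} (ha : 0 < a) (b : ℝ) :
    (ENNReal.ofReal (a * b))⁻¹ ^ 2 = (ENNReal.ofReal a)⁻¹ ^ 2 * (ENNReal.ofReal b)⁻¹ ^ 2 := by
  rw [ENNReal.ofReal_mul ha.le, ENNReal.mul_inv (Or.inl (by simpa using ha))
    (Or.inl ENNReal.ofReal_ne_top), mul_pow]

theorem ENNReal_ofReal_inv_sq_ne_top {a : ℝ} (ha : 0 < a) : (ENNReal.ofReal a)⁻¹ ^ 2 ≠ ⊤ :=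
  ENNReal.pow_ne_top (ENNReal.inv_ne_top.mpr (by simpa using ha))

theorem sobolevBounded_kern_hEdge (p q : ℝ) {L M : ℝ} (hL : L ≠ 0) (hM : M ≠ 0) :
    SobolevBounded (rect p q L M) fun Φ =>
      ∫⁻ x, ∫⁻ y, kern Φ x y ∂(hEdge p q L) ∂(hEdge p q L) := by
  have hL' : 0 < |L| := abs_pos.mpr hL
  refine (((sobolevBounded_energy p q hL hM (max |L| |M|)).const_mul (c := 56)
    (by norm_num)).const_mul
    (c := ENNReal.ofReal |L| * (ENNReal.ofReal |L| * (ENNReal.ofReal |L|)⁻¹ ^ 2))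
    (ENNReal.mul_ne_top ENNReal.ofReal_ne_top (ENNReal.mul_ne_top ENNReal.ofReal_ne_top
      (ENNReal_ofReal_inv_sq_ne_top hL')))).mono subset_rfl fun Φ hΦ => ?_
  rw [lintegral_hEdge _ _ _ (measurable_lintegral_kern hΦ.continuous _)]
  have h1 := lintegral_same_edge_le
    (isUpperGradient_rect hΦ p q (le_max_left |L| |M|) (le_max_right |L| |M|))
  simp only [mul_zero, add_zero] at h1
  rw [mul_assoc, mul_assoc]
  gcongr
  refine le_trans ?_ (by gcongr : _ * (_ * (∫⁻ s in Ioo (0 : ℝ) 1, ∫⁻ t in Ioo (0 : ℝ) 1,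
    ‖Φ !₂[p + L * s, q] - Φ !₂[p + L * t, q]‖ₑ ^ 2 * (ENNReal.ofReal |s - t|)⁻¹ ^ 2)) ≤ _)
  rw [← lintegral_const_mul' _ _ (ENNReal_ofReal_inv_sq_ne_top hL'),
    ← lintegral_const_mul' _ _ ENNReal.ofReal_ne_top]
  refine lintegral_mono fun s => ?_
  rw [lintegral_hEdge _ _ _ (measurable_kern_right hΦ.continuous _),
    ← lintegral_const_mul' _ _ (ENNReal_ofReal_inv_sq_ne_top hL')]
  gcongr with t
  have hd : dist (!₂[p + L * s, q] : Plane) !₂[p + L * t, q] = |L| * |s - t| := by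
    rw [EuclideanSpace.dist_eq, ← abs_mul, mul_sub]
    simp [Real.sqrt_sq_eq_abs, Real.dist_eq]
  rw [kern, hd, ENNReal_ofReal_inv_sq_mul hL', mul_left_comm]

theorem sobolevBounded_kern_vEdge (p q : ℝ) {L M : ℝ} (hL : L ≠ 0) (hM : M ≠ 0) :
    SobolevBounded (rect p q L M) fun Φ =>
      ∫⁻ x, ∫⁻ y, kern Φ x y ∂(vEdge p q M) ∂(vEdge p q M) := by
  have hM' : 0 < |M| := abs_pos.mpr hM
  refine (((sobolevBounded_energy p q hL hM (max |L| |M|)).const_mul (c := 56)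
    (by norm_num)).const_mul
    (c := ENNReal.ofReal |M| * (ENNReal.ofReal |M| * (ENNReal.ofReal |M|)⁻¹ ^ 2))
    (ENNReal.mul_ne_top ENNReal.ofReal_ne_top (ENNReal.mul_ne_top ENNReal.ofReal_ne_top
      (ENNReal_ofReal_inv_sq_ne_top hM')))).mono subset_rfl fun Φ hΦ => ?_
  rw [lintegral_vEdge _ _ _ (measurable_lintegral_kern hΦ.continuous _)]
  have hug := isUpperGradient_rect hΦ p q (le_max_left |L| |M|) (le_max_right |L| |M|)
  have h1 := lintegral_same_edge_le hug.swap
  rw [energy_swap hug.measurable] at h1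
  simp only [mul_zero, add_zero] at h1
  rw [mul_assoc, mul_assoc]
  gcongr
  refine le_trans ?_ (by gcongr : _ * (_ * (∫⁻ s in Ioo (0 : ℝ) 1, ∫⁻ t in Ioo (0 : ℝ) 1,
    ‖Φ !₂[p, q + M * s] - Φ !₂[p, q + M * t]‖ₑ ^ 2 * (ENNReal.ofReal |s - t|)⁻¹ ^ 2)) ≤ _)
  rw [← lintegral_const_mul' _ _ (ENNReal_ofReal_inv_sq_ne_top hM'),
    ← lintegral_const_mul' _ _ ENNReal.ofReal_ne_top]
  refine lintegral_mono fun s => ?_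
  rw [lintegral_vEdge _ _ _ (measurable_kern_right hΦ.continuous _),
    ← lintegral_const_mul' _ _ (ENNReal_ofReal_inv_sq_ne_top hM')]
  gcongr with t
  have hd : dist (!₂[p, q + M * s] : Plane) !₂[p, q + M * t] = |M| * |s - t| := by
    rw [EuclideanSpace.dist_eq, ← abs_mul, mul_sub]
    simp [Real.sqrt_sq_eq_abs, Real.dist_eq]
  rw [kern, hd, ENNReal_ofReal_inv_sq_mul hM', mul_left_comm]

theorem sobolevBounded_kern_corner (p q : ℝ) {L M : ℝ} (hL : L ≠ 0) (hM : M ≠ 0) :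
    SobolevBounded (rect p q L M) fun Φ =>
      ∫⁻ x, ∫⁻ y, kern Φ x y ∂(vEdge p q M) ∂(hEdge p q L) := by
  set m := min |L| |M| with hm
  have hm0 : 0 < m := lt_min (abs_pos.mpr hL) (abs_pos.mpr hM)
  refine (((sobolevBounded_energy p q hL hM (max |L| |M|)).const_mul (c := 16)
    (by norm_num)).const_mul
    (c := ENNReal.ofReal |L| * (ENNReal.ofReal |M| * (ENNReal.ofReal m)⁻¹ ^ 2))
    (ENNReal.mul_ne_top ENNReal.ofReal_ne_top (ENNReal.mul_ne_top ENNReal.ofReal_ne_top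
      (ENNReal_ofReal_inv_sq_ne_top hm0)))).mono subset_rfl fun Φ hΦ => ?_
  rw [lintegral_hEdge _ _ _ (measurable_lintegral_kern hΦ.continuous _)]
  -- Points on the two legs are at distance at least m·s and at least m·t, which is what the minimum
  -- of the two weights encodes.
  have h1 := lintegral_corner_le
    (isUpperGradient_rect hΦ p q (le_max_left |L| |M|) (le_max_right |L| |M|))
    (W := fun s t => min ((ENNReal.ofReal s)⁻¹ ^ 2) ((ENNReal.ofReal t)⁻¹ ^ 2))
    (fun s t => min_le_left _ _) (fun s t => min_le_right _ _)
  simp only [mul_zero, add_zero] at h1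
  rw [mul_assoc, mul_assoc]
  gcongr
  refine le_trans ?_ (by gcongr : _ * (_ * (∫⁻ s in Ioo (0 : ℝ) 1, ∫⁻ t in Ioo (0 : ℝ) 1,
    ‖Φ !₂[p + L * s, q] - Φ !₂[p, q + M * t]‖ₑ ^ 2 *
      min ((ENNReal.ofReal s)⁻¹ ^ 2) ((ENNReal.ofReal t)⁻¹ ^ 2))) ≤ _)
  rw [← lintegral_const_mul' _ _ (ENNReal_ofReal_inv_sq_ne_top hm0),
    ← lintegral_const_mul' _ _ ENNReal.ofReal_ne_top]
  refine setLIntegral_mono' measurableSet_Ioo fun s hs => ?_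
  rw [lintegral_vEdge _ _ _ (measurable_kern_right hΦ.continuous _),
    ← lintegral_const_mul' _ _ (ENNReal_ofReal_inv_sq_ne_top hm0)]
  refine mul_le_mul' le_rfl (setLIntegral_mono' measurableSet_Ioo fun t ht => ?_)
  have hd : dist (!₂[p + L * s, q] : Plane) !₂[p, q + M * t] =
      Real.sqrt ((|L| * s) ^ 2 + (|M| * t) ^ 2) := by
    rw [EuclideanSpace.dist_eq]
    simp [Real.dist_eq, mul_pow]
  have hd1 : m * s ≤ dist (!₂[p + L * s, q] : Plane) !₂[p, q + M * t] := by
    rw [hd]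
    refine (mul_le_mul_of_nonneg_right (min_le_left _ _) hs.1.le).trans ?_
    exact Real.le_sqrt_of_sq_le (le_add_of_nonneg_right (sq_nonneg _))
  have hd2 : m * t ≤ dist (!₂[p + L * s, q] : Plane) !₂[p, q + M * t] := by
    rw [hd]
    refine (mul_le_mul_of_nonneg_right (min_le_right _ _) ht.1.le).trans ?_
    exact Real.le_sqrt_of_sq_le (le_add_of_nonneg_left (sq_nonneg _))
  rw [kern, mul_left_comm]
  gcongr
  rcases min_choice ((ENNReal.ofReal s)⁻¹ ^ 2) ((ENNReal.ofReal t)⁻¹ ^ 2) with h | h <;>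
    rw [h, ← ENNReal_ofReal_inv_sq_mul hm0] <;> gcongr

theorem kern_le_of_le_dist {Φ : Plane → ℂ} {x y : Plane} {δ : ℝ} (h : δ ≤ dist x y) :
    kern Φ x y ≤ (ENNReal.ofReal δ)⁻¹ ^ 2 * (2 * ‖Φ x‖ₑ ^ 2 + 2 * ‖Φ y‖ₑ ^ 2) := by
  rw [kern, mul_comm]
  gcongr
  calc ‖Φ x - Φ y‖ₑ ^ 2 ≤ (‖Φ x‖ₑ + ‖Φ y‖ₑ) ^ 2 := by gcongr; exact enorm_sub_le
    _ ≤ _ := ENNReal_add_sq_le _ _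

/-- Between opposite sides the kernel is not singular, so the L² trace bounds suffice. -/
theorem sobolevBounded_kern_of_le_dist {μ ν : Measure Plane} [IsFiniteMeasure μ]
    [IsFiniteMeasure ν] (hμ : SobolevBounded U fun Φ => ∫⁻ x, ‖Φ x‖ₑ ^ 2 ∂μ)
    (hν : SobolevBounded U fun Φ => ∫⁻ x, ‖Φ x‖ₑ ^ 2 ∂ν) {δ : ℝ} (hδ : 0 < δ)
    (h : ∀ᵐ x ∂μ, ∀ᵐ y ∂ν, δ ≤ dist x y) :
    SobolevBounded U fun Φ => ∫⁻ x, ∫⁻ y, kern Φ x y ∂ν ∂μ := by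
  refine (((hμ.const_mul (measure_ne_top ν univ)).add
    (hν.const_mul (measure_ne_top μ univ))).const_mul (c := (ENNReal.ofReal δ)⁻¹ ^ 2 * 2)
    (ENNReal.mul_ne_top (ENNReal_ofReal_inv_sq_ne_top hδ) (by norm_num))).mono subset_rfl
    fun Φ hΦ => ?_
  have hm : Measurable fun x => ‖Φ x‖ₑ ^ 2 := hΦ.continuous.measurable.enorm.pow_const 2
  calc ∫⁻ x, ∫⁻ y, kern Φ x y ∂ν ∂μ
      ≤ ∫⁻ x, ∫⁻ y, (ENNReal.ofReal δ)⁻¹ ^ 2 * (2 * ‖Φ x‖ₑ ^ 2 + 2 * ‖Φ y‖ₑ ^ 2) ∂ν ∂μ := by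
        refine lintegral_mono_ae ?_
        filter_upwards [h] with x hx
        refine lintegral_mono_ae ?_
        filter_upwards [hx] with y hy
        exact kern_le_of_le_dist hy
    _ = (ENNReal.ofReal δ)⁻¹ ^ 2 * 2 * (ν univ * ∫⁻ x, ‖Φ x‖ₑ ^ 2 ∂μ +
          μ univ * ∫⁻ x, ‖Φ x‖ₑ ^ 2 ∂ν) := by
        simp only [← mul_add, ← mul_assoc]
        simp only [lintegral_const_mul' _ _ (ENNReal.mul_ne_top (ENNReal_ofReal_inv_sq_ne_top hδ)
          ENNReal.ofNat_ne_top)]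
        congr 1
        simp only [lintegral_add_left measurable_const, lintegral_const]
        rw [lintegral_add_right _ measurable_const, lintegral_mul_const _ hm, lintegral_const,
          mul_comm (ν univ), mul_comm (μ univ)]

theorem ae_hEdge (p q L : ℝ) : ∀ᵐ x ∂(hEdge p q L), x 1 = q := by
  have h1 : Measurable fun y : Plane => y 1 := by fun_prop
  refine Measure.ae_smul_measure ?_ _
  exact (ae_map_iff (p := fun x : Plane => x 1 = q) (measurable_hpoint p q L).aemeasurable
    (h1 (measurableSet_singleton q))).mpr (.of_forall fun s => by simp)

theorem ae_vEdge (p q M : ℝ) : ∀ᵐ x ∂(vEdge p q M), x 0 = p := by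
  have h1 : Measurable fun y : Plane => y 0 := by fun_prop
  refine Measure.ae_smul_measure ?_ _
  exact (ae_map_iff (p := fun x : Plane => x 0 = p) (measurable_vpoint p q M).aemeasurable
    (h1 (measurableSet_singleton p))).mpr (.of_forall fun s => by simp)

theorem abs_coord_sub_le_dist (x y : Plane) (i : Fin 2) : |x i - y i| ≤ dist x y := by
  rw [dist_eq_norm]
  exact PiLp.norm_apply_le (x - y) i

theorem SobolevBounded.kern_swap {μ ν : Measure Plane} [SFinite μ] [SFinite ν]
    (h : SobolevBounded U fun Φ => ∫⁻ x, ∫⁻ y, kern Φ x y ∂ν ∂μ) :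
    SobolevBounded U fun Φ => ∫⁻ x, ∫⁻ y, kern Φ x y ∂μ ∂ν := by
  refine h.mono subset_rfl fun Φ hΦ => ?_
  rw [lintegral_lintegral_swap (measurable_kern hΦ.continuous).aemeasurable]
  exact (lintegral_congr fun x => lintegral_congr fun y => kern_comm Φ _ _).le

/-! ### The boundary of a box -/

variable {a b c d : ℝ}

/-- Arc length on the four sides of a box. -/
def sides (a b c d : ℝ) : Fin 4 → Measure Plane :=
  ![hEdge a c (b - a), hEdge a d (b - a), vEdge a c (d - c), vEdge b c (d - c)]

instance (i : Fin 4) : IsFiniteMeasure (sides a b c d i) := by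
  fin_cases i
  · exact inferInstanceAs (IsFiniteMeasure (hEdge a c (b - a)))
  · exact inferInstanceAs (IsFiniteMeasure (hEdge a d (b - a)))
  · exact inferInstanceAs (IsFiniteMeasure (vEdge a c (d - c)))
  · exact inferInstanceAs (IsFiniteMeasure (vEdge b c (d - c)))

theorem isOpen_box (a b c d : ℝ) : IsOpen (box a b c d) := by
  have h0 : Continuous fun y : Plane => y 0 := by fun_prop
  have h1 : Continuous fun y : Plane => y 1 := by fun_prop
  exact ((isOpen_lt continuous_const h0).inter (isOpen_lt h0 continuous_const)).inter
      ((isOpen_lt continuous_const h1).inter (isOpen_lt h1 continuous_const))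

/-- Only an upper bound is needed, since all later integrands are non-negative; how the sides meet
at the corners is then irrelevant. -/
theorem arc_frontier_le (hab : a < b) (hcd : c < d) :
    arc (frontier (box a b c d)) ≤ ∑ i, sides a b c d i := by
  have hL : b - a ≠ 0 := (sub_pos.mpr hab).ne'
  have hM : d - c ≠ 0 := (sub_pos.mpr hcd).ne'
  have hv : ∀ p, ∀ x ∈ segment ℝ (!₂[p, c] : Plane) !₂[p, d],
      x 0 = p ∧ x 1 ∈ uIcc c (c + (d - c)) := by
    rintro p x ⟨s, t, hs, ht, hst, rfl⟩
    rw [add_sub_cancel, uIcc_of_le hcd.le]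
    refine ⟨by simp [← add_mul, hst], ?_⟩
    simp only [PiLp.add_apply, PiLp.smul_apply, smul_eq_mul, mem_Icc]
    simp only [Matrix.cons_val_one, Matrix.cons_val_fin_one]
    obtain rfl : s = 1 - t := by linarith
    constructor <;> nlinarith [mul_nonneg ht (sub_nonneg.mpr hcd.le),
      mul_nonneg hs (sub_nonneg.mpr hcd.le)]
  have hh : ∀ q, ∀ x ∈ segment ℝ (!₂[a, q] : Plane) !₂[b, q],
      x 0 ∈ uIcc a (a + (b - a)) ∧ x 1 = q := by
    rintro q x ⟨s, t, hs, ht, hst, rfl⟩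
    rw [add_sub_cancel, uIcc_of_le hab.le]
    refine ⟨?_, by simp [← add_mul, hst]⟩
    simp only [PiLp.add_apply, PiLp.smul_apply, smul_eq_mul, mem_Icc]
    simp only [Matrix.cons_val_zero]
    obtain rfl : s = 1 - t := by linarith
    constructor <;> nlinarith [mul_nonneg ht (sub_nonneg.mpr hab.le),
      mul_nonneg hs (sub_nonneg.mpr hab.le)]
  calc arc (frontier (box a b c d))
      ≤ (arc (segment ℝ (!₂[a, c] : Plane) !₂[a, d]) + arc (segment ℝ (!₂[b, c] : Plane) !₂[b, d])) +
        (arc (segment ℝ (!₂[a, c] : Plane) !₂[b, c]) + arc (segment ℝ (!₂[a, d] : Plane) !₂[b, d])) := by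
        refine (arc_mono (frontier_box_subset a b c d)).trans ?_
        exact (Measure.restrict_union_le _ _).trans
          (add_le_add (Measure.restrict_union_le _ _) (Measure.restrict_union_le _ _))
    _ ≤ (vEdge a c (d - c) + vEdge b c (d - c)) + (hEdge a c (b - a) + hEdge a d (b - a)) :=
        add_le_add (add_le_add (arc_vertical hM (hv a)) (arc_vertical hM (hv b)))
          (add_le_add (arc_horizontal hL (hh c)) (arc_horizontal hL (hh d)))
    _ = ∑ i, sides a b c d i := by
        rw [Fin.sum_univ_four]
        simp only [sides, Matrix.cons_val]
        abel

theorem rect_subset {p q L M : ℝ} (h1 : uIoo p (p + L) ⊆ Ioo a b)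
    (h2 : uIoo q (q + M) ⊆ Ioo c d) : rect p q L M ⊆ box a b c d :=
  fun _ hx => ⟨h1 hx.1, h2 hx.2⟩

/-- Sixteen pairs of sides, of three kinds: a side with itself (path at the height of the distance),
adjacent sides (corner estimate, placed at each vertex by the signs of the lengths), and opposite
sides (no singularity). The order within a pair does not matter by symmetry of the kernel. -/
theorem sobolevBounded_kern_sides (hab : a < b) (hcd : c < d) (i j : Fin 4) :
    SobolevBounded (box a b c d) fun Φ =>
      ∫⁻ x, ∫⁻ y, kern Φ x y ∂(sides a b c d j) ∂(sides a b c d i) := by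
  have hL : b - a ≠ 0 := (sub_pos.mpr hab).ne'
  have hM : d - c ≠ 0 := (sub_pos.mpr hcd).ne'
  have hL' := neg_ne_zero.mpr hL
  have hM' := neg_ne_zero.mpr hM
  have ea : uIoo a (a + (b - a)) ⊆ Ioo a b := by rw [add_sub_cancel, uIoo_of_le hab.le]
  have eb : uIoo b (b + -(b - a)) ⊆ Ioo a b := by
    rw [neg_sub, add_sub_cancel, uIoo_comm, uIoo_of_le hab.le]
  have ec : uIoo c (c + (d - c)) ⊆ Ioo c d := by rw [add_sub_cancel, uIoo_of_le hcd.le]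
  have ed : uIoo d (d + -(d - c)) ⊆ Ioo c d := by
    rw [neg_sub, add_sub_cancel, uIoo_comm, uIoo_of_le hcd.le]
  have rh : ∀ q, hEdge b q (-(b - a)) = hEdge a q (b - a) := fun q => by
    have := hEdge_reverse (p := a) (q := q) hL
    rwa [add_sub_cancel] at this
  have rv : ∀ p, vEdge p d (-(d - c)) = vEdge p c (d - c) := fun p => by
    have := vEdge_reverse (p := p) (q := c) hM
    rwa [add_sub_cancel] at this
  have tS := (sobolevBounded_hEdge a c hL hM).mono (rect_subset ea ec) fun _ _ => le_rfl
  have tN := (sobolevBounded_hEdge a d hL hM').mono (rect_subset ea ed) fun _ _ => le_rfl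
  have tW := (sobolevBounded_vEdge a c hL hM).mono (rect_subset ea ec) fun _ _ => le_rfl
  have tE := (sobolevBounded_vEdge b c hL' hM).mono (rect_subset eb ec) fun _ _ => le_rfl
  have kSS := (sobolevBounded_kern_hEdge a c hL hM).mono (rect_subset ea ec) fun _ _ => le_rfl
  have kNN := (sobolevBounded_kern_hEdge a d hL hM').mono (rect_subset ea ed) fun _ _ => le_rfl
  have kWW := (sobolevBounded_kern_vEdge a c hL hM).mono (rect_subset ea ec) fun _ _ => le_rfl
  have kEE := (sobolevBounded_kern_vEdge b c hL' hM).mono (rect_subset eb ec) fun _ _ => le_rfl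
  have kSW := (sobolevBounded_kern_corner a c hL hM).mono (rect_subset ea ec) fun _ _ => le_rfl
  have kSE := (sobolevBounded_kern_corner b c hL' hM).mono (rect_subset eb ec) fun _ _ => le_rfl
  have kNW := (sobolevBounded_kern_corner a d hL hM').mono (rect_subset ea ed) fun _ _ => le_rfl
  have kNE := (sobolevBounded_kern_corner b d hL' hM').mono (rect_subset eb ed) fun _ _ => le_rfl
  simp only [rh, rv] at kSE kNW kNE
  have kSN := sobolevBounded_kern_of_le_dist tS tN (sub_pos.mpr hcd) (by
    filter_upwards [ae_hEdge a c (b - a)] with x hx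
    filter_upwards [ae_hEdge a d (b - a)] with y hy
    have := abs_coord_sub_le_dist x y 1
    rw [hx, hy] at this
    linarith [neg_abs_le (c - d)])
  have kWE := sobolevBounded_kern_of_le_dist tW tE (sub_pos.mpr hab) (by
    filter_upwards [ae_vEdge a c (d - c)] with x hx
    filter_upwards [ae_vEdge b c (d - c)] with y hy
    have := abs_coord_sub_le_dist x y 0
    rw [hx, hy] at this
    linarith [neg_abs_le (a - b)])
  fin_cases i <;> fin_cases j
  · exact kSS
  · exact kSN
  · exact kSW
  · exact kSE
  · exact kSN.kern_swap
  · exact kNN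
  · exact kNW
  · exact kNE
  · exact kSW.kern_swap
  · exact kNW.kern_swap
  · exact kWW
  · exact kWE
  · exact kSE.kern_swap
  · exact kNE.kern_swap
  · exact kWE.kern_swap
  · exact kEE

/-- The trace theorem for smooth functions: the `H^{1/2}` seminorm on the boundary of a box. -/
theorem sobolevBounded_kern_frontier (hab : a < b) (hcd : c < d) :
    SobolevBounded (box a b c d) fun Φ =>
      ∫⁻ x, ∫⁻ y, kern Φ x y ∂(arc (frontier (box a b c d))) ∂(arc (frontier (box a b c d))) := by
  refine (SobolevBounded.sum Finset.univ fun i => SobolevBounded.sum Finset.univ fun j =>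
    sobolevBounded_kern_sides hab hcd i j).mono subset_rfl fun Φ hΦ => ?_
  have hle := arc_frontier_le hab hcd
  refine (lintegral_mono' hle fun x => lintegral_mono' hle le_rfl).trans ?_
  simp only [lintegral_finsetSum_measure]
  refine Finset.sum_le_sum fun i _ => ?_
  rw [lintegral_finsetSum _ fun j _ => measurable_lintegral_kern hΦ.continuous _]

/-- A compact subset of a box keeps a positive distance from the sides. -/
theorem exists_collar (hab : a < b) (hcd : c < d) {S : Set Plane} (hS : IsCompact S)
    (hSB : S ⊆ box a b c d) : ∃ δ > 0, δ ≤ b - a ∧ δ ≤ d - c ∧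
      ∀ x ∈ S, a + δ ≤ x 0 ∧ x 0 ≤ b - δ ∧ c + δ ≤ x 1 ∧ x 1 ≤ d - δ := by
  let f : Plane → ℝ := fun x => min (min (x 0 - a) (b - x 0)) (min (x 1 - c) (d - x 1))
  have hf : Continuous f := by fun_prop
  obtain ⟨δ, hδ, h⟩ := hS.exists_forall_le' (f := f) hf.continuousOn (a := 0) fun x hx => by
    obtain ⟨⟨h1, h2⟩, h3, h4⟩ := hSB hx
    simp only [f, lt_min_iff, sub_pos]
    exact ⟨⟨h1, h2⟩, h3, h4⟩
  refine ⟨min δ (min (b - a) (d - c)), ?_, ?_, ?_, fun x hx => ?_⟩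
  · exact lt_min hδ (lt_min (sub_pos.mpr hab) (sub_pos.mpr hcd))
  · exact (min_le_right _ _).trans (min_le_left _ _)
  · exact (min_le_right _ _).trans (min_le_right _ _)
  · have h1 := h x hx
    have h2 : min δ (min (b - a) (d - c)) ≤ δ := min_le_left _ _
    simp only [f, le_min_iff] at h1
    obtain ⟨⟨h3, h4⟩, h5, h6⟩ := h1
    refine ⟨?_, ?_, ?_, ?_⟩ <;> linarith

/-- The `L²` trace theorem for smooth functions, with the norm of `H¹` away from the scatterer. -/
theorem sobolevBounded_frontier (hab : a < b) (hcd : c < d) {S : Set Plane} (hS : IsCompact S)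
    (hSB : S ⊆ box a b c d) :
    SobolevBounded (box a b c d \ S) fun Φ =>
      ∫⁻ x, ‖Φ x‖ₑ ^ 2 ∂(arc (frontier (box a b c d))) := by
  have hL : b - a ≠ 0 := (sub_pos.mpr hab).ne'
  have hM : d - c ≠ 0 := (sub_pos.mpr hcd).ne'
  obtain ⟨δ, hδ, hδ1, hδ2, hcol⟩ := exists_collar hab hcd hS hSB
  have e : ∀ p L : ℝ, 0 < L → uIoo p (p + L) = Ioo p (p + L) := fun p L h =>
    uIoo_of_le (by linarith)
  have e' : ∀ p L : ℝ, 0 < L → uIoo p (p + -L) = Ioo (p - L) p := fun p L h => by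
    rw [uIoo_comm, uIoo_of_le (by linarith), sub_eq_add_neg]
  -- For each side the rectangle used has thickness δ and lies between that side and the scatterer.
  have key : ∀ i, SobolevBounded (box a b c d \ S) fun Φ =>
      ∫⁻ x, ‖Φ x‖ₑ ^ 2 ∂(sides a b c d i) := by
    intro i
    fin_cases i
    · refine (sobolevBounded_hEdge a c hL hδ.ne').mono ?_ fun _ _ => le_rfl
      rintro x ⟨h1, h2⟩
      rw [e _ _ (sub_pos.mpr hab), add_sub_cancel] at h1
      rw [e _ _ hδ] at h2
      exact ⟨⟨h1, h2.1, by linarith [h2.2]⟩, fun hx => by linarith [hcol x hx, h2.2]⟩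
    · refine (sobolevBounded_hEdge a d hL (neg_ne_zero.mpr hδ.ne')).mono ?_ fun _ _ => le_rfl
      rintro x ⟨h1, h2⟩
      rw [e _ _ (sub_pos.mpr hab), add_sub_cancel] at h1
      rw [e' _ _ hδ] at h2
      exact ⟨⟨h1, by linarith [h2.1], h2.2⟩, fun hx => by linarith [hcol x hx, h2.1]⟩
    · refine (sobolevBounded_vEdge a c hδ.ne' hM).mono ?_ fun _ _ => le_rfl
      rintro x ⟨h1, h2⟩
      rw [e _ _ (sub_pos.mpr hcd), add_sub_cancel] at h2
      rw [e _ _ hδ] at h1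
      exact ⟨⟨⟨h1.1, by linarith [h1.2]⟩, h2⟩, fun hx => by linarith [hcol x hx, h1.2]⟩
    · refine (sobolevBounded_vEdge b c (neg_ne_zero.mpr hδ.ne') hM).mono ?_ fun _ _ => le_rfl
      rintro x ⟨h1, h2⟩
      rw [e _ _ (sub_pos.mpr hcd), add_sub_cancel] at h2
      rw [e' _ _ hδ] at h1
      exact ⟨⟨⟨by linarith [h1.1], h1.2⟩, h2⟩, fun hx => by linarith [hcol x hx, h1.1]⟩
  refine (SobolevBounded.sum Finset.univ key).mono subset_rfl fun Φ _ => ?_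
  exact (lintegral_mono' (arc_frontier_le hab hcd) le_rfl).trans_eq
    (lintegral_finsetSum_measure _ _ _)

/-- A function vanishing near S contributes nothing on S. The rectangles and grid cells below may
therefore overlap the scatterer freely. -/
theorem sobolev_le_sobolev_diff {B S : Set Plane} (hB : MeasurableSet B)
    (hS : MeasurableSet S) {Φ : Plane → ℂ} (h : Disjoint (tsupport Φ) S) : sobolev B Φ ≤ sobolev (B \ S) Φ := by
  have h0 : ∀ x ∈ S, x ∉ tsupport Φ := fun x hx hx' => disjoint_left.mp h hx' hx
  have key : ∀ f : Plane → ℝ≥0∞, (∀ x ∈ S, f x = 0) → ∫⁻ x in B, f x ≤ ∫⁻ x in B \ S, f x := by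
    intro f hf
    rw [← lintegral_inter_add_sdiff f B hS, setLIntegral_congr_fun (g := fun _ => 0)
      (hB.inter hS) fun x hx => hf x hx.2]
    simp
  refine add_le_add (key _ fun x hx => ?_) (key _ fun x hx => ?_)
  · simp [image_eq_zero_of_notMem_tsupport (h0 x hx)]
  · rw [fderiv_of_notMem_tsupport ℝ (h0 x hx), ← ofReal_norm, norm_zero, ENNReal.ofReal_zero,
      zero_pow two_ne_zero]

end TraceEstimates

/-! ### Compactness of the embedding of `H¹` into `L²` -/

section Rellich

open Set

/-- Integrate f(x) = f(y) + (f(x) - f(y)) in y: up to the total mass, f is its integral plus an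
averaged difference. The form without division avoids assuming positive mass. -/
theorem sq_measure_mul_lintegral_le {α : Type*} [MeasurableSpace α] (μ : Measure α)
    [IsFiniteMeasure μ] {f : α → ℂ} (hf : StronglyMeasurable f) (hfi : Integrable f μ) :
    μ univ ^ 2 * ∫⁻ x, ‖f x‖ₑ ^ 2 ∂μ ≤ μ univ * (2 * ‖∫ x, f x ∂μ‖ₑ ^ 2 +
      2 * ∫⁻ x, ∫⁻ y, ‖f x - f y‖ₑ ^ 2 ∂μ ∂μ) := by
  have hm : Measurable fun z : α × α => ‖f z.1 - f z.2‖ₑ ^ 2 :=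
    ((hf.measurable.comp measurable_fst).sub (hf.measurable.comp measurable_snd)).enorm.pow_const 2
  have hm' : Measurable fun x => ∫⁻ y, ‖f x - f y‖ₑ ^ 2 ∂μ := hm.lintegral_prod_right'
  have key : ∀ x, μ univ ^ 2 * ‖f x‖ₑ ^ 2 ≤ 2 * ‖∫ x, f x ∂μ‖ₑ ^ 2 +
      2 * (μ univ * ∫⁻ y, ‖f x - f y‖ₑ ^ 2 ∂μ) := by
    intro x
    have h1 : ∫ y, (f x - f y) ∂μ = μ.real univ • f x - ∫ y, f y ∂μ := by
      rw [integral_sub (integrable_const _) hfi, integral_const]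
    have h2 : μ univ * ‖f x‖ₑ ≤ ‖∫ y, f y ∂μ‖ₑ + ∫⁻ y, ‖f x - f y‖ₑ ∂μ := by
      have h3 : ‖μ.real univ • f x‖ₑ = μ univ * ‖f x‖ₑ := by
        rw [enorm_smul, Real.enorm_eq_ofReal measureReal_nonneg, ofReal_measureReal]
      rw [← h3, show μ.real univ • f x = ∫ y, f y ∂μ + ∫ y, (f x - f y) ∂μ by rw [h1]; ring]
      exact (enorm_add_le _ _).trans (by gcongr; exact enorm_integral_le_lintegral_enorm _)
    rw [← mul_pow]
    refine (pow_le_pow_left' h2 2).trans ((ENNReal_add_sq_le _ _).trans ?_)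
    gcongr
    exact sq_lintegral_le μ (hf.measurable.const_sub (f x)).enorm.aemeasurable
  rw [← lintegral_const_mul' _ _ (ENNReal.pow_ne_top (measure_ne_top μ univ))]
  refine (lintegral_mono key).trans_eq ?_
  rw [lintegral_add_left measurable_const, lintegral_const,
    lintegral_const_mul' _ _ ENNReal.ofNat_ne_top, lintegral_const_mul' _ _ (measure_ne_top μ univ)]
  ring

theorem volume_rect {p q L M : ℝ} (hL : L ≠ 0) (hM : M ≠ 0) :
    volume (rect p q L M) = ENNReal.ofReal |L| * ENNReal.ofReal |M| := by
  have h := lintegral_rect (p := p) (q := q) hL hM (f := fun _ => 1) measurable_const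
  simp only [lintegral_const, Measure.restrict_apply_univ, Real.volume_Ioo, sub_zero,
    ENNReal.ofReal_one, one_mul] at h
  have hL' : ENNReal.ofReal |L| * ENNReal.ofReal |L⁻¹| = 1 := by
    rw [← ENNReal.ofReal_mul (abs_nonneg _), ← abs_mul, mul_inv_cancel₀ hL]; simp
  have hM' : ENNReal.ofReal |M| * ENNReal.ofReal |M⁻¹| = 1 := by
    rw [← ENNReal.ofReal_mul (abs_nonneg _), ← abs_mul, mul_inv_cancel₀ hM]; simp
  calc volume (rect p q L M)
      = (ENNReal.ofReal |L| * ENNReal.ofReal |L⁻¹|) * (ENNReal.ofReal |M| * ENNReal.ofReal |M⁻¹|) *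
        volume (rect p q L M) := by rw [hL', hM', one_mul, one_mul]
    _ = ENNReal.ofReal |L| * ENNReal.ofReal |M| *
        (ENNReal.ofReal |L⁻¹| * ENNReal.ofReal |M⁻¹| * volume (rect p q L M)) := by ring
    _ = _ := by rw [← h, mul_one]

/-- Poincaré's inequality on a rectangle. -/
theorem poincare_rect {Φ : Plane → ℂ} (hΦ : ContDiff ℝ ∞ Φ) (hc : HasCompactSupport Φ) (p q : ℝ)
    {L M K : ℝ} (hL : L ≠ 0) (hM : M ≠ 0) (hLK : |L| ≤ K) (hMK : |M| ≤ K) :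
    ∫⁻ x in rect p q L M, ‖Φ x‖ₑ ^ 2 ≤
      2 * (volume (rect p q L M))⁻¹ * ‖∫ x in rect p q L M, Φ x‖ₑ ^ 2 +
      8 * ENNReal.ofReal K ^ 2 * ∫⁻ x in rect p q L M, ‖fderiv ℝ Φ x‖ₑ ^ 2 := by
  set Q := rect p q L M
  set V := volume Q with hV
  have hVeq : V = ENNReal.ofReal |L| * ENNReal.ofReal |M| := volume_rect hL hM
  have hL0 : 0 < |L| := abs_pos.mpr hL
  have hM0 : 0 < |M| := abs_pos.mpr hM
  have hV0 : V ≠ 0 := by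
    rw [hVeq]; exact mul_ne_zero (by simpa using hL) (by simpa using hM)
  have hVt : V ≠ ⊤ := by rw [hVeq]; finiteness
  have hVinv : V⁻¹ = ENNReal.ofReal |L⁻¹| * ENNReal.ofReal |M⁻¹| := by
    rw [hVeq, ENNReal.mul_inv (Or.inl (by simpa using hL)) (Or.inl ENNReal.ofReal_ne_top),
      abs_inv, abs_inv, ENNReal.ofReal_inv_of_pos hL0, ENNReal.ofReal_inv_of_pos hM0]
  have : IsFiniteMeasure (volume.restrict Q) :=
    ⟨by rw [Measure.restrict_apply_univ]; exact hVt.lt_top⟩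
  have hd : Measurable fun z : Plane × Plane => ‖Φ z.1 - Φ z.2‖ₑ ^ 2 :=
    (((hΦ.continuous.comp continuous_fst).sub
      (hΦ.continuous.comp continuous_snd)).measurable.enorm.pow_const 2)
  have hdx : ∀ x, Measurable fun y => ‖Φ x - Φ y‖ₑ ^ 2 := fun x =>
    ((continuous_const.sub hΦ.continuous).measurable.enorm.pow_const 2)
  have hd1 : Measurable fun x => ∫⁻ y in Q, ‖Φ x - Φ y‖ₑ ^ 2 := hd.lintegral_prod_right'
  have h1 := sq_measure_mul_lintegral_le (volume.restrict Q) hΦ.continuous.stronglyMeasurable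
    (hΦ.continuous.integrable_of_hasCompactSupport hc).integrableOn
  rw [Measure.restrict_apply_univ, ← hV] at h1
  have h2 := lintegral_sq_sub_le (isUpperGradient_rect hΦ p q hLK hMK)
  rw [energy_rect hΦ p q hL hM, ← hVinv] at h2
  -- The bound on the unit square, rescaled: each change of variables costs one factor V⁻¹. The
  -- final constant 8 is 2 · 4.
  have h3 : V⁻¹ * (V⁻¹ * ∫⁻ x in Q, ∫⁻ y in Q, ‖Φ x - Φ y‖ₑ ^ 2) ≤
      4 * (ENNReal.ofReal K ^ 2 * (V⁻¹ * ∫⁻ x in Q, ‖fderiv ℝ Φ x‖ₑ ^ 2)) := by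
    refine le_trans (le_of_eq ?_) h2
    have e1 : ∀ s t : ℝ, ∫⁻ s' in Ioo (0 : ℝ) 1, ∫⁻ t' in Ioo (0 : ℝ) 1,
        ‖Φ !₂[p + L * s, q + M * t] - Φ !₂[p + L * s', q + M * t']‖ₑ ^ 2 =
        V⁻¹ * ∫⁻ y in Q, ‖Φ !₂[p + L * s, q + M * t] - Φ y‖ₑ ^ 2 := fun s t => by
      rw [hVinv]
      exact lintegral_rect hL hM (hdx _)
    simp only [e1]
    rw [← lintegral_const_mul' _ _ (ENNReal.inv_ne_top.mpr hV0), hVinv]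
    exact (lintegral_rect (p := p) (q := q) hL hM (hd1.const_mul _)).symm
  calc ∫⁻ x in Q, ‖Φ x‖ₑ ^ 2 = V⁻¹ ^ 2 * (V ^ 2 * ∫⁻ x in Q, ‖Φ x‖ₑ ^ 2) := by
        rw [← mul_assoc, ← mul_pow, ENNReal.inv_mul_cancel hV0 hVt, one_pow, one_mul]
    _ ≤ V⁻¹ ^ 2 * (V * (2 * ‖∫ x in Q, Φ x‖ₑ ^ 2 +
          2 * ∫⁻ x in Q, ∫⁻ y in Q, ‖Φ x - Φ y‖ₑ ^ 2)) := by gcongr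
    _ = (V⁻¹ * V) * (2 * V⁻¹ * ‖∫ x in Q, Φ x‖ₑ ^ 2) + 2 * (V * (V⁻¹ * (V⁻¹ *
          ∫⁻ x in Q, ∫⁻ y in Q, ‖Φ x - Φ y‖ₑ ^ 2))) := by ring
    _ ≤ (V⁻¹ * V) * (2 * V⁻¹ * ‖∫ x in Q, Φ x‖ₑ ^ 2) + 2 * (V * (4 * (ENNReal.ofReal K ^ 2 *
          (V⁻¹ * ∫⁻ x in Q, ‖fderiv ℝ Φ x‖ₑ ^ 2)))) := by gcongr
    _ = (V⁻¹ * V) * (2 * V⁻¹ * ‖∫ x in Q, Φ x‖ₑ ^ 2) + (V⁻¹ * V) *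
          (8 * ENNReal.ofReal K ^ 2 * ∫⁻ x in Q, ‖fderiv ℝ Φ x‖ₑ ^ 2) := by ring
    _ = _ := by rw [ENNReal.inv_mul_cancel hV0 hVt, one_mul, one_mul]

theorem lintegral_Ioo_grid (p : ℝ) {h : ℝ} (hh : 0 < h) (n : ℕ) (f : ℝ → ℝ≥0∞) :
    ∫⁻ s in Ioo p (p + n * h), f s =
      ∑ i ∈ Finset.range n, ∫⁻ s in uIoo (p + i * h) (p + i * h + h), f s := by
  have e : ∀ i : ℕ, uIoo (p + i * h) (p + i * h + h) = Ioo (p + i * h) (p + i * h + h) := fun i =>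
    uIoo_of_le (by linarith)
  -- Half-open cells have the same integrals as the open ones and tile the interval exactly.
  simp only [e, restrict_Ioo_eq_restrict_Ioc]
  induction n with
  | zero => simp
  | succ n ih =>
    have e2 : p + ((n + 1 : ℕ) : ℝ) * h = p + n * h + h := by push_cast; ring
    rw [Finset.sum_range_succ, ← ih, e2, ← lintegral_union measurableSet_Ioc
      (Ioc_disjoint_Ioc_of_le le_rfl), Ioc_union_Ioc_eq_Ioc]
    · have : 0 ≤ (n : ℝ) * h := by positivity
      linarith
    · linarith

theorem lintegral_box_grid {a b c d : ℝ} (hab : a < b) (hcd : c < d) {n : ℕ} (hn : 0 < n)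
    {f : Plane → ℝ≥0∞} (hf : Measurable f) :
    ∫⁻ x in box a b c d, f x = ∑ i ∈ Finset.range n, ∑ j ∈ Finset.range n,
      ∫⁻ x in rect (a + i * ((b - a) / n)) (c + j * ((d - c) / n)) ((b - a) / n) ((d - c) / n),
        f x := by
  have hn' : (0 : ℝ) < n := by exact_mod_cast hn
  have hh : 0 < (b - a) / n := div_pos (sub_pos.mpr hab) hn'
  have hh' : 0 < (d - c) / n := div_pos (sub_pos.mpr hcd) hn'
  have e1 : box a b c d = {x : Plane | x 0 ∈ Ioo a (a + n * ((b - a) / n)) ∧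
      x 1 ∈ Ioo c (c + n * ((d - c) / n))} := by
    rw [mul_div_cancel₀ _ hn'.ne', mul_div_cancel₀ _ hn'.ne', add_sub_cancel, add_sub_cancel]
    rfl
  rw [e1, lintegral_coord measurableSet_Ioo measurableSet_Ioo hf, lintegral_Ioo_grid a hh]
  refine Finset.sum_congr rfl fun i _ => ?_
  simp only [lintegral_Ioo_grid c hh']
  rw [lintegral_finsetSum]
  · refine Finset.sum_congr rfl fun j _ => ?_
    exact (lintegral_coord measurableSet_Ioo measurableSet_Ioo hf).symm
  · intro j _
    exact (hf.comp continuous_point.measurable).lintegral_prod_right'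

end Rellich

/-! ### The space of functions that vanish on the scatterer -/

section Vanishing

variable {B S : Set Plane}

/-- The smooth functions in `H¹(B \ S)` that vanish near `S`. -/
def smoothVanishing (B S : Set Plane) : Submodule ℂ (H1 (B \ S)) where
  carrier := {v | ∃ Φ, H1.IsSmooth v Φ ∧ Disjoint (tsupport Φ) S}
  zero_mem' := by
    refine ⟨0, ⟨contDiff_const, HasCompactSupport.zero, ?_⟩, by simp [tsupport]⟩
    exact Lp.coeFn_zero _ _ _
  add_mem' := by
    rintro u v ⟨Φ, hΦ, h⟩ ⟨Ψ, hΨ, h'⟩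
    exact ⟨Φ + Ψ, hΦ.add hΨ, (h.union_left h').mono_left (tsupport_add Φ Ψ)⟩
  smul_mem' := by
    rintro r u ⟨Φ, hΦ, h⟩
    refine ⟨r • Φ, hΦ.smul r, h.mono_left (closure_mono ?_)⟩
    exact Function.support_const_smul_subset r Φ

/-- The functions in `H¹(B \ S)` that vanish on the boundary of `S`. -/
def vanishing (B S : Set Plane) : Submodule ℂ (H1 (B \ S)) :=
  (smoothVanishing B S).topologicalClosure

instance completeSpace_vanishing : CompleteSpace (vanishing B S) :=
  (Submodule.isClosed_topologicalClosure _).completeSpace_coe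

theorem smoothVanishing_le : smoothVanishing B S ≤ vanishing B S :=
  Submodule.le_topologicalClosure _

theorem conj_mem_vanishing {u : H1 (B \ S)} (hu : u ∈ vanishing B S) :
    H1.conj u ∈ vanishing B S := by
  refine map_mem_closure H1.isometry_conj.continuous hu ?_
  rintro v ⟨Φ, hΦ, h⟩
  refine ⟨_, hΦ.conj, h.mono_left (closure_mono fun x hx => ?_)⟩
  simpa using hx

/-- Complex conjugation on `vanishing B S`. -/
def vconj (u : vanishing B S) : vanishing B S := ⟨H1.conj u.1, conj_mem_vanishing u.2⟩

theorem continuous_vconj : Continuous (vconj : vanishing B S → vanishing B S) :=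
  (H1.isometry_conj.continuous.comp continuous_subtype_val).subtype_mk _

theorem vconj_vconj (u : vanishing B S) : vconj (vconj u) = u := Subtype.ext (H1.conj_conj u.1)

theorem dense_smooth : Dense {u : vanishing B S | u.1 ∈ smoothVanishing B S} := by
  intro v
  rw [closure_subtype]
  refine closure_mono ?_ v.2
  intro w hw
  exact ⟨⟨w, smoothVanishing_le hw⟩, hw, rfl⟩

/-- Density principle: a closed property needs checking only on smooth functions that vanish near S.
-/
theorem vanishing_induction {p : vanishing B S → Prop} (hp : IsClosed {u | p u})
    (h : ∀ (u : H1 (B \ S)) (hu : u ∈ vanishing B S) (Φ : Plane → ℂ), H1.IsSmooth u Φ →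
      Disjoint (tsupport Φ) S → p ⟨u, hu⟩) (u : vanishing B S) : p u := by
  refine hp.closure_subset_iff.mpr ?_ (dense_smooth u)
  rintro ⟨v, hv⟩ ⟨Φ, hΦ, hd⟩
  exact h v hv Φ hΦ hd

/-- The embedding of `vanishing B S` into `L²`. -/
def vfn (B S : Set Plane) : vanishing B S →L[ℂ] Lp ℂ 2 (volume.restrict (B \ S)) :=
  (H1.fnL (B \ S)).comp (vanishing B S).subtypeL

theorem sq_le_of_ofReal_sq_le {κ : Type*} [Fintype κ] {x y C K : ℝ} {z : κ → ℝ} (hx : 0 ≤ x)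
    (hy : 0 ≤ y) (hC : 0 ≤ C) (hK : 0 ≤ K) (hz : ∀ i, 0 ≤ z i)
    (h : ENNReal.ofReal x ^ 2 ≤ (∑ i, 2 * ENNReal.ofReal C * ENNReal.ofReal (z i) ^ 2) +
      8 * ENNReal.ofReal K ^ 2 * ENNReal.ofReal y ^ 2) :
    x ^ 2 ≤ 2 * C * ∑ i, z i ^ 2 + 8 * K ^ 2 * y ^ 2 := by
  have hs : 0 ≤ ∑ i, z i ^ 2 := Finset.sum_nonneg fun i _ => sq_nonneg _
  refine (ENNReal.ofReal_le_ofReal_iff (by positivity)).mp ?_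
  rw [ENNReal.ofReal_add (by positivity) (by positivity), ENNReal.ofReal_mul (by positivity),
    ENNReal.ofReal_mul (by positivity), ENNReal.ofReal_mul (by positivity),
    ENNReal.ofReal_mul (by positivity), ENNReal.ofReal_sum_of_nonneg fun i _ => sq_nonneg _,
    Finset.mul_sum, ENNReal.ofReal_pow hx, ENNReal.ofReal_pow hy, ENNReal.ofReal_pow hK]
  simpa only [ENNReal.ofReal_pow (hz _), ENNReal.ofReal_ofNat] using h

open Set in
/-- On a fine grid, the `L²` norm is controlled by the means over the cells and the gradient. -/
theorem rellich_grid {a b c d : ℝ} (hab : a < b) (hcd : c < d)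
    (hB : B = box a b c d) (hS : IsCompact S) {ε : ℝ} (hε : 0 < ε) :
    ∃ (κ : Type) (_ : Fintype κ) (ℓ : κ → Lp ℂ 2 (volume.restrict (B \ S))) (C : ℝ),
      ∀ (u : H1 (B \ S)) (Φ : Plane → ℂ), H1.IsSmooth u Φ → Disjoint (tsupport Φ) S →
        ‖H1.fn u‖ ^ 2 ≤ C * ∑ i, ‖inner ℂ (ℓ i) (H1.fn u)‖ ^ 2 + ε ^ 2 * ‖u‖ ^ 2 := by
  have hBo : IsOpen B := hB ▸ isOpen_box a b c d
  have hΩ : IsOpen (B \ S) := hBo.sdiff hS.isClosed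
  -- This makes 3(h + h') ≤ ε for the cell sides h, h'. Poincaré's constant on a cell is 8(h + h')²,
  -- and 8 ≤ 3².
  obtain ⟨n, hn⟩ := exists_nat_gt (3 * ((b - a) + (d - c)) / ε)
  have hpos : 0 < 3 * ((b - a) + (d - c)) := by linarith
  have hn0 : (0 : ℝ) < n := (div_pos hpos hε).trans hn
  have hn1 : 0 < n := by exact_mod_cast hn0
  obtain ⟨h, hh⟩ : ∃ h, h = (b - a) / n := ⟨_, rfl⟩
  obtain ⟨h', hh'⟩ : ∃ h', h' = (d - c) / n := ⟨_, rfl⟩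
  have hhp : 0 < h := hh ▸ div_pos (sub_pos.mpr hab) hn0
  have hhp' : 0 < h' := hh' ▸ div_pos (sub_pos.mpr hcd) hn0
  have e1 : (n : ℝ) * h = b - a := hh ▸ mul_div_cancel₀ _ hn0.ne'
  have e2 : (n : ℝ) * h' = d - c := hh' ▸ mul_div_cancel₀ _ hn0.ne'
  let Q : Fin n × Fin n → Set Plane := fun ij => rect (a + ij.1 * h) (c + ij.2 * h') h h'
  have hQm : ∀ ij, MeasurableSet (Q ij) := fun ij => measurableSet_rect _ _ _ _
  have hQv : ∀ ij, volume (Q ij) = ENNReal.ofReal (h * h') := fun ij => by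
    rw [ENNReal.ofReal_mul hhp.le]
    simpa [abs_of_pos, hhp, hhp'] using
      volume_rect (p := a + ij.1 * h) (q := c + ij.2 * h') hhp.ne' hhp'.ne'
  have hQf : ∀ ij, (volume.restrict (B \ S)) (Q ij) ≠ ⊤ := fun ij => by
    refine ((Measure.restrict_apply_le _ _).trans_lt ?_).ne
    rw [hQv]; exact ENNReal.ofReal_lt_top
  have hKp : 0 < h + h' := add_pos hhp hhp'
  have h3 : 3 * (h + h') ≤ ε := by
    rw [hh, hh', ← add_div, ← mul_div_assoc, div_le_iff₀ hn0]
    rw [div_lt_iff₀ hε] at hn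
    linarith
  refine ⟨Fin n × Fin n, inferInstance, fun ij => indicatorConstLp 2 (hQm ij) (hQf ij) (1 : ℂ),
    2 * (h * h')⁻¹, fun u Φ hΦ hdis => ?_⟩
  have hz : ∀ x ∈ S, Φ x = 0 := fun x hx =>
    image_eq_zero_of_notMem_tsupport fun hx' => Set.disjoint_left.mp hdis hx' hx
  have hsub : ∀ ij, Q ij ⊆ B := by
    rintro ⟨i, j⟩ x ⟨h1, h2⟩
    rw [uIoo_of_le (by linarith)] at h1 h2
    have hi : ((i : ℕ) : ℝ) + 1 ≤ n := by exact_mod_cast i.2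
    have hj : ((j : ℕ) : ℝ) + 1 ≤ n := by exact_mod_cast j.2
    have f1 : (0 : ℝ) ≤ (i : ℕ) * h := by positivity
    have f2 : (0 : ℝ) ≤ (j : ℕ) * h' := by positivity
    have g1 := mul_le_mul_of_nonneg_right hi hhp.le
    have g2 := mul_le_mul_of_nonneg_right hj hhp'.le
    have k1 := h1.1
    have k2 := h1.2
    have k3 := h2.1
    have k4 := h2.2
    dsimp only at k1 k2 k3 k4
    rw [hB]
    exact ⟨⟨by linarith, by linarith⟩, by linarith, by linarith⟩
  -- The pairing in L²(B \ S) is the integral over the whole cell, because Φ vanishes on S; so the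
  -- finitely many functionals are those of Poincaré's inequality.
  have hℓ : ∀ ij, inner ℂ (indicatorConstLp 2 (hQm ij) (hQf ij) (1 : ℂ)) (H1.fn u) =
      ∫ x in Q ij, Φ x := by
    intro ij
    refine (MeasureTheory.L2.inner_indicatorConstLp_one (hQm ij) (hQf ij) (H1.fn u)).trans ?_
    refine (integral_congr_ae (ae_restrict_of_ae hΦ.2.2)).trans ?_
    rw [Measure.restrict_restrict (hQm ij)]
    symm
    refine setIntegral_eq_of_subset_of_forall_sdiff_eq_zero (hQm ij) inter_subset_left ?_
    rintro x ⟨hx, hx'⟩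
    by_contra hne
    exact hx' ⟨hx, hsub ij hx, fun hxS => hne (hz x hxS)⟩
  have h1 := hΦ.lintegral_le hΩ
  have h2 := sobolev_le_sobolev_diff (B := B) hBo.measurableSet hS.measurableSet hdis
  have h3' : ∫⁻ x in B, ‖fderiv ℝ Φ x‖ₑ ^ 2 ≤ ‖u‖ₑ ^ 2 := le_add_self.trans (h2.trans h1)
  have h4 : ‖H1.fn u‖ₑ ^ 2 ≤ ∫⁻ x in B, ‖Φ x‖ₑ ^ 2 := by
    refine (L2.enorm_sq (H1.fn u)).trans_le ?_
    refine (lintegral_congr_ae (g := fun x => ‖Φ x‖ₑ ^ 2)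
      (by filter_upwards [hΦ.2.2] with x hx; rw [hx])).trans_le ?_
    exact lintegral_mono_set sdiff_subset
  have hmΦ : Measurable fun x => ‖Φ x‖ₑ ^ 2 := hΦ.1.continuous.measurable.enorm.pow_const 2
  have hmD : Measurable fun x => ‖fderiv ℝ Φ x‖ₑ ^ 2 :=
    (hΦ.1.continuous_fderiv (by simp)).measurable.enorm.pow_const 2
  have hgrid : ∀ f : Plane → ℝ≥0∞, Measurable f →
      ∫⁻ x in B, f x = ∑ ij, ∫⁻ x in Q ij, f x := by
    intro f hf
    rw [hB, lintegral_box_grid hab hcd hn1 hf, Fintype.sum_prod_type, Finset.sum_range]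
    refine Finset.sum_congr rfl fun i _ => ?_
    rw [Finset.sum_range]
    simp only [Q, hh, hh']
  have key : ‖H1.fn u‖ₑ ^ 2 ≤
      (∑ ij, 2 * (volume (Q ij))⁻¹ * ‖∫ x in Q ij, Φ x‖ₑ ^ 2) +
        8 * ENNReal.ofReal (h + h') ^ 2 * ‖u‖ₑ ^ 2 := by
    refine h4.trans (le_trans ?_ (add_le_add le_rfl (mul_le_mul' le_rfl h3')))
    rw [hgrid _ hmΦ, hgrid _ hmD, Finset.mul_sum, ← Finset.sum_add_distrib]
    refine Finset.sum_le_sum fun ij _ => ?_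
    refine poincare_rect hΦ.1 hΦ.2.1 _ _ hhp.ne' hhp'.ne' ?_ ?_
    · rw [abs_of_pos hhp]; linarith
    · rw [abs_of_pos hhp']; linarith
  have hpp := mul_pos hhp hhp'
  have key' := sq_le_of_ofReal_sq_le (κ := Fin n × Fin n) (x := ‖H1.fn u‖) (y := ‖u‖)
    (C := (h * h')⁻¹) (K := h + h') (z := fun ij => ‖∫ x in Q ij, Φ x‖)
    (norm_nonneg _) (norm_nonneg _) (by positivity) hKp.le (fun _ => norm_nonneg _) (by
      simp only [ofReal_norm, ENNReal.ofReal_inv_of_pos hpp]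
      simpa only [hQv] using key)
  refine key'.trans (add_le_add (le_of_eq ?_) (mul_le_mul_of_nonneg_right ?_ (by positivity)))
  · exact congrArg _ (Finset.sum_congr rfl fun ij _ => by rw [hℓ])
  calc 8 * (h + h') ^ 2 ≤ (3 * (h + h')) ^ 2 := by nlinarith [sq_nonneg (h + h')]
    _ ≤ ε ^ 2 := by gcongr

/-- Rellich's theorem. -/
theorem isCompactOperator_vfn {a b c d : ℝ} (hab : a < b) (hcd : c < d)
    (hB : B = box a b c d) (hS : IsCompact S) : IsCompactOperator (vfn B S) := by
  have hcompact := isCompactOperator_of_dense (H := vanishing B S)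
    (F := Lp ℂ 2 (volume.restrict (B \ S))) (vfn B S) dense_smooth
  exact hcompact fun ε hε => (rellich_grid hab hcd hB hS hε).imp fun κ h => h.imp fun hκ h =>
    h.imp fun ℓ h => h.imp fun C h u hu => hu.elim fun Φ hΦ => h u.1 Φ hΦ.1 hΦ.2
end Vanishing

/-! ### The trace operator -/

section Trace

variable {σ : Measure Plane} [IsFiniteMeasure σ]

theorem enorm_div_dist_sq_le (Φ : Plane → ℂ) (x y : Plane) :
    ‖(Φ x - Φ y) / (dist x y : ℂ)‖ₑ ^ 2 ≤ kern Φ x y := by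
  rcases eq_or_ne x y with rfl | h
  · simp
  · have hd : dist x y ≠ 0 := dist_ne_zero.mpr h
    have hd' : (dist x y : ℂ) ≠ 0 := by exact_mod_cast hd
    have e : ‖(dist x y : ℂ)‖ₑ = ENNReal.ofReal (dist x y) := by
      rw [← ofReal_norm, Complex.norm_real, Real.norm_of_nonneg dist_nonneg]
    rw [kern, div_eq_mul_inv, enorm_mul, enorm_inv hd', e, mul_pow]

theorem H12.coeFn_toL2 (g : H12 σ) : H12.toL2 σ g = g.1.fst := rfl

theorem H12.exists_of_continuous {Φ : Plane → ℂ} (hΦ : Continuous Φ) (hc : HasCompactSupport Φ)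
    (hk : ∫⁻ x, ∫⁻ y, kern Φ x y ∂σ ∂σ ≠ ⊤) : ∃ g : H12 σ, H12.toL2 σ g =ᵐ[σ] Φ := by
  have h1 : MemLp Φ 2 σ := hΦ.memLp_of_hasCompactSupport hc
  have hm : Measurable fun z : Plane × Plane => (Φ z.1 - Φ z.2) / (dist z.1 z.2 : ℂ) := by
    have : Measurable fun z : Plane × Plane => (dist z.1 z.2 : ℂ) :=
      (Complex.continuous_ofReal.comp continuous_dist).measurable
    exact (((hΦ.comp continuous_fst).sub (hΦ.comp continuous_snd)).measurable).div this
  have h2 : MemLp (fun z : Plane × Plane => (Φ z.1 - Φ z.2) / (dist z.1 z.2 : ℂ)) 2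
      (σ.prod σ) := by
    refine ⟨hm.aestronglyMeasurable, ?_⟩
    have e := eLpNorm_nnreal_pow_eq_lintegral (p := 2) (μ := σ.prod σ)
      (f := fun z : Plane × Plane => (Φ z.1 - Φ z.2) / (dist z.1 z.2 : ℂ)) (by norm_num)
    have hlt : ∫⁻ z, ‖(Φ z.1 - Φ z.2) / (dist z.1 z.2 : ℂ)‖ₑ ^ ((2 : NNReal) : ℝ) ∂(σ.prod σ)
        < ⊤ := by
      rw [lintegral_prod _ (hm.enorm.pow_const _).aemeasurable]
      refine (lintegral_mono fun x => lintegral_mono fun y => ?_).trans_lt hk.lt_top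
      simpa using enorm_div_dist_sq_le Φ x y
    rw [← e] at hlt
    simpa using (ENNReal.rpow_lt_top_iff_of_pos (by norm_num)).mp hlt
  have h3 := h1.coeFn_toLp
  refine ⟨⟨WithLp.toLp 2 (h1.toLp Φ, h2.toLp _), ?_⟩, h3⟩
  filter_upwards [h2.coeFn_toLp, Measure.quasiMeasurePreserving_fst (μ := σ) (ν := σ) |>.ae h3,
    Measure.quasiMeasurePreserving_snd (μ := σ) (ν := σ) |>.ae h3] with z a1 a2 a3
  exact a1.trans (by rw [← a2, ← a3]; rfl)

theorem H12.enorm_sq_le {Φ : Plane → ℂ} (hΦ : Measurable fun z : Plane × Plane => kern Φ z.1 z.2)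
    {g : H12 σ} (h : H12.toL2 σ g =ᵐ[σ] Φ) :
    ‖g‖ₑ ^ 2 ≤ (∫⁻ x, ‖Φ x‖ₑ ^ 2 ∂σ) + ∫⁻ x, ∫⁻ y, kern Φ x y ∂σ ∂σ := by
  have h0 : ‖g‖ ^ 2 = ‖g.1.fst‖ ^ 2 + ‖g.1.snd‖ ^ 2 := WithLp.prod_norm_sq_eq_of_L2 g.1
  have h1 : ‖g‖ₑ ^ 2 = ‖g.1.fst‖ₑ ^ 2 + ‖g.1.snd‖ₑ ^ 2 := by
    rw [← ofReal_norm, ← ofReal_norm, ← ofReal_norm, ← ENNReal.ofReal_pow (norm_nonneg _),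
      ← ENNReal.ofReal_pow (norm_nonneg _), ← ENNReal.ofReal_pow (norm_nonneg _),
      ← ENNReal.ofReal_add (by positivity) (by positivity), h0]
  rw [h1, L2.enorm_sq, L2.enorm_sq]
  refine add_le_add (le_of_eq (lintegral_congr_ae ?_)) ?_
  · filter_upwards [h] with x hx
    rw [← H12.coeFn_toL2, hx]
  · rw [← lintegral_prod (fun z => kern Φ z.1 z.2) hΦ.aemeasurable]
    refine lintegral_mono_ae ?_
    filter_upwards [g.2, Measure.quasiMeasurePreserving_fst (μ := σ) (ν := σ) |>.ae h,
      Measure.quasiMeasurePreserving_snd (μ := σ) (ν := σ) |>.ae h] with z a1 a2 a3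
    rw [a1, ← H12.coeFn_toL2, a2, a3]
    exact enorm_div_dist_sq_le Φ z.1 z.2

theorem norm_le_of_enorm_sq_le {E F : Type*} [SeminormedAddCommGroup E] [SeminormedAddCommGroup F]
    {x : E} {y : F} {C : ℝ≥0∞} (hC : C ≠ ⊤) (h : ‖x‖ₑ ^ 2 ≤ C * ‖y‖ₑ ^ 2) :
    ‖x‖ ≤ √C.toReal * ‖y‖ := by
  have h1 := ENNReal.toReal_mono (by finiteness) h
  simp only [ENNReal.toReal_pow, ENNReal.toReal_mul, toReal_enorm] at h1
  refine (abs_le_of_sq_le_sq' ?_ (by positivity)).2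
  rwa [mul_pow, Real.sq_sqrt ENNReal.toReal_nonneg]

end Trace

/-! ### Trace bounds on the boundary of a domain with scatterer, and the bounded trace operator -/

section

variable {B S : Set Plane}

/-- The values on `∂B` of smooth functions on `B \ S` are controlled in `L²`, and in `H^{1/2}` for
smooth functions that vanish near `S`. -/
structure HasTraceBounds (B S : Set Plane) : Prop where
  isOpen : IsOpen (B \ S)
  l2 : SobolevBounded (B \ S) fun Φ => ∫⁻ x, ‖Φ x‖ₑ ^ 2 ∂(arc (frontier B))
  kern : ∃ C : ℝ≥0∞, C ≠ ⊤ ∧ ∀ Φ, ContDiff ℝ ∞ Φ → Disjoint (tsupport Φ) S →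
    ∫⁻ x, ∫⁻ y, kern Φ x y ∂(arc (frontier B)) ∂(arc (frontier B)) ≤ C * sobolev (B \ S) Φ

theorem hasTraceBounds_box {a b c d : ℝ} (hab : a < b) (hcd : c < d) (hS : IsCompact S)
    (hSB : S ⊆ box a b c d) : HasTraceBounds (box a b c d) S := by
  refine ⟨(isOpen_box a b c d).sdiff hS.isClosed, sobolevBounded_frontier hab hcd hS hSB, ?_⟩
  obtain ⟨C, hC, h⟩ := sobolevBounded_kern_frontier hab hcd
  exact ⟨C, hC, fun Φ hΦ hd => (h Φ hΦ).trans (mul_le_mul' le_rfl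
    (sobolev_le_sobolev_diff (isOpen_box a b c d).measurableSet hS.measurableSet hd))⟩

theorem sobolev_ne_top {U : Set Plane} {Φ : Plane → ℂ} (hΦ : ContDiff ℝ ∞ Φ)
    (hc : HasCompactSupport Φ) : sobolev U Φ ≠ ⊤ := by
  have key : ∀ {E : Type} [NormedAddCommGroup E] (f : Plane → E), Continuous f →
      HasCompactSupport f → ∫⁻ x in U, ‖f x‖ₑ ^ 2 ≠ ⊤ := by
    intro E _ f hf hcf
    have := (hf.memLp_of_hasCompactSupport (μ := volume.restrict U) (p := 2) hcf).eLpNorm_lt_top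
    have e := eLpNorm_nnreal_pow_eq_lintegral (p := 2) (μ := volume.restrict U) (f := f)
      (by norm_num)
    have h2 : eLpNorm f ((2 : NNReal) : ℝ≥0∞) (volume.restrict U) ^ ((2 : NNReal) : ℝ) < ⊤ :=
      ENNReal.rpow_lt_top_of_nonneg (by norm_num) (by simpa using this.ne)
    rw [e] at h2
    simpa using h2.ne
  exact ENNReal.add_ne_top.mpr ⟨key Φ hΦ.continuous hc,
    key _ (hΦ.continuous_fderiv (by simp)) (hc.fderiv ℝ)⟩

/-- Here Φ need not vanish near S. This generality is required because the approximants in `IsTrace`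
are arbitrary smooth functions. -/
theorem HasTraceBounds.exists_norm_toLp_le (h : HasTraceBounds B S) : ∃ C : ℝ,
    ∀ (u : H1 (B \ S)) (Φ : Plane → ℂ) (hm : MemLp Φ 2 (arc (frontier B))), H1.IsSmooth u Φ →
      ‖hm.toLp Φ‖ ≤ C * ‖u‖ := by
  obtain ⟨C, hC, hl⟩ := h.l2
  refine ⟨√C.toReal, fun u Φ hm hu => norm_le_of_enorm_sq_le hC ?_⟩
  refine (L2.enorm_sq _).trans_le (le_trans (le_of_eq (lintegral_congr_ae ?_))
    ((hl Φ hu.1).trans (mul_le_mul' le_rfl (hu.lintegral_le h.isOpen))))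
  filter_upwards [hm.coeFn_toLp] with x hx
  rw [hx]

variable [IsFiniteMeasure (arc (frontier B))]

theorem HasTraceBounds.exists_trace_of_smooth (h : HasTraceBounds B S) {Φ : Plane → ℂ}
    (hΦ : ContDiff ℝ ∞ Φ) (hc : HasCompactSupport Φ) (hd : Disjoint (tsupport Φ) S) :
    ∃ g : H12 (arc (frontier B)), H12.toL2 _ g =ᵐ[arc (frontier B)] Φ := by
  obtain ⟨C, hC, hk⟩ := h.kern
  exact H12.exists_of_continuous hΦ.continuous hc
    ((hk Φ hΦ hd).trans_lt (ENNReal.mul_lt_top hC.lt_top (sobolev_ne_top hΦ hc).lt_top)).ne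

theorem HasTraceBounds.exists_norm_trace_le (h : HasTraceBounds B S) : ∃ C : ℝ,
    ∀ (u : H1 (B \ S)) (Φ : Plane → ℂ) (g : H12 (arc (frontier B))), H1.IsSmooth u Φ →
      Disjoint (tsupport Φ) S → H12.toL2 _ g =ᵐ[arc (frontier B)] Φ → ‖g‖ ≤ C * ‖u‖ := by
  obtain ⟨C, hC, hk⟩ := h.kern
  obtain ⟨C', hC', hl⟩ := h.l2
  refine ⟨√(C' + C).toReal, fun u Φ g hu hd hg =>
    norm_le_of_enorm_sq_le (ENNReal.add_ne_top.mpr ⟨hC', hC⟩) ?_⟩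
  refine (H12.enorm_sq_le (measurable_kern hu.1.continuous) hg).trans ?_
  refine (add_le_add (hl Φ hu.1) (hk Φ hu.1 hd)).trans ?_
  rw [← add_mul]
  exact mul_le_mul' le_rfl (hu.lintegral_le h.isOpen)

/-- `γ` maps smooth functions to their restrictions to `∂B`. -/
def IsTraceOperator (γ : vanishing B S →L[ℂ] H12 (arc (frontier B))) : Prop :=
  ∀ (u : vanishing B S) (Φ : Plane → ℂ), H1.IsSmooth u.1 Φ → Disjoint (tsupport Φ) S →
    H12.toL2 _ (γ u) =ᵐ[arc (frontier B)] Φ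

/-- An element of H¹ does not determine its smooth representative outside B \ S, so restriction to
∂B is at first only a relation. The norm bound makes it single-valued, and density of its domain
extends it. -/
theorem HasTraceBounds.exists_isTraceOperator (h : HasTraceBounds B S) :
    ∃ γ : vanishing B S →L[ℂ] H12 (arc (frontier B)), IsTraceOperator γ := by
  have hb := h.exists_norm_trace_le
  obtain ⟨C, hC⟩ := hb
  have ext := exists_extension_of_relation (H := vanishing B S) (X := H12 (arc (frontier B)))
    (fun u g => ∃ Φ, H1.IsSmooth u.1 Φ ∧ Disjoint (tsupport Φ) S ∧
      H12.toL2 _ g =ᵐ[arc (frontier B)] Φ) ?_ ?_ ?_ (C := C) ?_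
  · refine ext.imp fun γ hγ u Φ hu hd => ?_
    have hg := h.exists_trace_of_smooth hu.1 hu.2.1 hd
    obtain ⟨g, hg⟩ := hg
    have := hγ u g ⟨Φ, hu, hd, hg⟩
    exact (congrArg (H12.toL2 (arc (frontier B))) this).symm ▸ hg
  · rintro u v x y ⟨Φ, hu, hd, hx⟩ ⟨Ψ, hv, hd', hy⟩
    refine ⟨Φ + Ψ, hu.add hv, (hd.union_left hd').mono_left (tsupport_add Φ Ψ), ?_⟩
    rw [map_add]
    filter_upwards [Lp.coeFn_add (H12.toL2 (arc (frontier B)) x) (H12.toL2 _ y), hx, hy]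
      with z h1 h2 h3
    rw [h1, Pi.add_apply, Pi.add_apply, h2, h3]
  · rintro r u x ⟨Φ, hu, hd, hx⟩
    refine ⟨r • Φ, hu.smul r,
      hd.mono_left (closure_mono (Function.support_const_smul_subset r Φ)), ?_⟩
    rw [map_smul]
    filter_upwards [Lp.coeFn_smul r (H12.toL2 (arc (frontier B)) x), hx] with z h1 h2
    rw [h1, Pi.smul_apply, Pi.smul_apply, h2]
  · refine dense_smooth.mono ?_
    rintro u ⟨Φ, hu, hd⟩
    have hg := h.exists_trace_of_smooth hu.1 hu.2.1 hd
    obtain ⟨g, hg⟩ := hg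
    exact ⟨g, Φ, hu, hd, hg⟩
  · rintro u x ⟨Φ, hu, hd, hx⟩
    exact hC u.1 Φ x hu hd hx

end

/-! ### Uniqueness and conjugation of traces, and the weak Robin problem -/

section

variable {B S : Set Plane} [IsFiniteMeasure (arc (frontier B))]
  {γ : vanishing B S →L[ℂ] H12 (arc (frontier B))}

theorem IsTraceOperator.isTrace (hγ : IsTraceOperator γ) (v : vanishing B S) :
    IsTrace B S v.1 (γ v) := by
  have hv := mem_closure_iff_seq_limit.mp v.2
  obtain ⟨w, hw, hlim⟩ := hv
  choose Φ hΦ using hw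
  refine ⟨w, Φ, fun n => (hΦ n).1, hlim, ?_⟩
  have hmem : ∀ n, w n ∈ vanishing B S := fun n => smoothVanishing_le ⟨Φ n, hΦ n⟩
  have h1 : Tendsto (fun n => (⟨w n, hmem n⟩ : vanishing B S)) atTop (𝓝 v) :=
    tendsto_subtype_rng.mpr hlim
  have h2 : Tendsto (fun n => H12.toL2 (arc (frontier B)) (γ ⟨w n, hmem n⟩)) atTop
      (𝓝 (H12.toL2 (arc (frontier B)) (γ v))) :=
    ((H12.toL2 (arc (frontier B))).continuous.comp γ.continuous).continuousAt.tendsto.comp h1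
  refine (((Lp.tendsto_Lp_iff_tendsto_eLpNorm' _ _).mp h2)).congr fun n => eLpNorm_congr_ae ?_
  filter_upwards [hγ ⟨w n, hmem n⟩ (Φ n) (hΦ n).1 (hΦ n).2] with x hx
  exact congrArg (fun t => t - H12.toL2 (arc (frontier B)) (γ v) x) hx

/-- The difference of two approximating sequences tends to 0 in H¹, hence on ∂B in L², and an
H^{1/2} function is determined by its L² class. -/
theorem HasTraceBounds.isTrace_unique (h : HasTraceBounds B S) {u : H1 (B \ S)}
    {f g : H12 (arc (frontier B))} (hf : IsTrace B S u f) (hg : IsTrace B S u g) : f = g := by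
  obtain ⟨v, Φ, hv, hvu, hvf⟩ := hf
  obtain ⟨w, Ψ, hw, hwu, hwg⟩ := hg
  have hb := h.exists_norm_toLp_le
  obtain ⟨C, hC⟩ := hb
  have mΦ : ∀ n, MemLp (Φ n) 2 (arc (frontier B)) := fun n =>
    (hv n).1.continuous.memLp_of_hasCompactSupport (hv n).2.1
  have mΨ : ∀ n, MemLp (Ψ n) 2 (arc (frontier B)) := fun n =>
    (hw n).1.continuous.memLp_of_hasCompactSupport (hw n).2.1
  have key : ∀ {Φ : ℕ → Plane → ℂ} (m : ∀ n, MemLp (Φ n) 2 (arc (frontier B)))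
      {g : H12 (arc (frontier B))}, Tendsto (fun n => eLpNorm (fun x => Φ n x -
        H12.toL2 (arc (frontier B)) g x) 2 (arc (frontier B))) atTop (𝓝 0) →
      Tendsto (fun n => (m n).toLp (Φ n)) atTop (𝓝 (H12.toL2 (arc (frontier B)) g)) := by
    intro Φ m g hl
    refine (Lp.tendsto_Lp_iff_tendsto_eLpNorm' _ _).mpr (hl.congr fun n => eLpNorm_congr_ae ?_)
    filter_upwards [(m n).coeFn_toLp] with x hx
    rw [Pi.sub_apply, hx]
  have h1 := (key mΦ hvf).sub (key mΨ hwg)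
  have h2 : Tendsto (fun n => (mΦ n).toLp (Φ n) - (mΨ n).toLp (Ψ n)) atTop (𝓝 0) := by
    have h3 : Tendsto (fun n => C * ‖v n - w n‖) atTop (𝓝 0) := by
      have := ((hvu.sub hwu).norm).const_mul C
      rwa [sub_self, norm_zero, mul_zero] at this
    refine squeeze_zero_norm (fun n => ?_) h3
    rw [← MemLp.toLp_sub]
    exact hC _ _ _ ((hv n).sub (hw n))
  exact H12.toL2_injective _ (sub_eq_zero.mp (tendsto_nhds_unique h1 h2))

theorem L2.continuous_star {α : Type*} [MeasurableSpace α] {μ : Measure α} :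
    Continuous (star : Lp ℂ 2 μ → Lp ℂ 2 μ) :=
  (Isometry.of_dist_eq fun f g => by
    rw [dist_eq_norm, dist_eq_norm, ← L2.star_sub, L2.norm_star]).continuous

/-- Needed twice: to make the boundary term bilinear, and to see that the conjugate of a function
with zero trace has zero trace. -/
theorem IsTraceOperator.toL2_vconj (hγ : IsTraceOperator γ) (v : vanishing B S) :
    H12.toL2 _ (γ (vconj v)) = star (H12.toL2 _ (γ v)) := by
  refine vanishing_induction (p := fun v => H12.toL2 _ (γ (vconj v)) = star (H12.toL2 _ (γ v)))
    (isClosed_eq ?_ ?_) (fun u hu Φ hΦ hd => ?_) v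
  · exact (H12.toL2 _).continuous.comp (γ.continuous.comp continuous_vconj)
  · exact L2.continuous_star.comp ((H12.toL2 _).continuous.comp γ.continuous)
  · refine Lp.ext ?_
    have hd' : Disjoint (tsupport fun x => star (Φ x)) S :=
      hd.mono_left (closure_mono fun x hx => by simpa using hx)
    filter_upwards [hγ (vconj ⟨u, hu⟩) _ hΦ.conj hd', hγ ⟨u, hu⟩ Φ hΦ hd,
      Lp.coeFn_star (H12.toL2 _ (γ ⟨u, hu⟩))] with x h1 h2 h3
    exact h1.trans (h3.trans (congrArg star h2)).symm

theorem toHm12_apply {σ : Measure Plane} [IsFiniteMeasure σ] (g f : H12 σ) :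
    H12.toHm12 σ g f = ∫ x, H12.toL2 σ g x * H12.toL2 σ f x ∂σ :=
  ContinuousLinearMap.lpPairing_eq_integral _ _ _

/-- The sesquilinear form of the Robin problem as a bilinear form. -/
theorem IsTraceOperator.robin_form_eq (hγ : IsTraceOperator γ) (k η : ℝ) (v w : vanishing B S) :
    inner ℂ (vconj v) w - ((k ^ 2 + 1 : ℝ) : ℂ) * inner ℂ (vfn B S (vconj v)) (vfn B S w) -
      Complex.I * η * inner ℂ (H12.toL2 _ (γ (vconj v))) (H12.toL2 _ (γ w)) =
    (∑ i, ∫ x in B \ S, H1.grad w.1 i x * H1.grad v.1 i x) -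
      (k : ℂ) ^ 2 * (∫ x in B \ S, H1.fn w.1 x * H1.fn v.1 x) -
      Complex.I * η * H12.toHm12 _ (γ w) (γ v) := by
  have comm : ∀ {μ : Measure Plane} (f g : Lp ℂ 2 μ), ∫ x, f x * g x ∂μ = ∫ x, g x * f x ∂μ :=
    fun f g => integral_congr_ae (.of_forall fun x => mul_comm _ _)
  have e1 : inner ℂ (vconj v) w = (∫ x in B \ S, H1.fn w.1 x * H1.fn v.1 x) +
      ∑ i, ∫ x in B \ S, H1.grad w.1 i x * H1.grad v.1 i x :=
    (H1.inner_conj_left v.1 w.1).trans (congrArg₂ (· + ·) (comm _ _)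
      (Finset.sum_congr rfl fun i _ => comm _ _))
  have e2 : inner ℂ (vfn B S (vconj v)) (vfn B S w) =
      ∫ x in B \ S, H1.fn w.1 x * H1.fn v.1 x :=
    (congrArg (fun f => inner ℂ f (vfn B S w)) (H1.fn_conj v.1)).trans
      ((L2.inner_star_left _ _).trans (comm _ _))
  have e3 : inner ℂ (H12.toL2 _ (γ (vconj v))) (H12.toL2 _ (γ w)) =
      H12.toHm12 _ (γ w) (γ v) :=
    (congrArg (fun f => inner ℂ f (H12.toL2 _ (γ w))) (hγ.toL2_vconj v)).trans
      ((L2.inner_star_left _ _).trans ((comm _ _).trans (toHm12_apply _ _).symm))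
  -- The extra 1 in k² + 1 cancels the L² part of the H¹ inner product.
  have alg : ∀ X Y Z : ℂ, X + Y - ((k ^ 2 + 1 : ℝ) : ℂ) * X - Complex.I * η * Z =
      Y - (k : ℂ) ^ 2 * X - Complex.I * η * Z := fun X Y Z => by push_cast; ring
  exact (congrArg₂ (· - ·) (congrArg₂ (· - ·) e1 (congrArg _ e2)) (congrArg _ e3)).trans
    (alg _ _ _)

theorem integral_neg_smul_mul {α : Type*} [MeasurableSpace α] {μ : Measure α} (c : ℂ)
    (f : Lp ℂ 2 μ) (g : α → ℂ) :
    ∫ x, (-(c • f) : Lp ℂ 2 μ) x * g x ∂μ = -(c * ∫ x, f x * g x ∂μ) := by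
  rw [← integral_const_mul, ← integral_neg]
  refine integral_congr_ae ?_
  filter_upwards [Lp.coeFn_neg (c • f), Lp.coeFn_smul c f] with x h1 h2
  rw [h1, Pi.neg_apply, h2, Pi.smul_apply, smul_eq_mul]
  ring

/-- The support lies in the open set B, which is disjoint from its frontier. -/
theorem IsTraceOperator.eq_zero_of_isTest (hγ : IsTraceOperator γ) (hB : IsOpen B)
    {v : vanishing B S} {φ : Plane → ℂ} (hφ : IsTest (B \ S) φ) (hv : H1.IsSmooth v.1 φ) :
    γ v = 0 := by
  refine H12.toL2_injective _ (Eq.trans (Lp.ext ?_) (map_zero _).symm)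
  have hd : Disjoint (tsupport φ) S :=
    Set.disjoint_left.mpr fun x hx hxS => (hφ.2.2 hx).2 hxS
  have hf : ∀ᵐ x ∂(arc (frontier B)), x ∈ frontier B :=
    ae_restrict_mem isClosed_frontier.measurableSet
  filter_upwards [hγ v φ hv hd, hf, Lp.coeFn_zero ℂ 2 (arc (frontier B))] with x h1 h2 h3
  refine (h1.trans ?_).trans h3.symm
  refine image_eq_zero_of_notMem_tsupport fun hx => ?_
  rw [hB.frontier_eq] at h2
  exact h2.2 (hφ.2.2 hx).1

theorem add_smul_add_smul {M : Type*} [AddCommGroup M] [Module ℂ M] (ψ t : M) (c : ℂ) :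
    ψ + c • t + c • t = ψ + (2 * c) • t := by
  rw [two_mul, add_smul, add_assoc]

/-- The identity behind the theorem: eliminating the normal derivative ν from the two Robin data
leaves twice the impedance times the trace. -/
theorem eq_add_two_smul {M : Type*} [AddCommGroup M] [Module ℂ M] {c : ℂ} {ν t ψ θ : M}
    (h : ν - c • t = ψ) (h' : ν + c • t = θ) : θ = ψ + (2 * c) • t := by
  rw [← h, ← h', two_mul, add_smul]
  abel

/-- The weak form of the Robin problem `Δw + k² w = 0`, `∂ₙ w - iη w = ψ`. -/
def IsWeakSolution (γ : vanishing B S →L[ℂ] H12 (arc (frontier B))) (k η : ℝ)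
    (ψ : Hm12 (arc (frontier B))) (w : vanishing B S) : Prop :=
  ∀ v : vanishing B S, (∑ i, ∫ x in B \ S, H1.grad w.1 i x * H1.grad v.1 i x) -
    (k : ℂ) ^ 2 * (∫ x in B \ S, H1.fn w.1 x * H1.fn v.1 x) -
    Complex.I * η * H12.toHm12 _ (γ w) (γ v) = ψ (γ v)

variable {k η : ℝ} {ψ θ : Hm12 (arc (frontier B))}

/-- The Laplacian in Green's formula must be -k²w by the fundamental lemma, and the given trace must
be γ w by uniqueness; the weak form is then Green's formula with ν eliminated. -/
theorem IsTraceOperator.exists_isWeakSolution (hγ : IsTraceOperator γ) (h : HasTraceBounds B S)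
    (hθ : IsRtR B S k η ψ θ) : ∃ w, IsWeakSolution γ k η ψ w ∧
      θ = ψ + (2 * (Complex.I * η)) • H12.toHm12 _ (γ w) := by
  obtain ⟨w, g, ν, hlap, hvan, htr, hnd, hψ, hθ⟩ := hθ
  obtain ⟨q, hq, hν⟩ := hnd
  have hqw : q = -((k : ℂ) ^ 2 • H1.fn w) :=
    Lp.ae_eq_of_integral_test h.isOpen _ _ fun φ hφ =>
      neg_injective ((hq φ hφ).symm.trans (hlap φ hφ))
  have hg : g = γ ⟨w, hvan⟩ := h.isTrace_unique htr (hγ.isTrace ⟨w, hvan⟩)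
  subst hqw hg
  refine ⟨⟨w, hvan⟩, fun v => ?_, eq_add_two_smul hψ hθ⟩
  have alg : ∀ {N X Y Z Q P : ℂ}, N = Y + Q → Q = -((k : ℂ) ^ 2 * X) →
      N - Complex.I * η * Z = P → Y - (k : ℂ) ^ 2 * X - Complex.I * η * Z = P := by
    rintro N X Y Z Q P rfl rfl rfl
    ring
  exact alg (hν v.1 v.2 (γ v) (hγ.isTrace v)) (integral_neg_smul_mul _ _ _)
    (congrArg (fun φ : Hm12 (arc (frontier B)) => φ (γ v)) hψ)

/-- Test functions are admissible in the weak form and have zero trace, so both boundary terms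
disappear. -/
theorem IsTraceOperator.isLaplacian (hγ : IsTraceOperator γ) (hB : IsOpen B) {w : vanishing B S}
    (hw : IsWeakSolution γ k η ψ w) : IsLaplacian w.1 (-((k : ℂ) ^ 2 • H1.fn w.1)) := by
  intro φ hφ
  have hs := H1.isSmooth_ofTest hφ
  have hd : Disjoint (tsupport φ) S :=
    Set.disjoint_left.mpr fun x hx hxS => (hφ.2.2 hx).2 hxS
  have hmem : H1.ofTest hφ ∈ vanishing B S := smoothVanishing_le ⟨φ, hs, hd⟩
  have h0 : γ ⟨H1.ofTest hφ, hmem⟩ = 0 := hγ.eq_zero_of_isTest hB hφ hs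
  have hz : ∀ ψ : Hm12 (arc (frontier B)), ψ (γ ⟨H1.ofTest hφ, hmem⟩) = 0 := fun ψ =>
    (congrArg ψ h0).trans (map_zero ψ)
  have alg : ∀ {X X' Y Y' Z P Q : ℂ}, Y - (k : ℂ) ^ 2 * X - Complex.I * η * Z = P → Z = 0 →
      P = 0 → X = X' → Y = Y' → Q = -((k : ℂ) ^ 2 * X') → Y' = -Q := by
    rintro X X' Y Y' Z P Q h rfl rfl rfl rfl rfl
    linear_combination h
  refine alg (hw ⟨H1.ofTest hφ, hmem⟩) (hz _) (hz _) (integral_congr_ae ?_)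
    (Finset.sum_congr rfl fun i _ => integral_congr_ae ?_) (integral_neg_smul_mul _ _ _)
  · filter_upwards [hs.2.2] with x hx
    rw [hx]
  · filter_upwards [H1.grad_ofTest hφ i] with x hx
    rw [hx]

/-- Take ψ + iη γw as normal derivative; Green's formula for it is the weak form. It is demanded for
every trace of v in the sense of `IsTrace`, hence the appeal to uniqueness. -/
theorem IsTraceOperator.isRtR_of_isWeakSolution (hγ : IsTraceOperator γ) (hB : IsOpen B)
    (h : HasTraceBounds B S) {w : vanishing B S} (hw : IsWeakSolution γ k η ψ w) :
    IsRtR B S k η ψ (ψ + (2 * (Complex.I * η)) • H12.toHm12 _ (γ w)) := by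
  have hlap := hγ.isLaplacian hB hw
  refine ⟨w.1, γ w, ψ + (Complex.I * η) • H12.toHm12 _ (γ w), hlap, w.2,
    hγ.isTrace _, ⟨_, hlap, fun v hv f hf => ?_⟩, add_sub_cancel_right _ _, ?_⟩
  · have hfv : f = γ ⟨v, hv⟩ := h.isTrace_unique hf (hγ.isTrace ⟨v, hv⟩)
    subst hfv
    have alg : ∀ {X Y Z P Q : ℂ}, Y - (k : ℂ) ^ 2 * X - Complex.I * η * Z = P →
        Q = -((k : ℂ) ^ 2 * X) → P + Complex.I * η * Z = Y + Q := by
      rintro X Y Z P Q rfl rfl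
      ring
    exact alg (hw ⟨v, hv⟩) (integral_neg_smul_mul _ _ _)
  · exact add_smul_add_smul ψ _ _

/-- The solution operator of the Robin problem; the trace of a solution is unique. -/
theorem IsTraceOperator.exists_solution (hγ : IsTraceOperator γ)
    (hc : IsCompactOperator (vfn B S)) (k : ℝ) {η : ℝ} (hη : η ≠ 0) :
    ∃ R : Hm12 (arc (frontier B)) →L[ℂ] vanishing B S, (∀ ψ, IsWeakSolution γ k η ψ (R ψ)) ∧
      ∀ ψ w, IsWeakSolution γ k η ψ w → γ w = γ (R ψ) := by
  have hJγ : ∀ u, γ u = 0 → γ (vconj u) = 0 := fun u hu => by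
    refine H12.toL2_injective _ ((hγ.toL2_vconj u).trans ?_)
    have h0 : H12.toL2 (arc (frontier B)) (γ u) = 0 :=
      (congrArg (H12.toL2 (arc (frontier B))) hu).trans (map_zero (H12.toL2 (arc (frontier B))))
    have h1 : ‖star (H12.toL2 (arc (frontier B)) (γ u))‖ = 0 :=
      (L2.norm_star _).trans (norm_eq_zero.mpr h0)
    exact (norm_eq_zero.mp h1).trans (map_zero (H12.toL2 (arc (frontier B)))).symm
  have hex := @exists_robin_solution (vanishing B S) (Lp ℂ 2 (volume.restrict (B \ S)))
    _ _ _ _ _ _ (H12 (arc (frontier B))) (Lp ℂ 2 (arc (frontier B))) _ _ _ _ _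
  have hex := hex hc γ (H12.toL2_injective _) vconj_vconj
    (fun u v => H1.inner_conj_conj u.1 v.1) hJγ (k ^ 2 + 1) hη
  obtain ⟨R, hR, hR'⟩ := hex
  exact ⟨R, fun ψ v => (hγ.robin_form_eq k η v (R ψ)).symm.trans (hR ψ v),
    fun ψ w hw => hR' ψ w fun v => (hγ.robin_form_eq k η v w).trans (hw v)⟩

end

/-! ### The block of the Robin-to-Robin map -/

section

variable {C Γ : Set Plane} [IsFiniteMeasure (arc Γ)] [IsFiniteMeasure (arc C)]

/-- Elements of H̃^{1/2}(C) vanish off C, so the L² pairing over Γ is the pairing over C. Thus the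
restriction to C of a trace is again an H^{1/2}(C) function. -/
theorem restrictDual_toHm12 (hC : MeasurableSet C) (h : C ⊆ Γ) (g : H12 (arc Γ)) :
    restrictDual C Γ (H12.toHm12 _ g) = inclHalf h (H12.restrict h g) := by
  refine ContinuousLinearMap.ext fun f => ?_
  have e : arc C = (arc Γ).restrict C := by
    rw [arc, arc, Measure.restrict_restrict hC, Set.inter_eq_left.mpr h]
  have h1 : H12.toHm12 (arc Γ) g f.1 = ∫ x, H12.toL2 _ g x * H12.toL2 _ f.1 x ∂(arc C) := by
    rw [toHm12_apply, e]
    refine (setIntegral_eq_integral_of_ae_compl_eq_zero ?_).symm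
    filter_upwards [f.2] with x hx hxC
    rw [hx hxC, mul_zero]
  refine h1.trans (Eq.trans (integral_congr_ae ?_)
    (toHm12_apply (H12.restrict h g) (H12.restrict h f.1)).symm)
  filter_upwards [L2.coeFn_mono (arc_mono h) (H12.toL2 _ g),
    L2.coeFn_mono (arc_mono h) (H12.toL2 _ f.1)] with x hx hx'
  exact congrArg₂ (· * ·) hx.symm hx'.symm

variable {B S : Set Plane} [IsFiniteMeasure (arc (frontier B))]

/-- Structure of the diagonal block of the Robin-to-Robin map. -/
theorem exists_isRtRBlock_iff (hB : IsOpen B) (hS : HasTraceBounds B S)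
    (hc : IsCompactOperator (vfn B S)) (hC : MeasurableSet C) (h : C ⊆ frontier B) (k : ℝ) {η : ℝ}
    (hη : η ≠ 0) : ∃ K : HTildem12 C →L[ℂ] H12 (arc C), ∀ φ ψ,
      IsRtRBlock B S C h k η φ ψ ↔ ψ = inclTilde h φ + inclHalf h (K φ) := by
  have hγ := hS.exists_isTraceOperator
  obtain ⟨γ, hγ⟩ := hγ
  have hR := hγ.exists_solution hc k hη
  obtain ⟨R, hR, hR'⟩ := hR
  let P : HTildem12 C →L[ℂ] Hm12 (arc (frontier B)) :=
    ContinuousLinearMap.precomp ℂ (H12.restrict h)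
  -- Extend the data by zero, solve, take the trace, restrict to C, multiply by 2iη.
  let K : HTildem12 C →L[ℂ] H12 (arc C) :=
    (2 * (Complex.I * η)) • (H12.restrict h).comp (γ.comp (R.comp P))
  have key : ∀ φ (g : H12 (arc (frontier B))), restrictDual C (frontier B)
      (extendZero h φ + (2 * (Complex.I * η)) • H12.toHm12 _ g) =
        inclTilde h φ + inclHalf h ((2 * (Complex.I * η)) • H12.restrict h g) := by
    intro φ g
    refine ContinuousLinearMap.ext fun f => ?_
    have h1 : H12.toHm12 (arc (frontier B)) g f.1 =
        H12.toHm12 (arc C) (H12.restrict h g) (H12.restrict h f.1) :=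
      congrArg (fun ψ => ψ f) (restrictDual_toHm12 hC h g)
    have h2 : H12.toHm12 (arc C) ((2 * (Complex.I * η)) • H12.restrict h g) (H12.restrict h f.1) =
        2 * (Complex.I * η) * H12.toHm12 (arc C) (H12.restrict h g) (H12.restrict h f.1) :=
      congrArg (fun ψ => ψ (H12.restrict h f.1)) (map_smul (H12.toHm12 (arc C)) _ _)
    exact congrArg (fun t => φ (H12.restrict h f.1) + t)
      ((congrArg (fun t => 2 * (Complex.I * η) * t) h1).trans h2.symm)
  refine ⟨K, fun φ ψ => ⟨?_, ?_⟩⟩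
  · rintro ⟨θ, hθ, rfl⟩
    have hw := hγ.exists_isWeakSolution hS hθ
    obtain ⟨w, hw, rfl⟩ := hw
    have hwR := hR' _ w hw
    exact (key φ (γ w)).trans (congrArg (fun g => inclTilde h φ + inclHalf h
      ((2 * (Complex.I * η)) • H12.restrict h g)) hwR)
  · rintro rfl
    exact ⟨_, hγ.isRtR_of_isWeakSolution hB hS (hR (extendZero h φ)), (key φ _).symm⟩

end

end RtR

end

-- Each equivalence contains both claims: from right to left a solution exists for every φ; from
-- left to right the outgoing data on C are the same for every solution and have the stated form.
open RtR in
theorem theorem2 (a b c d e k η : ℝ) (hab : a < b) (hbe : b < e) (hcd : c < d)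
    (hk : 0 < k) (hη : η ≠ 0) (Sj Sl : Set Plane)
    (hSj : IsCompact Sj) (hSjB : Sj ⊆ box a b c d)
    (hSl : IsCompact Sl) (hSlB : Sl ⊆ box b e c d) :
    (∃ Kj : HTildem12 (interface (box a b c d) (box b e c d)) →L[ℂ]
        H12 (arc (interface (box a b c d) (box b e c d))),
      ∀ φ ψ, IsRtRBlock (box a b c d) Sj (interface (box a b c d) (box b e c d))
          Set.inter_subset_left k η φ ψ ↔
        ψ = inclTilde Set.inter_subset_left φ + inclHalf Set.inter_subset_left (Kj φ)) ∧
    (∃ Kl : HTildem12 (interface (box a b c d) (box b e c d)) →L[ℂ]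
        H12 (arc (interface (box a b c d) (box b e c d))),
      ∀ φ ψ, IsRtRBlock (box b e c d) Sl (interface (box a b c d) (box b e c d))
          Set.inter_subset_right k η φ ψ ↔
        ψ = inclTilde Set.inter_subset_right φ + inclHalf Set.inter_subset_right (Kl φ)) := by
  have hC : MeasurableSet (interface (box a b c d) (box b e c d)) :=
    (isClosed_frontier.inter isClosed_frontier).measurableSet
  exact ⟨exists_isRtRBlock_iff (isOpen_box a b c d) (hasTraceBounds_box hab hcd hSj hSjB)
      (isCompactOperator_vfn hab hcd rfl hSj) hC Set.inter_subset_left k hη,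
    exists_isRtRBlock_iff (isOpen_box b e c d) (hasTraceBounds_box hbe hcd hSl hSlB)
      (isCompactOperator_vfn hbe hcd rfl hSl) hC Set.inter_subset_right k hη⟩
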